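/- Let $N\ge 1$, let $\Omega\subset\mathbb R^N$ be open and bounded, $1<p<\infty$, $p'=p/(p-1)$, and let $\alpha,\beta,\alpha_0>0$. Let $a:\Omega\times\mathbb R\times\mathbb R^N\to\mathbb R^N$, $a_0:\Omega\times\mathbb R\to\mathbb R$ and $H:\Omega\times\mathbb R\times\mathbb R^N\to\mathbb R$ be Carathéodory functions such that, for a.e. $x\in\Omega$ and all $s\in\mathbb R$, $\xi,\eta\in\mathbb R^N$, \[ a(x,s,\xi)\cdot\xi\ge\alpha|\xi|^p,\qquad |a(x,s,\xi)|\le\beta\,(h(x)+|s|^{p-1}+|\xi|^{p-1}),\qquad (a(x,s,\xi)-a(x,s,\eta))\cdot(\xi-\eta)>0\ \text{ if }\xi\ne\eta, \] \[ |a_0(x,s)|\le\beta\,(h(x)+|s|^{p-1}),\qquad a_0(x,s)\,s\ge\alpha_0|s|^p,\qquad |H(x,s,\xi)|\le f(x)+b(|s|)\,|\xi|^p, \] where $h\in L^{p'}(\Omega)$, $f\in L^\infty(\Omega)$, $f\ge 0$, and $b:[0,\infty)\to(0,\infty)$ is continuous and nondecreasing. Let $\psi\in W_0^{1,p}(\Omega)\cap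 L^\infty(\Omega)$ and $\mathcal C(\psi)=\{v\in W_0^{1,p}(\Omega): v\ge\psi\text{ a.e. in }\Omega\}$. A solution of the obstacle problem with Hamiltonian $H$ is a function $u\in\mathcal C(\psi)\cap L^\infty(\Omega)$ such that \[ \int_\Omega a(x,u,Du)\cdot D(v-u)+\int_\Omega a_0(x,u)(v-u)+\int_\Omega H(x,u,Du)(v-u)\ge 0\qquad\text{for all } v\in\mathcal C(\psi)\cap L^\infty(\Omega). \] For $j\ge1$ let $H_j=H/(1+\tfrac1j|H|)$, and let $u_j$ be any solution of the obstacle problem with $H_j$ in place of $H$. Put \[ C_\infty=\max\Big\{\Big(\frac{\|f\|_{\infty}}{\alpha_0}\Big)^{1/(p-1)},\ \|\psi\|_{\infty}\Big\},\qquad \lambda=\frac{b(C_\infty)^2}{4\alpha^2}, \] and, for $\Psi\in\mathcal C(\psi)\cap L^\infty(\Omega)$, $\tilde C=C_\infty+\|\Psi\|_\infty$. The quantity $C_\infty$ is a continuous function of $(\|f\|_\infty,\alpha_0,p,\|\psi\|_\infty)$ on $[0,\infty)\times(0,\infty)\times(1,\infty)\times[0,\infty)$. Then: (1) The sequence $(u_j)$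 has a subsequence that converges strongly in $W_0^{1,p}(\Omega)$. (2) If $u$ is the strong $W_0^{1,p}(\Omega)$ limit of some subsequence of $(u_j)$, then $u$ is a solution of the obstacle problem with Hamiltonian $H$. (3) There are a constant $M>0$ depending only on $\alpha,p,|\Omega|,\beta$ and a constant $M'>0$ depending only on $\alpha,p,|\Omega|,\beta,b(0)$ such that, for $w=u_j$ with any $j\ge1$ and for $w=u$ with any $u$ as in (2), one has $\|w\|_{\infty}\le C_\infty$ and, for every $\Psi\in\mathcal C(\psi)\cap L^\infty(\Omega)$, both \[ \int_\Omega|Dw|^p\le M\Big[(1+\lambda\tilde C^2)e^{4\lambda\tilde C^2}\Big]^p\Big\{\tilde C\big(\|f\|_\infty+\|h\|_{p'}+C_\infty^{p-1}\big)+\|D\Psi\|_p^p+\|D\Psi\|_p\big(\|h\|_{p'}+C_\infty^{p-1}\big)\Big\} \] and \[ \int_\Omega|Dw|^p\le M'\Big[(1+\lambda\tilde C^2)e^{4\lambda\tilde C^2}\Big]^p\Big\{\|f\|_\infty+\|h\|_{p'}+\|D\Psi\|_p^p+\|D\Psi\|_p\big(\|h\|_{p'}+C_\infty^{p-1}\big)+C_\infty^{p-1}\Big\}.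 \] -/

import Mathlib

open MeasureTheory Filter Topology
open scoped ENNReal ContDiff

noncomputable section

/-- The Euclidean space `ℝᴺ`. -/
abbrev RN (N : ℕ) : Type := EuclideanSpace ℝ (Fin N)

/-- `φ ∈ C_c^∞(Ω)`. -/
structure IsTestFun {N : ℕ} (Ω : Set (RN N)) (φ : RN N → ℝ) : Prop where
  smooth : ContDiff ℝ ∞ φ
  compactSupport : HasCompactSupport φ
  support_subset : tsupport φ ⊆ Ω

/-- `G` is the weak (distributional) gradient of `u` in `Ω`:
`∫_Ω u ∇φ = - ∫_Ω φ G` for all `φ ∈ C_c^∞(Ω)`. -/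
def HasWeakGradient {N : ℕ} (Ω : Set (RN N)) (u : RN N → ℝ) (G : RN N → RN N) : Prop :=
  ∀ φ : RN N → ℝ, IsTestFun Ω φ →
    ∫ x in Ω, u x • gradient φ x = - ∫ x in Ω, φ x • G x

/-- An element of `W₀^{1,p}(Ω)`: a function `u ∈ L^p(Ω)` with a weak gradient `Du ∈ L^p(Ω)`
such that `u` is the limit in the `W^{1,p}` norm of functions in `C_c^∞(Ω)`. Both `u` and `Du`
are given by representatives (values outside `Ω` and on null sets play no role). -/
structure W01 {N : ℕ} (Ω : Set (RN N)) (p : ℝ) where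
  toFun : RN N → ℝ
  grad : RN N → RN N
  memLp : MemLp toFun (ENNReal.ofReal p) (volume.restrict Ω)
  memLp_grad : MemLp grad (ENNReal.ofReal p) (volume.restrict Ω)
  hasWeakGradient : HasWeakGradient Ω toFun grad
  approx : ∃ φ : ℕ → RN N → ℝ, (∀ n, IsTestFun Ω (φ n)) ∧
    Tendsto (fun n => eLpNorm (fun x => φ n x - toFun x) (ENNReal.ofReal p)
      (volume.restrict Ω)) atTop (𝓝 0) ∧
    Tendsto (fun n => eLpNorm (fun x => gradient (φ n) x - grad x) (ENNReal.ofReal p)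
      (volume.restrict Ω)) atTop (𝓝 0)

/-- Strong convergence `u n → w` in `W₀^{1,p}(Ω)`. -/
def W01.StrongConv {N : ℕ} {Ω : Set (RN N)} {p : ℝ} (u : ℕ → W01 Ω p) (w : W01 Ω p) : Prop :=
  Tendsto (fun n => eLpNorm (fun x => (u n).toFun x - w.toFun x) (ENNReal.ofReal p)
    (volume.restrict Ω)) atTop (𝓝 0) ∧
  Tendsto (fun n => eLpNorm (fun x => (u n).grad x - w.grad x) (ENNReal.ofReal p)
    (volume.restrict Ω)) atTop (𝓝 0)

/-- `v ∈ L^∞(Ω)`. -/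
def W01.Bounded {N : ℕ} {Ω : Set (RN N)} {p : ℝ} (v : W01 Ω p) : Prop :=
  MemLp v.toFun ∞ (volume.restrict Ω)

/-- The norm of `L^∞(Ω)`. -/
def supNorm {N : ℕ} (Ω : Set (RN N)) (g : RN N → ℝ) : ℝ :=
  lpNorm g ∞ (volume.restrict Ω)

/-- The obstacle convex set `C(ψ) = {v ∈ W₀^{1,p}(Ω) : v ≥ ψ a.e. in Ω}`. -/
def obstacleSet {N : ℕ} {Ω : Set (RN N)} {p : ℝ} (ψ : W01 Ω p) : Set (W01 Ω p) :=
  {v | ∀ᵐ x ∂(volume.restrict Ω), ψ.toFun x ≤ v.toFun x}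

/-- Carathéodory functions on `Ω × S`: measurable in `x ∈ Ω` for every `s`, continuous in `s` for
almost every `x ∈ Ω`. -/
def IsCaratheodory {N : ℕ} {S T : Type} [TopologicalSpace S] [TopologicalSpace T]
    (Ω : Set (RN N)) (g : RN N → S → T) : Prop :=
  (∀ s : S, AEStronglyMeasurable (fun x => g x s) (volume.restrict Ω)) ∧
  (∀ᵐ x ∂(volume.restrict Ω), Continuous (g x))

/-- The structure conditions on `a`, `a₀`, `H` and their data `h`, `f`, `b`. -/
structure NaturalGrowthData {N : ℕ} (Ω : Set (RN N)) (p α β α₀ : ℝ)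
    (a : RN N → ℝ → RN N → RN N) (a₀ : RN N → ℝ → ℝ) (H : RN N → ℝ → RN N → ℝ)
    (h f : RN N → ℝ) (b : ℝ → ℝ) : Prop where
  a_caratheodory : IsCaratheodory Ω (fun x (q : ℝ × RN N) => a x q.1 q.2)
  a_coercive : ∀ᵐ x ∂(volume.restrict Ω), ∀ (s : ℝ) (ξ : RN N),
    α * ‖ξ‖ ^ p ≤ inner ℝ (a x s ξ) ξ
  a_growth : ∀ᵐ x ∂(volume.restrict Ω), ∀ (s : ℝ) (ξ : RN N),
    ‖a x s ξ‖ ≤ β * (h x + |s| ^ (p - 1) + ‖ξ‖ ^ (p - 1))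
  a_monotone : ∀ᵐ x ∂(volume.restrict Ω), ∀ (s : ℝ) (ξ η : RN N), ξ ≠ η →
    0 < inner ℝ (a x s ξ - a x s η) (ξ - η)
  h_memLp : MemLp h (ENNReal.ofReal (p / (p - 1))) (volume.restrict Ω)
  a₀_caratheodory : IsCaratheodory Ω a₀
  a₀_growth : ∀ᵐ x ∂(volume.restrict Ω), ∀ s : ℝ, |a₀ x s| ≤ β * (h x + |s| ^ (p - 1))
  a₀_coercive : ∀ᵐ x ∂(volume.restrict Ω), ∀ s : ℝ, α₀ * |s| ^ p ≤ a₀ x s * s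
  H_caratheodory : IsCaratheodory Ω (fun x (q : ℝ × RN N) => H x q.1 q.2)
  H_growth : ∀ᵐ x ∂(volume.restrict Ω), ∀ (s : ℝ) (ξ : RN N),
    |H x s ξ| ≤ f x + b |s| * ‖ξ‖ ^ p
  f_memLp : MemLp f ∞ (volume.restrict Ω)
  f_nonneg : ∀ᵐ x ∂(volume.restrict Ω), 0 ≤ f x
  b_pos : ∀ t : ℝ, 0 ≤ t → 0 < b t
  b_mono : MonotoneOn b (Set.Ici 0)
  b_cont : ContinuousOn b (Set.Ici 0)

/-- `u` solves the obstacle problem: `u ∈ C(ψ) ∩ L^∞(Ω)` and, for all `v ∈ C(ψ) ∩ L^∞(Ω)`,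
`⟨A(u), v - u⟩ + ∫_Ω a₀(x,u)(v - u) + ∫_Ω H(x,u,Du)(v - u) ≥ 0`, where
`⟨A(u), w⟩ = ∫_Ω a(x,u,Du) · Dw`. -/
def IsObstacleSolution {N : ℕ} {Ω : Set (RN N)} {p : ℝ}
    (a : RN N → ℝ → RN N → RN N) (a₀ : RN N → ℝ → ℝ) (H : RN N → ℝ → RN N → ℝ)
    (ψ u : W01 Ω p) : Prop :=
  u ∈ obstacleSet ψ ∧ u.Bounded ∧
  ∀ v : W01 Ω p, v ∈ obstacleSet ψ → v.Bounded →
    0 ≤ (∫ x in Ω, inner ℝ (a x (u.toFun x) (u.grad x)) (v.grad x - u.grad x))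
      + (∫ x in Ω, a₀ x (u.toFun x) * (v.toFun x - u.toFun x))
      + ∫ x in Ω, H x (u.toFun x) (u.grad x) * (v.toFun x - u.toFun x)

/-- The truncated Hamiltonian `H_j = H / (1 + |H| / j)`, used for `j ≥ 1`. -/
def truncH {N : ℕ} (H : RN N → ℝ → RN N → ℝ) (j : ℕ) : RN N → ℝ → RN N → ℝ :=
  fun x s ξ => H x s ξ / (1 + 1 / (j : ℝ) * |H x s ξ|)

/-- `C_∞ = max {(F / α₀)^{1/(p-1)}, P}`, with `F = ‖f‖_∞` and `P = ‖ψ‖_∞`. -/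
def CInfty (F α₀ p P : ℝ) : ℝ := max ((F / α₀) ^ (1 / (p - 1))) P

/-- `λ = b(C)² / (4 α²)`. -/
def lambdaConst (b : ℝ → ℝ) (α C : ℝ) : ℝ := b C ^ 2 / (4 * α ^ 2)

/-- The factor `[(1 + λ t²) e^{4 λ t²}]^p`. -/
def expFactor (p lam t : ℝ) : ℝ := ((1 + lam * t ^ 2) * Real.exp (4 * lam * t ^ 2)) ^ p

/-- `M [(1 + λ C̃²) e^{4λC̃²}]^p { κ (F + ‖h‖_{p'} + C^{p-1})
  + ‖DΨ‖_p^p + ‖DΨ‖_p (‖h‖_{p'} + C^{p-1}) }`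
with `C̃ = C + ‖Ψ‖_∞` and `λ = b(C)² / (4 α²)`. -/
def gradientBound {N : ℕ} {Ω : Set (RN N)} {p : ℝ} (M κ α F C : ℝ) (h : RN N → ℝ) (b : ℝ → ℝ)
    (Ψ : W01 Ω p) : ℝ :=
  M * expFactor p (lambdaConst b α C) (C + supNorm Ω Ψ.toFun) *
    (κ * (F + lpNorm h (ENNReal.ofReal (p / (p - 1))) (volume.restrict Ω) + C ^ (p - 1))
      + lpNorm Ψ.grad (ENNReal.ofReal p) (volume.restrict Ω) ^ p
      + lpNorm Ψ.grad (ENNReal.ofReal p) (volume.restrict Ω) *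
        (lpNorm h (ENNReal.ofReal (p / (p - 1))) (volume.restrict Ω) + C ^ (p - 1)))

/-- The estimates for `w`, in terms of the data: `‖w‖_∞ ≤ C_∞` and, for every
`Ψ ∈ C(ψ) ∩ L^∞(Ω)`, the bounds on `∫_Ω |Dw|^p` with the constant `M` and the factor
`C̃ = C_∞ + ‖Ψ‖_∞`, and with the constant `M'` and the factor `1`. -/
def SatisfiesEstimates {N : ℕ} {Ω : Set (RN N)} {p : ℝ} (M M' α α₀ : ℝ)
    (h f : RN N → ℝ) (b : ℝ → ℝ) (ψ w : W01 Ω p) : Prop :=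
  let F : ℝ := supNorm Ω f
  let C : ℝ := CInfty F α₀ p (supNorm Ω ψ.toFun)
  eLpNorm w.toFun ∞ (volume.restrict Ω) ≤ ENNReal.ofReal C ∧
  ∀ Ψ : W01 Ω p, Ψ ∈ obstacleSet ψ → Ψ.Bounded →
    (∫ x in Ω, ‖w.grad x‖ ^ p) ≤ gradientBound M (C + supNorm Ω Ψ.toFun) α F C h b Ψ ∧
    (∫ x in Ω, ‖w.grad x‖ ^ p) ≤ gradientBound M' 1 α F C h b Ψ

end

/-! The Hamiltonian may grow like |Du|^p, exactly as fast as the coercive term, so testing with u −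
Ψ gives no estimate. One tests instead with nonlinear functions whose derivative dominates the
function itself. For φ(s) = s e^{λs²} with λ = B²/(4α²) one has αφ' − B|φ| ≥ α/2
(`half_le_deriv_expTest_sub`), so the contribution B|Du|^p |φ| of H is absorbed by the principal
part. Since |H_j| ≤ |H|, the truncated problems obey the same structure conditions with the same f
and b (`NaturalGrowthData.truncH`); every estimate is therefore proved for an arbitrary solution and
is uniform in j.

A priori bounds. The obstacle gives u ≥ −C_∞. For the upper bound, a test function e^{Ku}g(u − C_∞),
with g smooth and vanishing on the negative axis, absorbs H and leaves ∫(a₀ − f)·(test) ≤ 0, while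
a₀ > f wherever u > C_∞ (`IsObstacleSolution.ae_abs_le`). With |u| ≤ C_∞ known, b(|u|) ≤ b(C_∞), and
testing with φ(u − Ψ) plus Young's inequality gives the gradient bound
(`IsObstacleSolution.integral_norm_grad_le`). Its two forms differ only in how the factor ‖φ(u −
Ψ)‖_∞ is estimated.

Compactness. The bounds yield an a.e. convergent subsequence (`W01.exists_subseq_tendsto_ae`, a
Rellich argument with ball averages), and convex combinations place the limit w in W₀^{1,p} and
identify the weak limit of the gradients (`W01.exists_grad_of_tendsto`). Testing with φ(v_n − w)
shows that the integral of the Leray–Lions defect (a(x,v_n,Dv_n) − a(x,v_n,Dw))·(Dv_n − Dw) tends to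
0 (`tendsto_integral_defect_zero`). Strict monotonicity turns this into a.e. convergence of the
gradients. Coercivity bounds |Dv_n|^p by a multiple of the defect plus a fixed integrable function,
so a generalised dominated convergence theorem gives strong convergence
(`NaturalGrowthData.exists_subseq_tendsto_grad`).

Limits. Strong convergence suffices to pass to the limit in all three integrals
(`IsObstacleSolution.of_strongConv`). The limit is then itself a solution for H, so the a priori
bounds apply to it directly. -/

noncomputable section

/-! ### Real-exponent L^p norms and convergence of integrals -/

section Lp

variable {α E : Type*} {m : MeasurableSpace α} {μ : Measure α} [NormedAddCommGroup E] {p : ℝ}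

theorem MeasureTheory.MemLp.integrable_rpow_norm (hp : 0 < p) {f : α → E}
    (hf : MemLp f (ENNReal.ofReal p) μ) : Integrable (fun x => ‖f x‖ ^ p) μ := by
  have := hf.integrable_norm_rpow (by simpa using hp) ENNReal.ofReal_ne_top
  rwa [ENNReal.toReal_ofReal hp.le] at this

theorem memLp_ofReal_iff (hp : 0 < p) {f : α → E} (hf : AEStronglyMeasurable f μ) :
    MemLp f (ENNReal.ofReal p) μ ↔ Integrable (fun x => ‖f x‖ ^ p) μ := by
  have := integrable_norm_rpow_iff hf (p := ENNReal.ofReal p) (by simpa using hp)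
    ENNReal.ofReal_ne_top
  rw [ENNReal.toReal_ofReal hp.le] at this
  exact this.symm

theorem MeasureTheory.MemLp.eLpNorm_ofReal_eq (hp : 0 < p) {f : α → E}
    (hf : MemLp f (ENNReal.ofReal p) μ) :
    eLpNorm f (ENNReal.ofReal p) μ = ENNReal.ofReal ((∫ x, ‖f x‖ ^ p ∂μ) ^ p⁻¹) := by
  have := hf.eLpNorm_eq_integral_rpow_norm (by simpa using hp) ENNReal.ofReal_ne_top
  rwa [ENNReal.toReal_ofReal hp.le] at this

theorem lpNorm_ofReal_eq (hp : 0 < p) {f : α → E} (hf : AEStronglyMeasurable f μ) :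
    lpNorm f (ENNReal.ofReal p) μ = (∫ x, ‖f x‖ ^ p ∂μ) ^ p⁻¹ := by
  have := lpNorm_eq_integral_norm_rpow_toReal (p := ENNReal.ofReal p) (by simpa using hp)
    ENNReal.ofReal_ne_top hf
  rwa [ENNReal.toReal_ofReal hp.le] at this

theorem lpNorm_ofReal_rpow (hp : 0 < p) {f : α → E} (hf : AEStronglyMeasurable f μ) :
    lpNorm f (ENNReal.ofReal p) μ ^ p = ∫ x, ‖f x‖ ^ p ∂μ := by
  rw [lpNorm_ofReal_eq hp hf, ← Real.rpow_mul (integral_nonneg fun x => by positivity),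
    inv_mul_cancel₀ hp.ne', Real.rpow_one]

theorem tendsto_eLpNorm_ofReal_zero_iff {ι : Type*} {l : Filter ι} (hp : 0 < p) {f : ι → α → E}
    (hf : ∀ i, MemLp (f i) (ENNReal.ofReal p) μ) :
    Tendsto (fun i => eLpNorm (f i) (ENNReal.ofReal p) μ) l (𝓝 0) ↔
      Tendsto (fun i => ∫ x, ‖f i x‖ ^ p ∂μ) l (𝓝 0) := by
  have h0 : ∀ i, 0 ≤ ∫ x, ‖f i x‖ ^ p ∂μ := fun i => integral_nonneg fun x => by positivity
  have hfe : (fun i => eLpNorm (f i) (ENNReal.ofReal p) μ) =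
      fun i => ENNReal.ofReal ((∫ x, ‖f i x‖ ^ p ∂μ) ^ p⁻¹) :=
    funext fun i => (hf i).eLpNorm_ofReal_eq hp
  rw [hfe]
  constructor
  · intro h
    have h1 := (ENNReal.tendsto_toReal ENNReal.zero_ne_top).comp h
    have h2 := h1.rpow_const (p := p) (Or.inr hp.le)
    refine (h2.congr fun i => ?_).trans (by simp [Real.zero_rpow hp.ne'])
    simp only [Function.comp]
    rw [ENNReal.toReal_ofReal (by have := h0 i; positivity), ← Real.rpow_mul (h0 i),
      inv_mul_cancel₀ hp.ne', Real.rpow_one]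
  · intro h
    have h2 := h.rpow_const (p := p⁻¹) (Or.inr (by positivity))
    rw [Real.zero_rpow (by positivity)] at h2
    simpa using ENNReal.tendsto_ofReal h2

theorem tendsto_eLpNorm_sub_of_dominated (hp : 0 < p) {f : ℕ → α → E} {f₀ : α → E} {g : α → ℝ}
    (hf : ∀ n, AEStronglyMeasurable (f n) μ)
    (hlim : ∀ᵐ x ∂μ, Tendsto (fun n => f n x) atTop (𝓝 (f₀ x)))
    (hg : MemLp g (ENNReal.ofReal p) μ) (hbd : ∀ n, ∀ᵐ x ∂μ, ‖f n x - f₀ x‖ ≤ g x) :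
    Tendsto (fun n => eLpNorm (fun x => f n x - f₀ x) (ENNReal.ofReal p) μ) atTop (𝓝 0) := by
  have hf0 : AEStronglyMeasurable f₀ μ := aestronglyMeasurable_of_tendsto_ae _ hf hlim
  have hm : ∀ n, MemLp (fun x => f n x - f₀ x) (ENNReal.ofReal p) μ := fun n =>
    MemLp.of_le hg ((hf n).sub hf0) ((hbd n).mono fun x hx => hx.trans (le_abs_self _))
  rw [tendsto_eLpNorm_ofReal_zero_iff hp hm]
  rw [← integral_zero α ℝ (μ := μ)]
  refine tendsto_integral_of_dominated_convergence _
    (fun n => ((hm n).integrable_rpow_norm hp).1) (hg.integrable_rpow_norm hp) (fun n => ?_) ?_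
  · filter_upwards [hbd n] with x hx
    rw [Real.norm_of_nonneg (by positivity)]
    exact Real.rpow_le_rpow (norm_nonneg _) (hx.trans (le_abs_self _)) hp.le
  · filter_upwards [hlim] with x hx
    have h1 : Tendsto (fun n => ‖f n x - f₀ x‖) atTop (𝓝 0) := by
      simpa using (hx.sub_const (f₀ x)).norm
    simpa [Real.zero_rpow hp.ne'] using h1.rpow_const (p := p) (Or.inr hp.le)

theorem exists_seq_tendsto_ae_of_eLpNorm {q : ℝ≥0∞} (hq : q ≠ 0) {f : ℕ → α → E} {f₀ : α → E}
    (hf : ∀ n, AEStronglyMeasurable (f n) μ) (hf0 : AEStronglyMeasurable f₀ μ)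
    (h : Tendsto (fun n => eLpNorm (fun x => f n x - f₀ x) q μ) atTop (𝓝 0)) :
    ∃ ns : ℕ → ℕ, StrictMono ns ∧ ∀ᵐ x ∂μ, Tendsto (fun i => f (ns i) x) atTop (𝓝 (f₀ x)) :=
  (tendstoInMeasure_of_tendsto_eLpNorm hq hf hf0 h).exists_seq_tendsto_ae

theorem tendsto_eLpNorm_one_of_ofReal [IsFiniteMeasure μ] {ι : Type*} {l : Filter ι} (hp : 1 < p)
    {f : ι → α → E} (hf : ∀ i, AEStronglyMeasurable (f i) μ)
    (h : Tendsto (fun i => eLpNorm (f i) (ENNReal.ofReal p) μ) l (𝓝 0)) :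
    Tendsto (fun i => eLpNorm (f i) 1 μ) l (𝓝 0) := by
  have hp1 : (1 : ℝ≥0∞) ≤ ENNReal.ofReal p := by simpa using hp.le
  have h2 := ENNReal.Tendsto.mul_const (b := μ Set.univ ^ (1 / (1 : ℝ≥0∞).toReal -
    1 / (ENNReal.ofReal p).toReal)) h (Or.inr ?_)
  · rw [zero_mul] at h2
    exact tendsto_of_tendsto_of_tendsto_of_le_of_le tendsto_const_nhds h2 (fun _ => zero_le)
      (fun i => eLpNorm_le_eLpNorm_mul_rpow_measure_univ hp1 (hf i))
  · refine ENNReal.rpow_ne_top_of_nonneg ?_ (measure_ne_top _ _)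
    rw [ENNReal.toReal_ofReal (by linarith)]
    have : 1 / p ≤ 1 := by rw [div_le_one (by linarith)]; exact hp.le
    simpa using this

theorem integral_mul_norm_le {F : Type*} [NormedAddCommGroup F] {q : ℝ} (hpq : p.HolderConjugate q)
    {f : α → E} {g : α → F} (hf : MemLp f (ENNReal.ofReal p) μ) (hg : MemLp g (ENNReal.ofReal q) μ) :
    ∫ x, ‖f x‖ * ‖g x‖ ∂μ ≤ (∫ x, ‖f x‖ ^ p ∂μ) ^ (1 / p) * (∫ x, ‖g x‖ ^ q ∂μ) ^ (1 / q) :=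
  integral_mul_le_Lp_mul_Lq_of_nonneg hpq (.of_forall fun _ => norm_nonneg _)
    (.of_forall fun _ => norm_nonneg _) hf.norm hg.norm

theorem integrable_mul_norm {F : Type*} [NormedAddCommGroup F] {q : ℝ} (hpq : p.HolderConjugate q)
    {f : α → E} {g : α → F} (hf : MemLp f (ENNReal.ofReal p) μ) (hg : MemLp g (ENNReal.ofReal q) μ) :
    Integrable (fun x => ‖f x‖ * ‖g x‖) μ := by
  have := hpq.ennrealOfReal
  exact hf.norm.integrable_mul hg.norm

/-- Hölder: a factor bounded in L^p times a factor tending to 0 in L^q. The product error terms of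
the defect estimate are disposed of in this way. -/
theorem tendsto_integral_mul_norm_zero {F : Type*} [NormedAddCommGroup F] {q : ℝ}
    (hpq : p.HolderConjugate q) {f : ℕ → α → E} {g : ℕ → α → F} {K : ℝ}
    (hf : ∀ n, MemLp (f n) (ENNReal.ofReal p) μ) (hg : ∀ n, MemLp (g n) (ENNReal.ofReal q) μ)
    (hK : ∀ n, ∫ x, ‖f n x‖ ^ p ∂μ ≤ K)
    (h0 : Tendsto (fun n => eLpNorm (g n) (ENNReal.ofReal q) μ) atTop (𝓝 0)) :
    Tendsto (fun n => ∫ x, ‖f n x‖ * ‖g n x‖ ∂μ) atTop (𝓝 0) := by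
  have hp := hpq.pos
  have hq := hpq.symm.pos
  rw [tendsto_eLpNorm_ofReal_zero_iff hq hg] at h0
  have h1 := h0.rpow_const (p := 1 / q) (Or.inr (by positivity))
  rw [Real.zero_rpow (by positivity)] at h1
  have h2 := h1.const_mul (K ^ (1 / p))
  rw [mul_zero] at h2
  refine squeeze_zero (fun n => integral_nonneg fun x => by positivity) (fun n => ?_) h2
  refine (integral_mul_norm_le hpq (hf n) (hg n)).trans ?_
  refine mul_le_mul_of_nonneg_right ?_ (Real.rpow_nonneg (integral_nonneg fun x => by positivity) _)
  exact Real.rpow_le_rpow (integral_nonneg fun x => by positivity) (hK n) (by positivity)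

end Lp

theorem exists_seq_tendsto_ae_of_tendsto_integral {α : Type*} {m : MeasurableSpace α}
    {μ : Measure α} {e : ℕ → α → ℝ} (he : ∀ n, Integrable (e n) μ)
    (he0 : ∀ n, ∀ᵐ x ∂μ, 0 ≤ e n x) (helim : Tendsto (fun n => ∫ x, e n x ∂μ) atTop (𝓝 0)) :
    ∃ ns : ℕ → ℕ, StrictMono ns ∧ ∀ᵐ x ∂μ, Tendsto (fun i => e (ns i) x) atTop (𝓝 0) := by
  refine exists_seq_tendsto_ae_of_eLpNorm one_ne_zero (fun n => (he n).1)
    aestronglyMeasurable_const ?_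
  rw [← ENNReal.ofReal_one, tendsto_eLpNorm_ofReal_zero_iff one_pos fun n => ?_]
  · refine helim.congr fun n => integral_congr_ae ?_
    filter_upwards [he0 n] with x hx
    simp [abs_of_nonneg hx]
  · simpa [memLp_one_iff_integrable] using he n

/-- Dominated convergence with a majorant g + e_n, where e_n → 0 only in L¹. The positive part of
|F_n − f| − e_n is dominated by the fixed function g + |f| and tends to 0 a.e., and what is
discarded has integral at most ∫ e_n. This serves for |Dv_n|^p, whose natural majorant contains a
vanishing term that varies with n. -/
theorem integrable_and_tendsto_integral_of_norm_le_add {α : Type*} {m : MeasurableSpace α}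
    {μ : Measure α} {F : ℕ → α → ℝ} {f g : α → ℝ} {e : ℕ → α → ℝ}
    (hF : ∀ n, AEStronglyMeasurable (F n) μ)
    (hlim : ∀ᵐ x ∂μ, Tendsto (fun n => F n x) atTop (𝓝 (f x)))
    (hg : Integrable g μ) (he : ∀ n, Integrable (e n) μ) (he0 : ∀ n, ∀ᵐ x ∂μ, 0 ≤ e n x)
    (helim : Tendsto (fun n => ∫ x, e n x ∂μ) atTop (𝓝 0))
    (hbd : ∀ n, ∀ᵐ x ∂μ, ‖F n x‖ ≤ g x + e n x) :
    Integrable f μ ∧ Tendsto (fun n => ∫ x, F n x ∂μ) atTop (𝓝 (∫ x, f x ∂μ)) := by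
  have hfm : AEStronglyMeasurable f μ := aestronglyMeasurable_of_tendsto_ae _ hF hlim
  have hFi : ∀ n, Integrable (F n) μ := fun n => (hg.add (he n)).mono' (hF n) (hbd n)
  obtain ⟨ns, hns, hae⟩ := exists_seq_tendsto_ae_of_tendsto_integral he he0 helim
  have hfg : ∀ᵐ x ∂μ, ‖f x‖ ≤ g x := by
    filter_upwards [hae, hlim, ae_all_iff.2 hbd] with x h1 h2 h3
    have h4 : Tendsto (fun i => g x + e (ns i) x) atTop (𝓝 (g x + 0)) := tendsto_const_nhds.add h1
    rw [add_zero] at h4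
    exact le_of_tendsto_of_tendsto' ((h2.comp hns.tendsto_atTop).norm) h4 (fun i => h3 (ns i))
  have hfi : Integrable f μ := hg.mono' hfm hfg
  refine ⟨hfi, ?_⟩
  have hmain : Tendsto (fun n => ∫ x, max (‖F n x - f x‖ - e n x) 0 ∂μ) atTop
      (𝓝 (∫ _, (0 : ℝ) ∂μ)) := by
    refine tendsto_integral_of_dominated_convergence (fun x => g x + ‖f x‖)
      (fun n => ((((hF n).sub hfm).norm.sub (he n).1)).sup aestronglyMeasurable_const)
      (hg.add hfi.norm) (fun n => ?_) ?_
    · filter_upwards [hbd n, hfg, he0 n] with x h1 h2 h3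
      rw [Real.norm_of_nonneg (le_max_right _ _)]
      refine max_le ?_ (by have := norm_nonneg (f x); linarith)
      have := norm_sub_le (F n x) (f x)
      linarith
    · filter_upwards [hlim, ae_all_iff.2 he0] with x h1 h3
      have h4 : Tendsto (fun n => ‖F n x - f x‖) atTop (𝓝 0) := by
        simpa using (h1.sub_const (f x)).norm
      refine squeeze_zero (fun n => le_max_right _ _) (fun n => ?_) h4
      exact max_le (by have := h3 n; linarith) (norm_nonneg _)
  rw [integral_zero] at hmain
  have hsum := hmain.add helim
  rw [add_zero] at hsum
  rw [tendsto_iff_norm_sub_tendsto_zero]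
  refine squeeze_zero (fun n => norm_nonneg _) (fun n => ?_) hsum
  rw [← integral_sub (hFi n) hfi]
  have hi : Integrable (fun x => max (‖F n x - f x‖ - e n x) 0) μ := by
    exact ((((hFi n).sub hfi).norm.sub (he n)).sup (integrable_zero α ℝ μ))
  rw [← integral_add hi (he n)]
  refine (norm_integral_le_integral_norm _).trans (integral_mono ((hFi n).sub hfi).norm
    (hi.add (he n)) fun x => ?_)
  have := le_max_left (‖F n x - f x‖ - e n x) 0
  change ‖F n x - f x‖ ≤ max (‖F n x - f x‖ - e n x) 0 + e n x
  linarith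

/-- For simple q the composition is a finite sum of functions g(·, y) cut off to the fibres of q. A
general q is a pointwise limit of simple functions, and continuity of g(x, ·) for a.e. x carries
measurability to the limit. -/
theorem IsCaratheodory.aestronglyMeasurable_comp {N : ℕ} {S T : Type} [TopologicalSpace S]
    [TopologicalSpace.PseudoMetrizableSpace S] [NormedAddCommGroup T]
    {Ω : Set (RN N)} {g : RN N → S → T}
    (hg : IsCaratheodory Ω g) {q : RN N → S} (hq : AEStronglyMeasurable q (volume.restrict Ω)) :
    AEStronglyMeasurable (fun x => g x (q x)) (volume.restrict Ω) := by
  obtain ⟨q', hq', hqq⟩ := hq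
  have hs : ∀ n, AEStronglyMeasurable (fun x => g x (hq'.approx n x)) (volume.restrict Ω) := by
    intro n
    set s := hq'.approx n with hs
    have heq : (fun x => g x (s x)) =
        fun x => ∑ y ∈ s.range, Set.indicator (s ⁻¹' {y}) (fun x => g x y) x := by
      funext x
      rw [Finset.sum_eq_single_of_mem (s x) (s.mem_range_self x)]
      · simp
      · intro y _ hy
        exact Set.indicator_of_notMem (by simpa using fun h => hy h.symm) _
    rw [heq]
    refine Finset.aestronglyMeasurable_fun_sum _ fun y _ => ?_
    exact (hg.1 y).indicator (s.measurableSet_fiber y)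
  refine (aestronglyMeasurable_of_tendsto_ae atTop hs (g := fun x => g x (q' x)) ?_).congr ?_
  · filter_upwards [hg.2] with x hx
    exact (hx.tendsto _).comp (hq'.tendsto_approx x)
  · filter_upwards [hqq] with x hx
    simp [hx]

/-! ### Calculus of test functions -/

section TestFunctions

variable {N : ℕ} {Ω : Set (RN N)} {p : ℝ} {φ η : RN N → ℝ}

theorem IsTestFun.continuous_gradient (hφ : IsTestFun Ω φ) : Continuous (gradient φ) :=
  (InnerProductSpace.toDual ℝ (RN N)).symm.continuous.comp
    (hφ.smooth.continuous_fderiv (by simp))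

theorem gradient_eq_zero_of_notMem_tsupport {x : RN N} (hx : x ∉ tsupport φ) :
    gradient φ x = 0 := by
  have h : fderiv ℝ φ x = 0 := by
    by_contra h
    exact hx (support_fderiv_subset ℝ h)
  simp [gradient, h]

theorem IsTestFun.hasCompactSupport_gradient (hφ : IsTestFun Ω φ) :
    HasCompactSupport (gradient φ) :=
  HasCompactSupport.intro hφ.compactSupport fun _ hx => gradient_eq_zero_of_notMem_tsupport hx

theorem IsTestFun.eq_zero (hφ : IsTestFun Ω φ) {x : RN N} (hx : x ∉ Ω) : φ x = 0 :=
  image_eq_zero_of_notMem_tsupport fun h => hx (hφ.support_subset h)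

theorem IsTestFun.gradient_eq_zero (hφ : IsTestFun Ω φ) {x : RN N} (hx : x ∉ Ω) :
    gradient φ x = 0 :=
  gradient_eq_zero_of_notMem_tsupport fun h => hx (hφ.support_subset h)

theorem IsTestFun.memLp (hφ : IsTestFun Ω φ) (q : ℝ≥0∞) : MemLp φ q (volume.restrict Ω) :=
  (hφ.smooth.continuous.memLp_of_hasCompactSupport hφ.compactSupport).restrict Ω

theorem IsTestFun.memLp_gradient (hφ : IsTestFun Ω φ) (q : ℝ≥0∞) :
    MemLp (gradient φ) q (volume.restrict Ω) :=
  (hφ.continuous_gradient.memLp_of_hasCompactSupport hφ.hasCompactSupport_gradient).restrict Ω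

theorem IsTestFun.linear_comb (hφ : IsTestFun Ω φ) (hη : IsTestFun Ω η) (a b : ℝ) :
    IsTestFun Ω (fun x => a * φ x + b * η x) where
  smooth := (contDiff_const.mul hφ.smooth).add (contDiff_const.mul hη.smooth)
  compactSupport := (hφ.compactSupport.mul_left (f := fun _ => a)).add
    (hη.compactSupport.mul_left (f := fun _ => b))
  support_subset := by
    refine (tsupport_add _ _).trans (Set.union_subset ?_ ?_)
    · exact (tsupport_mul_subset_right (f := fun _ => a)).trans hφ.support_subset
    · exact (tsupport_mul_subset_right (f := fun _ => b)).trans hη.support_subset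

theorem IsTestFun.differentiable (hφ : IsTestFun Ω φ) : Differentiable ℝ φ :=
  hφ.smooth.differentiable (by simp)

theorem IsTestFun.gradient_linear_comb (hφ : IsTestFun Ω φ) (hη : IsTestFun Ω η) (a b : ℝ)
    (x : RN N) :
    gradient (fun x => a * φ x + b * η x) x = a • gradient φ x + b • gradient η x := by
  refine ext_inner_right ℝ fun v => ?_
  rw [inner_gradient_left, inner_add_left, inner_smul_left, inner_smul_left, inner_gradient_left,
    inner_gradient_left]
  have h1 := (hφ.differentiable x).hasFDerivAt.const_mul a
  have h2 := (hη.differentiable x).hasFDerivAt.const_mul b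
  have h3 := (h1.add h2).fderiv
  rw [show (fun x => a * φ x + b * η x) = (fun x => a * φ x) + (fun x => b * η x) from rfl, h3]
  simp

theorem IsTestFun.comp (hφ : IsTestFun Ω φ) {θ : ℝ → ℝ} (hθ : ContDiff ℝ ∞ θ) (h0 : θ 0 = 0) :
    IsTestFun Ω (fun x => θ (φ x)) where
  smooth := hθ.comp hφ.smooth
  compactSupport := hφ.compactSupport.comp_left h0
  support_subset := (tsupport_comp_subset h0 φ).trans hφ.support_subset

theorem IsTestFun.gradient_comp (hφ : IsTestFun Ω φ) {θ : ℝ → ℝ} (hθ : ContDiff ℝ ∞ θ) (x : RN N) :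
    gradient (fun x => θ (φ x)) x = deriv θ (φ x) • gradient φ x := by
  refine ext_inner_right ℝ fun v => ?_
  rw [inner_gradient_left, inner_smul_left, inner_gradient_left]
  have h1 := (hθ.differentiable (by simp) (φ x)).hasDerivAt.comp_hasFDerivAt x
    (hφ.differentiable x).hasFDerivAt
  rw [show (fun x => θ (φ x)) = θ ∘ φ from rfl, h1.fderiv]
  simp

/-- Both supports lie in Ω, so the integrals extend to the whole space, where integration by parts
holds in each direction v without boundary terms. -/
theorem IsTestFun.hasWeakGradient (hφ : IsTestFun Ω φ) : HasWeakGradient Ω φ (gradient φ) := by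
  intro η hη
  have hφc := hφ.smooth.continuous
  have hηc := hη.smooth.continuous
  rw [setIntegral_eq_integral_of_forall_compl_eq_zero fun x hx => by simp [hφ.eq_zero hx],
    setIntegral_eq_integral_of_forall_compl_eq_zero fun x hx => by simp [hη.eq_zero hx]]
  have hi1 : Integrable (fun x => φ x • gradient η x) :=
    (hφc.smul hη.continuous_gradient).integrable_of_hasCompactSupport
      hφ.compactSupport.smul_right
  have hi2 : Integrable (fun x => η x • gradient φ x) :=
    (hηc.smul hφ.continuous_gradient).integrable_of_hasCompactSupport
      hη.compactSupport.smul_right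
  have hi3 : Integrable (fun x => φ x * η x) :=
    (hφc.mul hηc).integrable_of_hasCompactSupport hφ.compactSupport.mul_right
  refine ext_inner_left ℝ fun v => ?_
  rw [inner_neg_right, ← integral_inner hi1, ← integral_inner hi2]
  have e1 : ∀ x, inner ℝ v (φ x • gradient η x) = φ x * fderiv ℝ η x v := fun x => by
    rw [inner_smul_right, real_inner_comm, inner_gradient_left]
  have e2 : ∀ x, inner ℝ v (η x • gradient φ x) = fderiv ℝ φ x v * η x := fun x => by
    rw [inner_smul_right, real_inner_comm, inner_gradient_left, mul_comm]
  have hj1 := hi1.const_inner (𝕜 := ℝ) v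
  have hj2 := hi2.const_inner (𝕜 := ℝ) v
  simp_rw [e1] at hj1 ⊢
  simp_rw [e2] at hj2 ⊢
  exact integral_mul_fderiv_eq_neg_fderiv_mul_of_integrable hj2 hj1 hi3
    (fun x _ => hφ.differentiable x) (fun x _ => hη.differentiable x)

end TestFunctions

/-- `u` together with `G` is (the data of) an element of `W₀^{1,p}(Ω)`. -/
def MemW01 {N : ℕ} (Ω : Set (RN N)) (p : ℝ) (u : RN N → ℝ) (G : RN N → RN N) : Prop :=
  ∃ w : W01 Ω p, w.toFun = u ∧ w.grad = G

theorem W01.memW01 {N : ℕ} {Ω : Set (RN N)} {p : ℝ} (w : W01 Ω p) :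
    MemW01 Ω p w.toFun w.grad := ⟨w, rfl, rfl⟩

theorem tendsto_integral_smul_of_eLpNorm_sub {α E : Type*} {m : MeasurableSpace α} {μ : Measure α}
    [NormedAddCommGroup E] [NormedSpace ℝ E] {g : ℕ → α → E}
    {g₀ : α → E} {K : ℝ} {η : α → ℝ} (hη : AEStronglyMeasurable η μ) (hK : ∀ x, ‖η x‖ ≤ K)
    (hg : ∀ n, MemLp (g n) 1 μ) (hg0 : MemLp g₀ 1 μ)
    (h : Tendsto (fun n => eLpNorm (fun x => g n x - g₀ x) 1 μ) atTop (𝓝 0)) :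
    Tendsto (fun n => ∫ x, η x • g n x ∂μ) atTop (𝓝 (∫ x, η x • g₀ x ∂μ)) := by
  have hb : ∀ᵐ x ∂μ, ‖η x‖ ≤ K := .of_forall hK
  refine tendsto_integral_of_L1 _ ((memLp_one_iff_integrable.1 hg0).bdd_smul K hη hb).1
    (.of_forall fun n => (memLp_one_iff_integrable.1 (hg n)).bdd_smul K hη hb) ?_
  have h2 := ENNReal.Tendsto.const_mul (a := ENNReal.ofReal K) h (Or.inr ENNReal.ofReal_ne_top)
  rw [mul_zero] at h2
  refine tendsto_of_tendsto_of_tendsto_of_le_of_le tendsto_const_nhds h2 (fun _ => zero_le)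
    (fun n => ?_)
  dsimp only
  rw [eLpNorm_one_eq_lintegral_enorm, ← lintegral_const_mul' _ _ ENNReal.ofReal_ne_top]
  refine lintegral_mono fun x => ?_
  change ‖η x • g n x - η x • g₀ x‖ₑ ≤ _
  rw [← smul_sub, enorm_smul]
  gcongr
  rw [← ofReal_norm]
  exact ENNReal.ofReal_le_ofReal (hK x)

/-! ### Closure properties of W₀^{1,p} -/

section W01

variable {N : ℕ} {Ω : Set (RN N)} {p : ℝ}

theorem MemW01.memLp {u : RN N → ℝ} {G : RN N → RN N} (h : MemW01 Ω p u G) :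
    MemLp u (ENNReal.ofReal p) (volume.restrict Ω) := by
  obtain ⟨w, rfl, rfl⟩ := h
  exact w.memLp

theorem MemW01.memLp_grad {u : RN N → ℝ} {G : RN N → RN N} (h : MemW01 Ω p u G) :
    MemLp G (ENNReal.ofReal p) (volume.restrict Ω) := by
  obtain ⟨w, rfl, rfl⟩ := h
  exact w.memLp_grad

theorem MemW01.exists_testFun {u : RN N → ℝ} {G : RN N → RN N} (h : MemW01 Ω p u G)
    {ε : ℝ≥0∞} (hε : 0 < ε) : ∃ φ, IsTestFun Ω φ ∧
      eLpNorm (fun x => φ x - u x) (ENNReal.ofReal p) (volume.restrict Ω) < ε ∧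
      eLpNorm (fun x => gradient φ x - G x) (ENNReal.ofReal p) (volume.restrict Ω) < ε := by
  obtain ⟨w, rfl, rfl⟩ := h
  obtain ⟨φ, hφ, h1, h2⟩ := w.approx
  obtain ⟨n, hn1, hn2⟩ := ((h1.eventually_lt_const hε).and (h2.eventually_lt_const hε)).exists
  exact ⟨φ n, hφ n, hn1, hn2⟩

variable [IsFiniteMeasure (volume.restrict Ω)]

/-- The weak-gradient identity need not be assumed: it holds for the test functions, and on a set of
finite measure L^p convergence implies L¹ convergence, which is enough against the bounded η and Dη.
-/
theorem memW01_of_tendsto_testFun (hp : 1 < p) {u : RN N → ℝ} {G : RN N → RN N}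
    (hu : MemLp u (ENNReal.ofReal p) (volume.restrict Ω))
    (hG : MemLp G (ENNReal.ofReal p) (volume.restrict Ω))
    {φ : ℕ → RN N → ℝ} (hφ : ∀ n, IsTestFun Ω (φ n))
    (h1 : Tendsto (fun n => eLpNorm (fun x => φ n x - u x) (ENNReal.ofReal p)
      (volume.restrict Ω)) atTop (𝓝 0))
    (h2 : Tendsto (fun n => eLpNorm (fun x => gradient (φ n) x - G x) (ENNReal.ofReal p)
      (volume.restrict Ω)) atTop (𝓝 0)) : MemW01 Ω p u G := by
  refine ⟨⟨u, G, hu, hG, ?_, φ, hφ, h1, h2⟩, rfl, rfl⟩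
  have hp1 : (1 : ℝ≥0∞) ≤ ENNReal.ofReal p := by simpa using hp.le
  have k1 := tendsto_eLpNorm_one_of_ofReal hp
    (fun n => (((hφ n).memLp (ENNReal.ofReal p)).sub hu).1) h1
  have k2 := tendsto_eLpNorm_one_of_ofReal hp
    (fun n => (((hφ n).memLp_gradient (ENNReal.ofReal p)).sub hG).1) h2
  intro η hη
  obtain ⟨K, hK⟩ := hη.compactSupport.exists_bound_of_continuous hη.smooth.continuous
  obtain ⟨K', hK'⟩ := hη.hasCompactSupport_gradient.exists_bound_of_continuous
    hη.continuous_gradient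
  have l2 := tendsto_integral_smul_of_eLpNorm_sub (hη.memLp 1).1 hK (fun n => (hφ n).memLp_gradient 1) (hG.mono_exponent hp1) k2
  have l1 : Tendsto (fun n => ∫ x in Ω, φ n x • gradient η x) atTop
      (𝓝 (∫ x in Ω, u x • gradient η x)) := by
    have hu1 := memLp_one_iff_integrable.1 (hu.mono_exponent hp1)
    have hb : ∀ᵐ x ∂(volume.restrict Ω), ‖gradient η x‖ ≤ K' := .of_forall hK'
    refine tendsto_integral_of_L1 _ (hu1.smul_bdd K' (hη.memLp_gradient 1).1 hb).1
      (.of_forall fun n => (memLp_one_iff_integrable.1 ((hφ n).memLp 1)).smul_bdd K'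
        (hη.memLp_gradient 1).1 hb) ?_
    have h2 := ENNReal.Tendsto.mul_const (b := ENNReal.ofReal K') k1 (Or.inr ENNReal.ofReal_ne_top)
    rw [zero_mul] at h2
    refine tendsto_of_tendsto_of_tendsto_of_le_of_le tendsto_const_nhds h2 (fun _ => zero_le)
      (fun n => ?_)
    dsimp only
    rw [eLpNorm_one_eq_lintegral_enorm, ← lintegral_mul_const' _ _ ENNReal.ofReal_ne_top]
    refine lintegral_mono fun x => ?_
    change ‖φ n x • gradient η x - u x • gradient η x‖ₑ ≤ _
    rw [← sub_smul, enorm_smul]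
    refine mul_le_mul' le_rfl ?_
    rw [← ofReal_norm]
    exact ENNReal.ofReal_le_ofReal (hK' x)
  exact tendsto_nhds_unique (l1.congr fun n => (hφ n).hasWeakGradient η hη) l2.neg

theorem MemW01.congr (hp : 1 < p) {u u' : RN N → ℝ} {G G' : RN N → RN N} (h : MemW01 Ω p u G)
    (hu : u =ᵐ[volume.restrict Ω] u') (hG : G =ᵐ[volume.restrict Ω] G') : MemW01 Ω p u' G' := by
  obtain ⟨w, rfl, rfl⟩ := h
  obtain ⟨φ, hφ, h1, h2⟩ := w.approx
  refine memW01_of_tendsto_testFun hp (w.memLp.ae_eq hu) (w.memLp_grad.ae_eq hG) hφ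
    (h1.congr fun n => eLpNorm_congr_ae ?_) (h2.congr fun n => eLpNorm_congr_ae ?_)
  · filter_upwards [hu] with x hx
    rw [hx]
  · filter_upwards [hG] with x hx
    rw [hx]

/-- Diagonal argument: replace the n-th element by a test function within 1/n of it. -/
theorem memW01_of_tendsto (hp : 1 < p) {u : RN N → ℝ} {G : RN N → RN N}
    (hu : MemLp u (ENNReal.ofReal p) (volume.restrict Ω))
    (hG : MemLp G (ENNReal.ofReal p) (volume.restrict Ω))
    {v : ℕ → RN N → ℝ} {V : ℕ → RN N → RN N} (hv : ∀ n, MemW01 Ω p (v n) (V n))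
    (h1 : Tendsto (fun n => eLpNorm (fun x => v n x - u x) (ENNReal.ofReal p)
      (volume.restrict Ω)) atTop (𝓝 0))
    (h2 : Tendsto (fun n => eLpNorm (fun x => V n x - G x) (ENNReal.ofReal p)
      (volume.restrict Ω)) atTop (𝓝 0)) : MemW01 Ω p u G := by
  have hp1 : (1 : ℝ≥0∞) ≤ ENNReal.ofReal p := by simpa using hp.le
  have hpos : ∀ n : ℕ, (0 : ℝ≥0∞) < (n : ℝ≥0∞)⁻¹ := fun n => by simp
  choose φ hφ k1 k2 using fun n => (hv n).exists_testFun (hpos n)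
  refine memW01_of_tendsto_testFun hp hu hG hφ ?_ ?_
  · have h3 := ENNReal.tendsto_inv_nat_nhds_zero.add h1
    rw [add_zero] at h3
    refine tendsto_of_tendsto_of_tendsto_of_le_of_le tendsto_const_nhds h3 (fun _ => zero_le)
      (fun n => ?_)
    have := eLpNorm_add_le (((hφ n).memLp (ENNReal.ofReal p)).sub (hv n).memLp).1
      ((hv n).memLp.sub hu).1 hp1
    simp only [sub_add_sub_cancel] at this
    exact this.trans (add_le_add_left (k1 n).le _)
  · have h3 := ENNReal.tendsto_inv_nat_nhds_zero.add h2
    rw [add_zero] at h3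
    refine tendsto_of_tendsto_of_tendsto_of_le_of_le tendsto_const_nhds h3 (fun _ => zero_le)
      (fun n => ?_)
    have := eLpNorm_add_le (((hφ n).memLp_gradient (ENNReal.ofReal p)).sub (hv n).memLp_grad).1
      ((hv n).memLp_grad.sub hG).1 hp1
    simp only [sub_add_sub_cancel] at this
    exact this.trans (add_le_add_left (k2 n).le _)

theorem eLpNorm_linear_comb_le {α E : Type*} {m : MeasurableSpace α} {μ : Measure α}
    [NormedAddCommGroup E] [NormedSpace ℝ E] {q : ℝ≥0∞} (hq : 1 ≤ q) {f g : α → E} (a b : ℝ)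
    (hf : AEStronglyMeasurable f μ) (hg : AEStronglyMeasurable g μ) :
    eLpNorm (fun x => a • f x + b • g x) q μ ≤ ‖a‖ₑ * eLpNorm f q μ + ‖b‖ₑ * eLpNorm g q μ := by
  refine (eLpNorm_add_le (hf.const_smul a) (hg.const_smul b) hq).trans ?_
  rw [eLpNorm_const_smul, eLpNorm_const_smul]

theorem MemW01.linear_comb (hp : 1 < p) {u v : RN N → ℝ} {G V : RN N → RN N}
    (hu : MemW01 Ω p u G) (hv : MemW01 Ω p v V) (a b : ℝ) :
    MemW01 Ω p (fun x => a * u x + b * v x) (fun x => a • G x + b • V x) := by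
  have hp1 : (1 : ℝ≥0∞) ≤ ENNReal.ofReal p := by simpa using hp.le
  obtain ⟨u, rfl, rfl⟩ := hu
  obtain ⟨v, rfl, rfl⟩ := hv
  obtain ⟨φ, hφ, h1, h2⟩ := u.approx
  obtain ⟨η, hη, k1, k2⟩ := v.approx
  refine memW01_of_tendsto_testFun hp ((u.memLp.const_mul a).add (v.memLp.const_mul b))
    ((u.memLp_grad.const_smul a).add (v.memLp_grad.const_smul b))
    (fun n => (hφ n).linear_comb (hη n) a b) ?_ ?_
  · have h3 := (ENNReal.Tendsto.const_mul (a := ‖a‖ₑ) h1 (Or.inr enorm_ne_top)).add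
      (ENNReal.Tendsto.const_mul (a := ‖b‖ₑ) k1 (Or.inr enorm_ne_top))
    simp only [mul_zero, add_zero] at h3
    refine tendsto_of_tendsto_of_tendsto_of_le_of_le tendsto_const_nhds h3 (fun _ => zero_le)
      (fun n => ?_)
    refine le_trans (le_of_eq ?_) (eLpNorm_linear_comb_le hp1 a b
      (((hφ n).memLp (ENNReal.ofReal p)).sub u.memLp).1
      (((hη n).memLp (ENNReal.ofReal p)).sub v.memLp).1)
    congr 1
    funext x
    simp only [smul_eq_mul]
    ring
  · have h3 := (ENNReal.Tendsto.const_mul (a := ‖a‖ₑ) h2 (Or.inr enorm_ne_top)).add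
      (ENNReal.Tendsto.const_mul (a := ‖b‖ₑ) k2 (Or.inr enorm_ne_top))
    simp only [mul_zero, add_zero] at h3
    refine tendsto_of_tendsto_of_tendsto_of_le_of_le tendsto_const_nhds h3 (fun _ => zero_le)
      (fun n => ?_)
    refine le_trans (le_of_eq ?_) (eLpNorm_linear_comb_le hp1 a b
      (((hφ n).memLp_gradient (ENNReal.ofReal p)).sub u.memLp_grad).1
      (((hη n).memLp_gradient (ENNReal.ofReal p)).sub v.memLp_grad).1)
    congr 1
    funext x
    rw [(hφ n).gradient_linear_comb (hη n)]
    simp only [smul_sub]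
    abel

/-- Chain rule by approximation. With test functions φ_n → u, the gradient error splits as
θ'(φ_n)(Dφ_n − Du) + (θ'(φ_n) − θ'(u))Du. The bound on θ' handles the first part; dominated
convergence along an a.e. convergent subsequence handles the second. -/
theorem MemW01.comp_of_deriv_le (hp : 1 < p) {u : RN N → ℝ} {G : RN N → RN N}
    (hu : MemW01 Ω p u G) {θ : ℝ → ℝ} (hθ : ContDiff ℝ ∞ θ) (h0 : θ 0 = 0) {K : ℝ}
    (hK : ∀ s, ‖deriv θ s‖ ≤ K) :
    MemW01 Ω p (fun x => θ (u x)) (fun x => deriv θ (u x) • G x) := by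
  have hp0 : 0 < p := by linarith
  have hp1 : (1 : ℝ≥0∞) ≤ ENNReal.ofReal p := by simpa using hp.le
  have hK0 : 0 ≤ K := (norm_nonneg _).trans (hK 0)
  have hlip : ∀ s t : ℝ, ‖θ s - θ t‖ ≤ K * ‖s - t‖ := fun s t =>
    convex_univ.norm_image_sub_le_of_norm_deriv_le (fun x _ => hθ.differentiable (by simp) x)
      (fun x _ => hK x) (Set.mem_univ t) (Set.mem_univ s)
  have hdc : Continuous (deriv θ) := hθ.continuous_deriv (by simp)
  obtain ⟨u, rfl, rfl⟩ := hu
  obtain ⟨φ, hφ, h1, h2⟩ := u.approx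
  obtain ⟨ns, hns, hae⟩ := exists_seq_tendsto_ae_of_eLpNorm
    (by simpa using hp0) (fun n => ((hφ n).memLp 1).1) u.memLp.1 h1
  replace h1 := h1.comp hns.tendsto_atTop
  replace h2 := h2.comp hns.tendsto_atTop
  have hθu : MemLp (fun x => θ (u.toFun x)) (ENNReal.ofReal p) (volume.restrict Ω) :=
    u.memLp.of_le_mul (hθ.continuous.comp_aestronglyMeasurable u.memLp.1)
      (.of_forall fun x => by simpa [h0] using hlip (u.toFun x) 0)
  have hθG : MemLp (fun x => deriv θ (u.toFun x) • u.grad x) (ENNReal.ofReal p)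
      (volume.restrict Ω) :=
    u.memLp_grad.of_le_mul ((hdc.comp_aestronglyMeasurable u.memLp.1).smul u.memLp_grad.1)
      (.of_forall fun x => by rw [norm_smul]; gcongr; exact hK _)
  refine memW01_of_tendsto_testFun hp hθu hθG (fun n => (hφ (ns n)).comp hθ h0) ?_ ?_
  · have h3 := ENNReal.Tendsto.const_mul (a := ENNReal.ofReal K) h1 (Or.inr ENNReal.ofReal_ne_top)
    rw [mul_zero] at h3
    refine tendsto_of_tendsto_of_tendsto_of_le_of_le tendsto_const_nhds h3 (fun _ => zero_le)
      (fun n => ?_)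
    exact eLpNorm_le_mul_eLpNorm_of_ae_le_mul (.of_forall fun x => hlip _ _) _
  · have h3 := ENNReal.Tendsto.const_mul (a := ENNReal.ofReal K) h2 (Or.inr ENNReal.ofReal_ne_top)
    rw [mul_zero] at h3
    have h4 : Tendsto (fun n => eLpNorm (fun x => deriv θ (φ (ns n) x) • u.grad x -
        deriv θ (u.toFun x) • u.grad x) (ENNReal.ofReal p) (volume.restrict Ω)) atTop (𝓝 0) := by
      refine tendsto_eLpNorm_sub_of_dominated hp0 (fun n =>
        (hdc.comp_aestronglyMeasurable ((hφ (ns n)).memLp 1).1).smul u.memLp_grad.1) ?_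
        (u.memLp_grad.norm.const_mul (2 * K)) (fun n => .of_forall fun x => ?_)
      · filter_upwards [hae] with x hx
        exact ((hdc.tendsto _).comp hx).smul_const _
      · rw [← sub_smul, norm_smul]
        gcongr
        refine (norm_sub_le _ _).trans ?_
        linarith [hK (φ (ns n) x), hK (u.toFun x)]
    have h5 := h3.add h4
    rw [add_zero] at h5
    refine tendsto_of_tendsto_of_tendsto_of_le_of_le tendsto_const_nhds h5 (fun _ => zero_le)
      (fun n => ?_)
    have hm : AEStronglyMeasurable (fun x => deriv θ (φ (ns n) x)) (volume.restrict Ω) :=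
      hdc.comp_aestronglyMeasurable ((hφ (ns n)).memLp 1).1
    have hsplit : (fun x => gradient (fun x => θ (φ (ns n) x)) x - deriv θ (u.toFun x) • u.grad x)
        = (fun x => deriv θ (φ (ns n) x) • (gradient (φ (ns n)) x - u.grad x)) +
          (fun x => deriv θ (φ (ns n) x) • u.grad x - deriv θ (u.toFun x) • u.grad x) := by
      funext x
      rw [(hφ (ns n)).gradient_comp hθ]
      simp [smul_sub]
    rw [hsplit]
    refine (eLpNorm_add_le (hm.smul (((hφ (ns n)).memLp_gradient 1).1.sub u.memLp_grad.1))
      ((hm.smul u.memLp_grad.1).sub hθG.1) hp1).trans ?_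
    refine add_le_add ?_ le_rfl
    refine eLpNorm_le_mul_eLpNorm_of_ae_le_mul (.of_forall fun x => ?_) _
    change ‖deriv θ (φ (ns n) x) • (gradient (φ (ns n)) x - u.grad x)‖ ≤ _
    rw [norm_smul]
    gcongr
    exact hK _

/-- Only the values of θ on [−R, R] matter, so θ may be multiplied by a cutoff; this removes the
bound on θ' and admits the exponential test functions. -/
theorem MemW01.comp_of_bounded (hp : 1 < p) {u : RN N → ℝ} {G : RN N → RN N}
    (hu : MemW01 Ω p u G) {R : ℝ} (hR : ∀ᵐ x ∂(volume.restrict Ω), |u x| ≤ R)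
    {θ : ℝ → ℝ} (hθ : ContDiff ℝ ∞ θ) (h0 : θ 0 = 0) :
    MemW01 Ω p (fun x => θ (u x)) (fun x => deriv θ (u x) • G x) := by
  -- The inner radius exceeds |R|, so that χ = 1 in a neighbourhood of every value of u and the
  -- derivatives agree there too.
  let χ : ContDiffBump (0 : ℝ) := ⟨|R| + 1, |R| + 2, by positivity, by linarith⟩
  have hs : ContDiff ℝ ∞ (fun s => θ s * χ s) := hθ.mul χ.contDiff
  have hc : HasCompactSupport (fun s => θ s * χ s) := χ.hasCompactSupport.mul_left
  obtain ⟨K, hK⟩ := hc.deriv.exists_bound_of_continuous (hs.continuous_deriv (by simp))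
  refine (hu.comp_of_deriv_le hp hs (by simp [h0]) hK).congr hp ?_ ?_
  · filter_upwards [hR] with x hx
    rw [χ.one_of_mem_closedBall, mul_one]
    rw [mem_closedBall_zero_iff, Real.norm_eq_abs]
    exact hx.trans ((le_abs_self R).trans (by simp [χ]))
  · filter_upwards [hR] with x hx
    congr 1
    have hx' : u x ∈ Metric.ball (0 : ℝ) χ.rIn := by
      rw [mem_ball_zero_iff, Real.norm_eq_abs]
      exact lt_of_le_of_lt (hx.trans (le_abs_self R)) (by simp [χ])
    refine Filter.EventuallyEq.deriv_eq ?_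
    filter_upwards [Metric.isOpen_ball.mem_nhds hx'] with s hs
    rw [χ.one_of_mem_closedBall (Metric.ball_subset_closedBall hs), mul_one]

/-- The fundamental lemma of the calculus of variations. The gradient is part of the data of `W01`,
so uniqueness is needed to identify gradients obtained from different constructions. -/
theorem W01.grad_ae_eq (hΩ : IsOpen Ω) (hp : 1 < p) {u v : W01 Ω p}
    (h : u.toFun =ᵐ[volume.restrict Ω] v.toFun) : u.grad =ᵐ[volume.restrict Ω] v.grad := by
  have hp1 : (1 : ℝ≥0∞) ≤ ENNReal.ofReal p := by simpa using hp.le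
  have hiu := memLp_one_iff_integrable.1 (u.memLp_grad.mono_exponent hp1)
  have hiv := memLp_one_iff_integrable.1 (v.memLp_grad.mono_exponent hp1)
  have hi : IntegrableOn (fun x => u.grad x - v.grad x) Ω volume := hiu.sub hiv
  have key := hΩ.ae_eq_zero_of_integral_contDiff_smul_eq_zero hi.locallyIntegrableOn
    fun g hg hgc hgΩ => ?_
  · rw [Filter.EventuallyEq, ae_restrict_iff' hΩ.measurableSet]
    filter_upwards [key] with x hx hxΩ
    exact sub_eq_zero.1 (hx hxΩ)
  · have ht : IsTestFun Ω g := ⟨hg, hgc, hgΩ⟩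
    obtain ⟨K, hK⟩ := hgc.exists_bound_of_continuous hg.continuous
    rw [← setIntegral_eq_integral_of_forall_compl_eq_zero (s := Ω)
      fun x hx => by simp [ht.eq_zero hx]]
    have hb : ∀ᵐ x ∂(volume.restrict Ω), ‖g x‖ ≤ K := .of_forall hK
    simp_rw [smul_sub]
    have hi1 : Integrable (fun x => g x • u.grad x) (volume.restrict Ω) :=
      hiu.bdd_smul K (ht.memLp 1).1 hb
    have hi2 : Integrable (fun x => g x • v.grad x) (volume.restrict Ω) :=
      hiv.bdd_smul K (ht.memLp 1).1 hb
    rw [integral_sub hi1 hi2, sub_eq_zero, ← neg_inj, ← u.hasWeakGradient g ht, ← v.hasWeakGradient g ht]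
    refine integral_congr_ae ?_
    filter_upwards [h] with x hx
    rw [hx]

end W01

/-! ### Rellich compactness -/

theorem exists_tendsto_eLpNorm_of_cauchy {α E : Type*} {m : MeasurableSpace α} {μ : Measure α}
    [NormedAddCommGroup E] [CompleteSpace E] {q : ℝ≥0∞} (hq : 1 ≤ q) {f : ℕ → α → E}
    (hf : ∀ n, MemLp (f n) q μ)
    (h : ∀ ε : ℝ≥0∞, 0 < ε → ∃ n₀, ∀ m, n₀ ≤ m → ∀ n, n₀ ≤ n →
      eLpNorm (fun x => f m x - f n x) q μ ≤ ε) :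
    ∃ g, MemLp g q μ ∧ Tendsto (fun n => eLpNorm (fun x => f n x - g x) q μ) atTop (𝓝 0) := by
  have : Fact (1 ≤ q) := ⟨hq⟩
  have hc : CauchySeq fun n => (hf n).toLp (f n) := by
    refine EMetric.cauchySeq_iff.2 fun ε hε => ?_
    obtain ⟨δ, hδ, hδε⟩ := exists_between hε
    obtain ⟨n₀, h0⟩ := h δ hδ
    refine ⟨n₀, fun m hm n hn => ?_⟩
    rw [Lp.edist_toLp_toLp]
    exact (h0 m hm n hn).trans_lt hδε
  obtain ⟨g, hg⟩ := cauchySeq_tendsto_of_complete hc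
  refine ⟨g, Lp.memLp g, ?_⟩
  rw [← Lp.toLp_coeFn g (Lp.memLp g)] at hg
  exact (Lp.tendsto_Lp_iff_tendsto_eLpNorm'' f hf g (Lp.memLp g)).1 hg

/-- Bounded functions form a bounded set in the separable space L², so sequential Banach–Alaoglu
gives a weakly convergent subsequence; it is tested on indicators. -/
theorem exists_subseq_tendsto_setIntegral {α : Type*} {m : MeasurableSpace α} {μ : Measure α}
    [IsFiniteMeasure μ] [MeasureTheory.IsSeparable μ] {f : ℕ → α → ℝ} {C : ℝ}
    (hf : ∀ n, AEStronglyMeasurable (f n) μ) (hC : ∀ n, ∀ᵐ x ∂μ, ‖f n x‖ ≤ C) :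
    ∃ ns : ℕ → ℕ, StrictMono ns ∧ ∀ s, MeasurableSet s →
      ∃ l : ℝ, Tendsto (fun i => ∫ x in s, f (ns i) x ∂μ) atTop (𝓝 l) := by
  have : Fact ((2 : ℝ≥0∞) ≠ ⊤) := ⟨by simp⟩
  have hm : ∀ n, MemLp (f n) 2 μ := fun n => MemLp.of_bound (hf n) C (hC n)
  let T : ℕ → WeakDual ℝ (Lp ℝ 2 μ) := fun n =>
    StrongDual.toWeakDual (InnerProductSpace.toDual ℝ (Lp ℝ 2 μ) ((hm n).toLp (f n)))
  have hT : ∀ n, T n ∈ WeakDual.toStrongDual ⁻¹'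
      Metric.closedBall (0 : StrongDual ℝ (Lp ℝ 2 μ))
        (μ Set.univ ^ (2 : ℝ≥0∞).toReal⁻¹ * ENNReal.ofReal C).toReal := fun n => by
    rw [Set.mem_preimage, mem_closedBall_zero_iff]
    change ‖InnerProductSpace.toDual ℝ (Lp ℝ 2 μ) ((hm n).toLp (f n))‖ ≤ _
    rw [LinearIsometryEquiv.norm_map, Lp.norm_toLp]
    refine ENNReal.toReal_mono ?_ (eLpNorm_le_of_ae_bound (hC n))
    exact ENNReal.mul_ne_top (ENNReal.rpow_ne_top_of_nonneg (by simp) (measure_ne_top _ _))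
      ENNReal.ofReal_ne_top
  have := Lp.SecondCountableTopology (E := ℝ) (μ := μ) (p := 2)
  obtain ⟨L, -, ns, hns, hlim⟩ := WeakDual.isSeqCompact_closedBall ℝ (Lp ℝ 2 μ) 0 _ hT
  refine ⟨ns, hns, fun s hs => ⟨L (indicatorConstLp 2 hs (measure_ne_top μ s) 1), ?_⟩⟩
  have h1 := (tendsto_iff_forall_eval_tendsto_topDualPairing.1 hlim)
    (indicatorConstLp 2 hs (measure_ne_top μ s) 1)
  refine h1.congr fun i => ?_
  change inner ℝ ((hm (ns i)).toLp (f (ns i))) (indicatorConstLp 2 hs (measure_ne_top μ s) 1) = _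
  rw [real_inner_comm, L2.inner_indicatorConstLp_one]
  exact integral_congr_ae (ae_restrict_of_ae (hm (ns i)).coeFn_toLp)

section Translation

variable {N : ℕ} {Ω : Set (RN N)} {p : ℝ} {φ : RN N → ℝ}

/-- Write φ(x + y) − φ(x) as the integral of Dφ·y along the segment, exchange the integrals, and use
translation invariance. -/
theorem IsTestFun.lintegral_translation_le (hφ : IsTestFun Ω φ) (y : RN N) :
    ∫⁻ x, ‖φ (x + y) - φ x‖ₑ ≤ ‖y‖ₑ * ∫⁻ x in Ω, ‖gradient φ x‖ₑ := by
  have hc := hφ.continuous_gradient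
  have hsub : ∀ x, ‖φ (x + y) - φ x‖ₑ ≤
      ∫⁻ t in Set.Ioc (0 : ℝ) 1, ‖gradient φ (x + t • y)‖ₑ * ‖y‖ₑ := fun x => by
    have hd : ∀ t ∈ Set.uIcc (0 : ℝ) 1, HasDerivAt (fun t : ℝ => φ (x + t • y))
        (inner ℝ (gradient φ (x + t • y)) y) t := fun t _ => by
      have h1 : HasDerivAt (fun t : ℝ => x + t • y) y t := by
        simpa using ((hasDerivAt_id t).smul_const y).const_add x
      have h2 := (hφ.differentiable (x + t • y)).hasFDerivAt.comp_hasDerivAt t h1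
      rwa [inner_gradient_left]
    have hcont : Continuous fun t : ℝ => inner ℝ (gradient φ (x + t • y)) y := by fun_prop
    have h := intervalIntegral.integral_eq_sub_of_hasDerivAt hd
      (hcont.intervalIntegrable (μ := volume) 0 1)
    rw [one_smul, zero_smul, add_zero, intervalIntegral.integral_of_le zero_le_one] at h
    rw [← h]
    refine (enorm_integral_le_lintegral_enorm _).trans (lintegral_mono fun t => ?_)
    rw [← ofReal_norm, ← ofReal_norm, ← ofReal_norm,
      ← ENNReal.ofReal_mul (norm_nonneg _)]
    exact ENNReal.ofReal_le_ofReal (norm_inner_le_norm _ _)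
  calc ∫⁻ x, ‖φ (x + y) - φ x‖ₑ
      ≤ ∫⁻ x, ∫⁻ t in Set.Ioc (0 : ℝ) 1, ‖gradient φ (x + t • y)‖ₑ * ‖y‖ₑ := lintegral_mono hsub
    _ = ∫⁻ t in Set.Ioc (0 : ℝ) 1, ∫⁻ x, ‖gradient φ (x + t • y)‖ₑ * ‖y‖ₑ := by
        refine lintegral_lintegral_swap (Continuous.aemeasurable ?_)
        refine ENNReal.continuous_mul_const (by simp) |>.comp ?_
        exact (hc.comp (by fun_prop : Continuous fun z : RN N × ℝ => z.1 + z.2 • y)).enorm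
    _ = ∫⁻ _ in Set.Ioc (0 : ℝ) 1, ‖y‖ₑ * ∫⁻ x in Ω, ‖gradient φ x‖ₑ := by
        refine lintegral_congr fun t => ?_
        rw [lintegral_mul_const' _ _ (by simp),
          lintegral_add_right_eq_self (fun x => ‖gradient φ x‖ₑ) (t • y), mul_comm]
        congr 1
        refine (setLIntegral_eq_of_support_subset ?_).symm
        intro x hx
        by_contra hxΩ
        exact hx (by simp [hφ.gradient_eq_zero hxΩ])
    _ = ‖y‖ₑ * ∫⁻ x in Ω, ‖gradient φ x‖ₑ := by simp

variable [IsFiniteMeasure (volume.restrict Ω)]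

/-- Extension by zero is harmless for W₀^{1,p}: the approximating test functions already vanish
outside Ω, and the translation estimate passes to their limit. -/
theorem W01.lintegral_translation_le (hΩ : MeasurableSet Ω) (hp : 1 < p) (w : W01 Ω p) (y : RN N) :
    ∫⁻ x, ‖Ω.indicator w.toFun (x + y) - Ω.indicator w.toFun x‖ₑ ≤
      ‖y‖ₑ * ∫⁻ x in Ω, ‖w.grad x‖ₑ := by
  obtain ⟨φ, hφ, h1, h2⟩ := w.approx
  have k1 := tendsto_eLpNorm_one_of_ofReal hp
    (fun n => (((hφ n).memLp (ENNReal.ofReal p)).sub w.memLp).1) h1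
  have k2 := tendsto_eLpNorm_one_of_ofReal hp
    (fun n => (((hφ n).memLp_gradient (ENNReal.ofReal p)).sub w.memLp_grad).1) h2
  simp only [eLpNorm_one_eq_lintegral_enorm] at k1 k2
  set U := Ω.indicator w.toFun with hU
  have hUm : AEStronglyMeasurable U := (aestronglyMeasurable_indicator_iff hΩ).2 w.memLp.1
  have hdiff : ∀ n, ∫⁻ x, ‖φ n x - U x‖ₑ = ∫⁻ x in Ω, ‖(φ n - w.toFun) x‖ₑ := fun n => by
    rw [← lintegral_indicator hΩ]
    refine lintegral_congr fun x => ?_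
    by_cases hx : x ∈ Ω
    · simp [hU, hx]
    · simp [hU, hx, (hφ n).eq_zero hx]
  have hlim := ((k1.add k1).add (ENNReal.Tendsto.const_mul (a := ‖y‖ₑ)
    (k2.add_const (∫⁻ x in Ω, ‖w.grad x‖ₑ)) (Or.inr (by simp))))
  rw [zero_add, zero_add, zero_add] at hlim
  refine ge_of_tendsto' hlim fun n => ?_
  have hm : AEMeasurable fun x => ‖φ n x - U x‖ₑ :=
    ((hφ n).smooth.continuous.aestronglyMeasurable.sub hUm).enorm
  calc ∫⁻ x, ‖U (x + y) - U x‖ₑ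
      ≤ ∫⁻ x, ((‖φ n (x + y) - U (x + y)‖ₑ + ‖φ n x - U x‖ₑ) + ‖φ n (x + y) - φ n x‖ₑ) := by
        refine lintegral_mono fun x => ?_
        have : U (x + y) - U x =
            (-(φ n (x + y) - U (x + y)) + (φ n x - U x)) + (φ n (x + y) - φ n x) := by ring
        rw [this]
        refine (enorm_add_le _ _).trans (add_le_add ((enorm_add_le _ _).trans ?_) le_rfl)
        rw [enorm_neg]
    _ = ((∫⁻ x, ‖φ n (x + y) - U (x + y)‖ₑ) + ∫⁻ x, ‖φ n x - U x‖ₑ)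
          + ∫⁻ x, ‖φ n (x + y) - φ n x‖ₑ := by
        rw [lintegral_add_right', lintegral_add_right' _ hm]
        exact ((((hφ n).smooth.continuous.comp (continuous_add_const y)).sub
          (hφ n).smooth.continuous).enorm.aemeasurable)
    _ ≤ _ := by
        rw [lintegral_add_right_eq_self (fun x => ‖φ n x - U x‖ₑ) y, hdiff]
        refine add_le_add le_rfl (((hφ n).lintegral_translation_le y).trans ?_)
        refine mul_le_mul' le_rfl ?_
        rw [← lintegral_add_right' _ w.memLp_grad.1.enorm]
        refine lintegral_mono fun x => ?_
        have : gradient (φ n) x = (gradient (φ n) x - w.grad x) + w.grad x := by abel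
        conv_lhs => rw [this]
        exact enorm_add_le _ _

/-- The integral over the ball B of radius ε minus |B| w(x) equals ∫_B (V(x + z) − V(x)) dz for the
zero extension V of w. Fubini and the translation estimate for |z| < ε finish. -/
theorem W01.lintegral_ball_average_le (hΩ : MeasurableSet Ω) (hp : 1 < p) (w : W01 Ω p)
    (ε : ℝ) :
    AEStronglyMeasurable (fun x => ∫ z in Metric.ball x ε, w.toFun z ∂(volume.restrict Ω))
      (volume.restrict Ω) ∧
    ∫⁻ x in Ω, ‖(∫ z in Metric.ball x ε, w.toFun z ∂(volume.restrict Ω)) -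
        (volume (Metric.ball (0 : RN N) ε)).toReal * w.toFun x‖ₑ ≤
      volume (Metric.ball (0 : RN N) ε) * (ENNReal.ofReal ε * ∫⁻ x in Ω, ‖w.grad x‖ₑ) := by
  have hUm : AEStronglyMeasurable (Ω.indicator w.toFun) :=
    (aestronglyMeasurable_indicator_iff hΩ).2 w.memLp.1
  have hw : Integrable w.toFun (volume.restrict Ω) :=
    memLp_one_iff_integrable.1 (w.memLp.mono_exponent (by simpa using hp.le))
  -- A genuinely strongly measurable representative is taken so that (x, z) ↦ V(x + z) is jointly
  -- measurable.
  obtain ⟨V, hVm, hV⟩ := hUm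
  have hVi : Integrable V := by
    refine Integrable.congr ?_ hV
    rwa [integrable_indicator_iff hΩ]
  have hVw : ∀ᵐ x ∂(volume.restrict Ω), w.toFun x = V x := by
    rw [ae_restrict_iff' hΩ]
    filter_upwards [hV] with x hx hxΩ
    rw [← hx, Set.indicator_of_mem hxΩ]
  set B := Metric.ball (0 : RN N) ε
  have hBfin : volume B ≠ ⊤ := measure_ball_lt_top.ne
  have havg : ∀ x, ∫ z in Metric.ball x ε, w.toFun z ∂(volume.restrict Ω) = ∫ z in B, V (x + z) := by
    intro x
    rw [Measure.restrict_restrict measurableSet_ball, Set.inter_comm,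
      ← Measure.restrict_restrict hΩ, ← integral_indicator hΩ,
      integral_congr_ae (ae_restrict_of_ae hV), ← integral_indicator measurableSet_ball,
      ← integral_indicator measurableSet_ball,
      ← integral_add_left_eq_self _ x]
    refine integral_congr_ae (.of_forall fun z => ?_)
    simp only [Set.indicator, Metric.mem_ball, dist_self_add_left, dist_zero_right]
  have hjoint : StronglyMeasurable fun q : RN N × RN N => V (q.1 + q.2) :=
    hVm.comp_measurable (measurable_fst.add measurable_snd)
  have htr : ∀ z, ∫⁻ x, ‖V (x + z) - V x‖ₑ ≤ ‖z‖ₑ * ∫⁻ x in Ω, ‖w.grad x‖ₑ := fun z => by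
    refine le_trans (le_of_eq (lintegral_congr_ae ?_)) (w.lintegral_translation_le hΩ hp z)
    have hz := (measurePreserving_add_right volume z).quasiMeasurePreserving.ae_eq hV
    filter_upwards [hV, hz] with x h1 h2
    simp only [Function.comp] at h2
    rw [h1, h2]
  have hmeas : StronglyMeasurable fun x => ∫ z in B, V (x + z) :=
    hjoint.integral_prod_right (f := fun x z => V (x + z))
  refine ⟨hmeas.aestronglyMeasurable.congr (.of_forall fun x => (havg x).symm), ?_⟩
  calc ∫⁻ x in Ω, ‖(∫ z in Metric.ball x ε, w.toFun z ∂(volume.restrict Ω)) -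
        (volume B).toReal * w.toFun x‖ₑ
      ≤ ∫⁻ x in Ω, ∫⁻ z in B, ‖V (x + z) - V x‖ₑ := by
        refine lintegral_mono_ae ?_
        filter_upwards [hVw] with x hx
        rw [havg, hx]
        have hi1 : IntegrableOn (fun z => V (x + z)) B := (hVi.comp_add_left x).integrableOn
        have hi2 : IntegrableOn (fun _ => V x) B := integrableOn_const hBfin
        have : (volume B).toReal * V x = ∫ _ in B, V x := by
          simp [Measure.real]
        rw [this, ← integral_sub hi1 hi2]
        exact enorm_integral_le_lintegral_enorm _
    _ ≤ ∫⁻ x, ∫⁻ z in B, ‖V (x + z) - V x‖ₑ := setLIntegral_le_lintegral _ _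
    _ = ∫⁻ z in B, ∫⁻ x, ‖V (x + z) - V x‖ₑ := by
        refine lintegral_lintegral_swap (Measurable.aemeasurable ?_)
        exact (hjoint.sub (hVm.comp_measurable measurable_fst)).enorm
    _ ≤ ∫⁻ _ in B, ENNReal.ofReal ε * ∫⁻ x in Ω, ‖w.grad x‖ₑ := by
        refine setLIntegral_mono measurable_const fun z hz => (htr z).trans ?_
        refine mul_le_mul' ?_ le_rfl
        rw [← ofReal_norm]
        exact ENNReal.ofReal_le_ofReal (mem_ball_zero_iff.1 hz).le
    _ = _ := by
        rw [lintegral_const, Measure.restrict_apply_univ, mul_comm]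

/-- Along a weakly convergent subsequence the integrals over the ball around each x converge; they
are bounded, hence converge in L¹. The gradient bound keeps them close to |B_ε| w_n, uniformly in n,
so w_n is Cauchy in L¹ and a further subsequence converges a.e. -/
theorem W01.exists_subseq_tendsto_ae (hΩ : MeasurableSet Ω) (hp : 1 < p) {w : ℕ → W01 Ω p}
    {C K : ℝ} (hC : ∀ n, ∀ᵐ x ∂(volume.restrict Ω), |(w n).toFun x| ≤ C)
    (hK : ∀ n, ∫ x in Ω, ‖(w n).grad x‖ ^ p ≤ K) :
    ∃ (ns : ℕ → ℕ) (u : RN N → ℝ), StrictMono ns ∧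
      AEStronglyMeasurable u (volume.restrict Ω) ∧
      ∀ᵐ x ∂(volume.restrict Ω), Tendsto (fun i => (w (ns i)).toFun x) atTop (𝓝 (u x)) := by
  have hp0 : 0 < p := by linarith
  have hp1 : (1 : ℝ≥0∞) ≤ ENNReal.ofReal p := by simpa using hp.le
  obtain ⟨K₁, hK₁, hgrad⟩ : ∃ K₁ : ℝ≥0∞, K₁ ≠ ⊤ ∧ ∀ n, ∫⁻ x in Ω, ‖(w n).grad x‖ₑ ≤ K₁ := by
    refine ⟨ENNReal.ofReal (K ^ p⁻¹) * (volume.restrict Ω) Set.univ ^ (1 / (1 : ℝ≥0∞).toReal -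
      1 / (ENNReal.ofReal p).toReal), ?_, fun n => ?_⟩
    · refine ENNReal.mul_ne_top ENNReal.ofReal_ne_top
        (ENNReal.rpow_ne_top_of_nonneg ?_ (measure_ne_top _ _))
      rw [ENNReal.toReal_ofReal hp0.le]
      have : p⁻¹ ≤ 1 := inv_le_one_of_one_le₀ hp.le
      simpa using this
    · rw [← eLpNorm_one_eq_lintegral_enorm]
      refine (eLpNorm_le_eLpNorm_mul_rpow_measure_univ hp1 (w n).memLp_grad.1).trans ?_
      refine mul_le_mul' ?_ le_rfl
      rw [(w n).memLp_grad.eLpNorm_ofReal_eq hp0]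
      refine ENNReal.ofReal_le_ofReal (Real.rpow_le_rpow ?_ (hK n) (by positivity))
      exact integral_nonneg fun x => by positivity
  obtain ⟨ns, hns, hweak⟩ := exists_subseq_tendsto_setIntegral (fun n => (w n).memLp.1) hC
  have hcauchy : ∃ g, MemLp g 1 (volume.restrict Ω) ∧ Tendsto (fun n =>
      eLpNorm (fun x => (w (ns n)).toFun x - g x) 1 (volume.restrict Ω)) atTop (𝓝 0) := by
    refine exists_tendsto_eLpNorm_of_cauchy le_rfl
      (fun n => (w (ns n)).memLp.mono_exponent hp1) fun δ hδ => ?_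
    -- Comparing each of the two functions with its ball integral costs |B_ε| ε K₁, twice; the other
    -- half of δ is left for the convergence of the ball integrals. The factor |B_ε| cancels at the
    -- end.
    obtain ⟨ε, hε, hε0⟩ : ∃ ε : ℝ, 2 * (ENNReal.ofReal ε * K₁) < δ / 2 ∧ 0 < ε := by
      have h1 : Tendsto (fun ε : ℝ => 2 * (ENNReal.ofReal ε * K₁)) (𝓝[>] 0) (𝓝 0) := by
        have := ENNReal.Tendsto.const_mul (a := 2) (ENNReal.Tendsto.mul_const (b := K₁)
          (ENNReal.tendsto_ofReal (tendsto_id (α := ℝ) (x := 𝓝 0))) (Or.inr hK₁))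
          (Or.inr (by simp))
        simp only [id, ENNReal.ofReal_zero, zero_mul, mul_zero] at this
        exact this.mono_left nhdsWithin_le_nhds
      exact ((h1.eventually_lt_const (ENNReal.half_pos hδ.ne')).and
        (eventually_mem_nhdsWithin)).exists
    set A : ℕ → RN N → ℝ := fun i x =>
      ∫ z in Metric.ball x ε, (w (ns i)).toFun z ∂(volume.restrict Ω) with hA
    have hball := fun i => (w (ns i)).lintegral_ball_average_le hΩ hp ε
    choose L hL using fun x : RN N => hweak (Metric.ball x ε) measurableSet_ball
    set β := volume (Metric.ball (0 : RN N) ε) with hβ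
    have hβ0 : β ≠ 0 := (Metric.measure_ball_pos volume _ hε0).ne'
    have hβt : β ≠ ⊤ := measure_ball_lt_top.ne
    have hAC : ∀ i x, ‖A i x‖ ≤ |C| * ((volume.restrict Ω) Set.univ).toReal := fun i x => by
      have h1 : ∀ᵐ z ∂((volume.restrict Ω).restrict (Metric.ball x ε)),
          ‖(w (ns i)).toFun z‖ ≤ |C| :=
        ae_restrict_of_ae ((hC (ns i)).mono fun z hz => hz.trans (le_abs_self C))
      refine (norm_integral_le_of_norm_le_const h1).trans ?_
      refine mul_le_mul_of_nonneg_left ?_ (abs_nonneg C)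
      exact ENNReal.toReal_mono (measure_ne_top _ _)
        (Measure.restrict_le_self _)
    have hAL := tendsto_eLpNorm_sub_of_dominated (p := 1) one_pos
      (fun i => (hball i).1) (.of_forall hL) (memLp_const
        (2 * (|C| * ((volume.restrict Ω) Set.univ).toReal))) (fun i => .of_forall fun x => by
        have h2 := le_of_tendsto' (hL x).norm fun i => hAC i x
        have h1 := hAC i x
        refine (norm_sub_le _ _).trans ?_
        linarith)
    have hLm : AEStronglyMeasurable L (volume.restrict Ω) :=
      aestronglyMeasurable_of_tendsto_ae _ (fun i => (hball i).1) (.of_forall hL)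
    rw [ENNReal.ofReal_one] at hAL
    have hpos : 0 < β * (δ / 4) := ENNReal.mul_pos hβ0 (ENNReal.div_pos hδ.ne' (by simp)).ne'
    obtain ⟨n₀, hn₀⟩ := eventually_atTop.1 (hAL.eventually_lt_const hpos)
    refine ⟨n₀, fun m hm n hn => ?_⟩
    refine (ENNReal.mul_le_mul_iff_right hβ0 hβt).1 ?_
    have e1 : β * eLpNorm (fun x => (w (ns m)).toFun x - (w (ns n)).toFun x) 1
        (volume.restrict Ω) =
        ∫⁻ x in Ω, ‖β.toReal * (w (ns m)).toFun x - β.toReal * (w (ns n)).toFun x‖ₑ := by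
      rw [eLpNorm_one_eq_lintegral_enorm, ← lintegral_const_mul' _ _ hβt]
      refine lintegral_congr fun x => ?_
      rw [← mul_sub, enorm_mul, Real.enorm_of_nonneg ENNReal.toReal_nonneg,
        ENNReal.ofReal_toReal hβt]
    have e2 : ∀ i, n₀ ≤ i →
        ∫⁻ x in Ω, ‖L x - β.toReal * (w (ns i)).toFun x‖ₑ ≤
          β * (δ / 4) + β * (ENNReal.ofReal ε * K₁) := fun i hi => by
      have hl := (hn₀ i hi).le
      rw [eLpNorm_one_eq_lintegral_enorm] at hl
      refine le_trans ?_ (add_le_add hl ((hball i).2.trans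
        (mul_le_mul' le_rfl (mul_le_mul' le_rfl (hgrad (ns i))))))
      have hAm : AEMeasurable (fun x => ‖A i x - L x‖ₑ) (volume.restrict Ω) :=
        ((hball i).1.sub hLm).enorm
      rw [← lintegral_add_left' hAm]
      refine lintegral_mono fun x => ?_
      have : L x - β.toReal * (w (ns i)).toFun x =
        -(A i x - L x) + (A i x - β.toReal * (w (ns i)).toFun x) := by ring
      rw [this]
      refine (enorm_add_le _ _).trans (le_of_eq ?_)
      rw [enorm_neg]
    rw [e1]
    calc ∫⁻ x in Ω, ‖β.toReal * (w (ns m)).toFun x - β.toReal * (w (ns n)).toFun x‖ₑ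
        ≤ ∫⁻ x in Ω, (‖L x - β.toReal * (w (ns m)).toFun x‖ₑ +
            ‖L x - β.toReal * (w (ns n)).toFun x‖ₑ) := by
          refine lintegral_mono fun x => ?_
          have : β.toReal * (w (ns m)).toFun x - β.toReal * (w (ns n)).toFun x =
            -(L x - β.toReal * (w (ns m)).toFun x) + (L x - β.toReal * (w (ns n)).toFun x) := by
            ring
          rw [this]
          refine (enorm_add_le _ _).trans (le_of_eq ?_)
          rw [enorm_neg]
      _ = (∫⁻ x in Ω, ‖L x - β.toReal * (w (ns m)).toFun x‖ₑ) +
            ∫⁻ x in Ω, ‖L x - β.toReal * (w (ns n)).toFun x‖ₑ :=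
          lintegral_add_left' (hLm.sub ((w (ns m)).memLp.1.const_mul _)).enorm _
      _ ≤ (β * (δ / 4) + β * (ENNReal.ofReal ε * K₁)) +
            (β * (δ / 4) + β * (ENNReal.ofReal ε * K₁)) := add_le_add (e2 m hm) (e2 n hn)
      _ = β * (δ / 4 + δ / 4 + 2 * (ENNReal.ofReal ε * K₁)) := by ring
      _ ≤ β * (δ / 4 + δ / 4 + δ / 2) := by gcongr
      _ = β * δ := by
          congr 1
          have h4 : δ / 4 + δ / 4 = δ / 2 := by
            rw [← two_mul, ← mul_div_assoc, show (4 : ℝ≥0∞) = 2 * 2 by norm_num,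
              ENNReal.mul_div_mul_left _ _ (by simp) (by simp)]
          rw [h4, ENNReal.add_halves]
  obtain ⟨g, hg, hlim⟩ := hcauchy
  obtain ⟨ms, hms, hae⟩ := exists_seq_tendsto_ae_of_eLpNorm one_ne_zero
    (fun n => (w (ns n)).memLp.1) hg.1 hlim
  exact ⟨ns ∘ ms, g, hns.comp hms, hg.1, hae⟩

end Translation

/-! ### Uniform convexity of ξ ↦ |ξ|^p -/

section StrictConvexity

variable {E : Type*} [NormedAddCommGroup E] [InnerProductSpace ℝ E] {p : ℝ}

theorem norm_rpow_linear_comb_le (hp : 1 ≤ p) {a b : ℝ} (ha : 0 ≤ a) (hb : 0 ≤ b) (hab : a + b = 1)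
    (x y : E) : ‖a • x + b • y‖ ^ p ≤ a * ‖x‖ ^ p + b * ‖y‖ ^ p := by
  have h1 : ‖a • x + b • y‖ ≤ a * ‖x‖ + b * ‖y‖ := by
    refine (norm_add_le _ _).trans (le_of_eq ?_)
    rw [norm_smul, norm_smul, Real.norm_of_nonneg ha, Real.norm_of_nonneg hb]
  refine (Real.rpow_le_rpow (norm_nonneg _) h1 (by linarith)).trans ?_
  exact (convexOn_rpow hp).2 (norm_nonneg x) (norm_nonneg y) ha hb hab

theorem norm_midpoint_rpow_lt (hp : 1 < p) {x y : E} (hxy : x ≠ y) :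
    ‖(1 / 2 : ℝ) • x + (1 / 2 : ℝ) • y‖ ^ p < 1 / 2 * ‖x‖ ^ p + 1 / 2 * ‖y‖ ^ p := by
  have hp0 : 0 < p := by linarith
  rcases eq_or_ne ‖x‖ ‖y‖ with h | h
  · have h1 : ‖(1 / 2 : ℝ) • x + (1 / 2 : ℝ) • y‖ < ‖x‖ := by
      rw [← smul_add]
      exact (norm_midpoint_lt_iff h).2 hxy
    have := Real.rpow_lt_rpow (norm_nonneg _) h1 hp0
    rw [← h]
    linarith
  · have h1 : ‖(1 / 2 : ℝ) • x + (1 / 2 : ℝ) • y‖ ≤ (1 / 2) * ‖x‖ + (1 / 2) * ‖y‖ := by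
      refine (norm_add_le _ _).trans (le_of_eq ?_)
      rw [norm_smul, norm_smul, Real.norm_of_nonneg (by norm_num)]
    refine (Real.rpow_le_rpow (norm_nonneg _) h1 (by linarith)).trans_lt ?_
    exact (strictConvexOn_rpow hp).2 (norm_nonneg x) (norm_nonneg y) h (by norm_num) (by norm_num)
      (by norm_num)

/-- Both sides are homogeneous of degree p, so it suffices to argue on |x|^p + |y|^p = 1. There the
pairs with |x − y|^p ≥ ε form a compact set, on which strict convexity keeps the midpoint gap above
some m > 0; since |x − y|^p ≤ 2^p, the constant 2^p/m works. -/
theorem exists_norm_sub_rpow_le [FiniteDimensional ℝ E] (hp : 1 < p) {ε : ℝ} (hε : 0 < ε) :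
    ∃ C : ℝ, 0 ≤ C ∧ ∀ x y : E, ‖x - y‖ ^ p ≤ ε * (‖x‖ ^ p + ‖y‖ ^ p) +
      C * (1 / 2 * ‖x‖ ^ p + 1 / 2 * ‖y‖ ^ p - ‖(1 / 2 : ℝ) • x + (1 / 2 : ℝ) • y‖ ^ p) := by
  have hp0 : 0 < p := by linarith
  let D : E × E → ℝ := fun z =>
    1 / 2 * ‖z.1‖ ^ p + 1 / 2 * ‖z.2‖ ^ p - ‖(1 / 2 : ℝ) • z.1 + (1 / 2 : ℝ) • z.2‖ ^ p
  have hrc : Continuous fun t : ℝ => t ^ p := Real.continuous_rpow_const hp0.le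
  have hDc : Continuous D := by
    refine ((continuous_const.mul (hrc.comp continuous_fst.norm)).add
      (continuous_const.mul (hrc.comp continuous_snd.norm))).sub (hrc.comp ?_)
    fun_prop
  have hD0 : ∀ z, 0 ≤ D z := fun z => sub_nonneg.2 <|
    norm_rpow_linear_comb_le hp.le (by norm_num) (by norm_num) (by norm_num) _ _
  let T : Set (E × E) := {z | ‖z.1‖ ^ p + ‖z.2‖ ^ p = 1 ∧ ε ≤ ‖z.1 - z.2‖ ^ p}
  have hle1 : ∀ x y : E, ‖x‖ ^ p + ‖y‖ ^ p = 1 → ‖x‖ ≤ 1 := fun x y h => by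
    by_contra hx
    have h1 := Real.one_lt_rpow (not_le.1 hx) hp0
    have h2 : 0 ≤ ‖y‖ ^ p := by positivity
    linarith
  have hT : IsCompact T := by
    have : ProperSpace E := FiniteDimensional.proper_real E
    refine Metric.isCompact_of_isClosed_isBounded ?_ ?_
    · refine IsClosed.inter ?_ ?_
      · exact isClosed_eq ((hrc.comp continuous_fst.norm).add (hrc.comp continuous_snd.norm))
          continuous_const
      · exact isClosed_le continuous_const (hrc.comp (continuous_fst.sub continuous_snd).norm)
    · refine (Metric.isBounded_closedBall (x := (0 : E × E)) (r := 1)).subset fun z hz => ?_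
      rw [mem_closedBall_zero_iff, Prod.norm_def]
      exact max_le (hle1 _ _ hz.1) (hle1 _ _ ((add_comm _ _).trans hz.1))
  obtain ⟨m, hm, hmT⟩ : ∃ m : ℝ, 0 < m ∧ ∀ z ∈ T, m ≤ D z := by
    rcases T.eq_empty_or_nonempty with h | h
    · exact ⟨1, one_pos, fun z hz => by simp [h] at hz⟩
    · obtain ⟨z, hz, hmin⟩ := hT.exists_isMinOn h hDc.continuousOn
      refine ⟨D z, sub_pos.2 (norm_midpoint_rpow_lt hp fun heq => ?_), fun y hy => hmin hy⟩
      have := hz.2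
      rw [heq, sub_self, norm_zero, Real.zero_rpow hp0.ne'] at this
      linarith
  have hsphere : ∀ x y : E, ‖x‖ ^ p + ‖y‖ ^ p = 1 → ‖x - y‖ ^ p ≤ ε + 2 ^ p / m * D (x, y) := by
    intro x y h
    have hC : 0 ≤ 2 ^ p / m * D (x, y) := mul_nonneg (by positivity) (hD0 _)
    rcases le_total (‖x - y‖ ^ p) ε with h1 | h1
    · linarith
    · have h2 := hmT (x, y) ⟨h, h1⟩
      have h3 : ‖x - y‖ ≤ 2 := (norm_sub_le _ _).trans (by
        linarith [hle1 x y h, hle1 y x ((add_comm _ _).trans h)])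
      have h4 : ‖x - y‖ ^ p ≤ 2 ^ p := Real.rpow_le_rpow (norm_nonneg _) h3 hp0.le
      have h5 : (2 : ℝ) ^ p = 2 ^ p / m * m := by field_simp
      have h6 : 2 ^ p / m * m ≤ 2 ^ p / m * D (x, y) := by gcongr
      linarith
  refine ⟨2 ^ p / m, by positivity, fun x y => ?_⟩
  set s := ‖x‖ ^ p + ‖y‖ ^ p with hs
  have hs0 : 0 ≤ s := by positivity
  rcases hs0.eq_or_lt with h | h
  · have hx : ‖x‖ ^ p = 0 := by
      have : 0 ≤ ‖y‖ ^ p := by positivity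
      have : 0 ≤ ‖x‖ ^ p := by positivity
      linarith
    have hy : ‖y‖ ^ p = 0 := by linarith
    rw [Real.rpow_eq_zero (norm_nonneg _) hp0.ne', norm_eq_zero] at hx hy
    simp [hx, hy, Real.zero_rpow hp0.ne', ← h]
  · have hsc : ∀ z : E, ‖(s ^ (-p⁻¹)) • z‖ ^ p = s⁻¹ * ‖z‖ ^ p := fun z => by
      rw [norm_smul, Real.norm_of_nonneg (by positivity),
        Real.mul_rpow (by positivity) (norm_nonneg _), ← Real.rpow_mul hs0, neg_mul,
        inv_mul_cancel₀ hp0.ne', Real.rpow_neg_one]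
    have h1 := hsphere (s ^ (-p⁻¹) • x) (s ^ (-p⁻¹) • y) (by
      rw [hsc, hsc, ← mul_add, ← hs, inv_mul_cancel₀ h.ne'])
    have e1 : (1 / 2 : ℝ) • s ^ (-p⁻¹) • x + (1 / 2 : ℝ) • s ^ (-p⁻¹) • y =
        s ^ (-p⁻¹) • ((1 / 2 : ℝ) • x + (1 / 2 : ℝ) • y) := by
      rw [smul_comm, smul_comm (1 / 2 : ℝ), ← smul_add]
    simp only [D] at h1
    rw [e1, ← smul_sub, hsc, hsc, hsc, hsc] at h1
    have h2 := mul_le_mul_of_nonneg_left h1 hs0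
    have e2 : s * (s⁻¹ * ‖x - y‖ ^ p) = ‖x - y‖ ^ p := by field_simp
    rw [e2] at h2
    refine h2.trans (le_of_eq ?_)
    field_simp

end StrictConvexity

/-! ### Weak limits of gradients through convex combinations -/

theorem integrable_inner_of_memLp {α E : Type*} {m : MeasurableSpace α} {μ : Measure α}
    [NormedAddCommGroup E] [InnerProductSpace ℝ E] {p q : ℝ} (hpq : p.HolderConjugate q)
    {f g : α → E} (hf : MemLp f (ENNReal.ofReal p) μ) (hg : MemLp g (ENNReal.ofReal q) μ) :
    Integrable (fun x => inner ℝ (f x) (g x)) μ :=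
  (integrable_mul_norm hpq hf hg).mono' (hf.1.inner hg.1) (.of_forall fun _ => norm_inner_le_norm _ _)

theorem tendsto_integral_inner_of_eLpNorm_sub {α E : Type*} {m : MeasurableSpace α} {μ : Measure α}
    [NormedAddCommGroup E] [InnerProductSpace ℝ E] {p q : ℝ} (hpq : p.HolderConjugate q)
    {f : ℕ → α → E} {f₀ g : α → E} (hf : ∀ n, MemLp (f n) (ENNReal.ofReal p) μ)
    (hf0 : MemLp f₀ (ENNReal.ofReal p) μ) (hg : MemLp g (ENNReal.ofReal q) μ)
    (h : Tendsto (fun n => eLpNorm (fun x => f n x - f₀ x) (ENNReal.ofReal p) μ) atTop (𝓝 0)) :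
    Tendsto (fun n => ∫ x, inner ℝ (f n x) (g x) ∂μ) atTop (𝓝 (∫ x, inner ℝ (f₀ x) (g x) ∂μ)) := by
  have h1 := tendsto_integral_mul_norm_zero hpq.symm (f := fun _ => g) (fun _ => hg)
    (fun n => (hf n).sub hf0) (fun _ => le_rfl) h
  rw [tendsto_iff_norm_sub_tendsto_zero]
  refine squeeze_zero (fun _ => norm_nonneg _) (fun n => ?_) h1
  rw [← integral_sub (integrable_inner_of_memLp hpq (hf n) hg)
    (integrable_inner_of_memLp hpq hf0 hg)]
  refine norm_integral_le_of_norm_le (integrable_mul_norm hpq.symm hg ((hf n).sub hf0))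
    (.of_forall fun x => ?_)
  rw [← inner_sub_left, mul_comm]
  exact norm_inner_le_norm _ _

section Mazur

variable {N : ℕ} {Ω : Set (RN N)} {p : ℝ}

theorem exists_tendsto_eLpNorm_of_integral_cauchy {α E : Type*} {m : MeasurableSpace α}
    {μ : Measure α} [NormedAddCommGroup E] [CompleteSpace E] (hp : 1 ≤ p) {f : ℕ → α → E}
    (hf : ∀ n, MemLp (f n) (ENNReal.ofReal p) μ)
    (h : ∀ η : ℝ, 0 < η → ∃ n₀, ∀ n, n₀ ≤ n → ∀ m, n ≤ m → ∫ x, ‖f m x - f n x‖ ^ p ∂μ ≤ η) :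
    ∃ g, MemLp g (ENNReal.ofReal p) μ ∧
      Tendsto (fun n => eLpNorm (fun x => f n x - g x) (ENNReal.ofReal p) μ) atTop (𝓝 0) := by
  have hp0 : 0 < p := by linarith
  refine exists_tendsto_eLpNorm_of_cauchy (by simpa using hp) hf fun ε hε => ?_
  have hmin : min ε 1 ≠ ⊤ := ((min_le_right ε 1).trans_lt ENNReal.one_lt_top).ne
  have hδ : 0 < (min ε 1).toReal := ENNReal.toReal_pos (lt_min hε one_pos).ne' hmin
  have hδε : ENNReal.ofReal (min ε 1).toReal ≤ ε := by
    rw [ENNReal.ofReal_toReal hmin]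
    exact min_le_left _ _
  obtain ⟨n₀, h0⟩ := h ((min ε 1).toReal ^ p) (by positivity)
  have key : ∀ n, n₀ ≤ n → ∀ m, n ≤ m →
      eLpNorm (fun x => f m x - f n x) (ENNReal.ofReal p) μ ≤ ε := fun n hn m hm => by
    refine le_trans ?_ hδε
    have hsub : MemLp (fun x => f m x - f n x) (ENNReal.ofReal p) μ := (hf m).sub (hf n)
    rw [hsub.eLpNorm_ofReal_eq hp0]
    refine ENNReal.ofReal_le_ofReal ?_
    have h1 := Real.rpow_le_rpow (integral_nonneg fun x => by positivity) (h0 n hn m hm)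
      (inv_nonneg.2 hp0.le)
    rwa [← Real.rpow_mul hδ.le, mul_inv_cancel₀ hp0.ne', Real.rpow_one] at h1
  refine ⟨n₀, fun m hm n hn => ?_⟩
  rcases le_total n m with hnm | hnm
  · exact key n hn m hnm
  · have := key m hm n hnm
    have e := eLpNorm_sub_comm (f m) (f n) (ENNReal.ofReal p) μ
    exact e.trans_le this

/-- A Mazur argument without reflexivity. In the convex hull of each tail choose an element g_n of
nearly minimal energy ∫|Z|^p. The minimal energies d_n increase to a finite limit D, and the
midpoint of g_m and g_n still lies in the n-th hull, so its energy is at least d_n; uniform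
convexity then makes the gradients of g_n Cauchy. Closeness to u and to the value l are convex
conditions, hence are inherited by the g_n and pass to the limit. -/
theorem W01.exists_grad_of_tendsto [IsFiniteMeasure (volume.restrict Ω)] {q : ℝ}
    (hpq : p.HolderConjugate q) {w : ℕ → W01 Ω p} {u : RN N → ℝ} {K : ℝ}
    (hK : ∀ n, ∫ x in Ω, ‖(w n).grad x‖ ^ p ≤ K)
    (hum : MemLp u (ENNReal.ofReal p) (volume.restrict Ω))
    (hu : Tendsto (fun n => eLpNorm (fun x => (w n).toFun x - u x) (ENNReal.ofReal p)
      (volume.restrict Ω)) atTop (𝓝 0))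
    {F : RN N → RN N} (hF : MemLp F (ENNReal.ofReal q) (volume.restrict Ω)) {l : ℝ}
    (hl : Tendsto (fun n => ∫ x in Ω, inner ℝ ((w n).grad x) (F x)) atTop (𝓝 l)) :
    ∃ G, MemW01 Ω p u G ∧ ∫ x in Ω, inner ℝ (G x) (F x) = l := by
  have hp : 1 < p := hpq.lt
  have hp0 : 0 < p := by linarith
  have hp1 : (1 : ℝ≥0∞) ≤ ENNReal.ofReal p := by simpa using hp.le
  -- Functions and gradients are combined as pairs, so that the same weights act on both.
  let S : ℕ → Set ((RN N → ℝ) × (RN N → RN N)) := fun n =>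
    convexHull ℝ {z | ∃ j, n ≤ j ∧ z = ((w j).toFun, (w j).grad)}
  let I : (RN N → ℝ) × (RN N → RN N) → ℝ := fun z => ∫ x in Ω, ‖z.2 x‖ ^ p
  have hI0 : ∀ z, 0 ≤ I z := fun z => integral_nonneg fun x => by positivity
  have hS : ∀ (n : ℕ) (e : ℝ≥0∞) (e' : ℝ),
      (∀ j, n ≤ j → eLpNorm (fun x => (w j).toFun x - u x) (ENNReal.ofReal p)
        (volume.restrict Ω) ≤ e) →
      (∀ j, n ≤ j → |(∫ x in Ω, inner ℝ ((w j).grad x) (F x)) - l| ≤ e') →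
      ∀ z ∈ S n, MemW01 Ω p z.1 z.2 ∧ I z ≤ K ∧
        eLpNorm (fun x => z.1 x - u x) (ENNReal.ofReal p) (volume.restrict Ω) ≤ e ∧
        |(∫ x in Ω, inner ℝ (z.2 x) (F x)) - l| ≤ e' := by
    intro n e e' h1 h2
    refine convexHull_min (𝕜 := ℝ) (t := {z | MemW01 Ω p z.1 z.2 ∧ I z ≤ K ∧
        eLpNorm (fun x => z.1 x - u x) (ENNReal.ofReal p) (volume.restrict Ω) ≤ e ∧
        |(∫ x in Ω, inner ℝ (z.2 x) (F x)) - l| ≤ e'}) ?_ ?_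
    · rintro z ⟨j, hj, rfl⟩
      exact ⟨(w j).memW01, hK j, h1 j hj, h2 j hj⟩
    · rintro y ⟨hy1, hy2, hy3, hy4⟩ z ⟨hz1, hz2, hz3, hz4⟩ a b ha hb hab
      have hm := hy1.linear_comb hp hz1 a b
      refine ⟨hm, ?_, ?_, ?_⟩
      · have hle : I (a • y + b • z) ≤ a * I y + b * I z := by
          simp only [I]
          rw [← integral_const_mul, ← integral_const_mul, ← integral_add]
          · refine integral_mono (hm.memLp_grad.integrable_rpow_norm hp0)
              (((hy1.memLp_grad.integrable_rpow_norm hp0).const_mul a).add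
                ((hz1.memLp_grad.integrable_rpow_norm hp0).const_mul b)) fun x => ?_
            exact norm_rpow_linear_comb_le hp.le ha hb hab _ _
          · exact (hy1.memLp_grad.integrable_rpow_norm hp0).const_mul a
          · exact (hz1.memLp_grad.integrable_rpow_norm hp0).const_mul b
        calc I (a • y + b • z) ≤ a * I y + b * I z := hle
          _ ≤ a * K + b * K := by gcongr
          _ = K := by rw [← add_mul, hab, one_mul]
      · have := eLpNorm_linear_comb_le hp1 a b (hy1.memLp.sub hum).1 (hz1.memLp.sub hum).1
        calc eLpNorm (fun x => (a • y + b • z).1 x - u x) (ENNReal.ofReal p) (volume.restrict Ω)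
            = eLpNorm (fun x => a • (y.1 - u) x + b • (z.1 - u) x) (ENNReal.ofReal p)
                (volume.restrict Ω) := by
              congr 1
              funext x
              have : u x = a * u x + b * u x := by rw [← add_mul, hab, one_mul]
              simp only [Prod.fst_add, Prod.smul_fst, Pi.add_apply, Pi.smul_apply, smul_eq_mul,
                Pi.sub_apply]
              linarith
          _ ≤ ‖a‖ₑ * e + ‖b‖ₑ * e := this.trans (by gcongr <;> assumption)
          _ = e := by
              rw [← add_mul, Real.enorm_of_nonneg ha, Real.enorm_of_nonneg hb,
                ← ENNReal.ofReal_add ha hb, hab, ENNReal.ofReal_one, one_mul]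
      · have e1 : ∫ x in Ω, inner ℝ ((a • y + b • z).2 x) (F x) =
            a * (∫ x in Ω, inner ℝ (y.2 x) (F x)) + b * ∫ x in Ω, inner ℝ (z.2 x) (F x) := by
          rw [← integral_const_mul, ← integral_const_mul, ← integral_add]
          · refine integral_congr_ae (.of_forall fun x => ?_)
            simp [inner_add_left, inner_smul_left]
          · exact (integrable_inner_of_memLp hpq hy1.memLp_grad hF).const_mul a
          · exact (integrable_inner_of_memLp hpq hz1.memLp_grad hF).const_mul b
        rw [e1]
        rw [abs_le] at hy4 hz4 ⊢
        have hb' : b = 1 - a := by linarith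
        subst hb'
        constructor <;> nlinarith
  obtain ⟨e, he⟩ : ∃ e' : ℝ, ∀ j, |(∫ x in Ω, inner ℝ ((w j).grad x) (F x)) - l| ≤ e' := by
    obtain ⟨e, he⟩ := (hl.sub_const l).abs.bddAbove_range
    exact ⟨e, fun j => he ⟨j, rfl⟩⟩
  have hS' : ∀ n, ∀ z ∈ S n, MemW01 Ω p z.1 z.2 ∧ I z ≤ K := fun n z hz =>
    have := hS n ⊤ e (fun _ _ => le_top) (fun j _ => he j) z hz
    ⟨this.1, this.2.1⟩
  have hne : ∀ n, (S n).Nonempty := fun n => ⟨_, subset_convexHull ℝ _ ⟨n, le_rfl, rfl⟩⟩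
  have hanti : ∀ m n, n ≤ m → S m ⊆ S n := fun m n hnm =>
    convexHull_mono fun z ⟨j, hj, hz⟩ => ⟨j, hnm.trans hj, hz⟩
  let d : ℕ → ℝ := fun n => sInf (I '' S n)
  have hbb : ∀ n, BddBelow (I '' S n) := fun n => ⟨0, by rintro _ ⟨z, -, rfl⟩; exact hI0 z⟩
  have hdle : ∀ n, ∀ z ∈ S n, d n ≤ I z := fun n z hz => csInf_le (hbb n) ⟨z, hz, rfl⟩
  have hdmono : Monotone d := fun n m hnm =>
    csInf_le_csInf (hbb n) ((hne m).image I) (Set.image_mono (hanti m n hnm))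
  have hdK : ∀ n, d n ≤ K := fun n => by
    obtain ⟨z, hz⟩ := hne n
    exact (hdle n z hz).trans (hS' n z hz).2
  have hdlim := tendsto_atTop_ciSup hdmono ⟨K, by rintro _ ⟨n, rfl⟩; exact hdK n⟩
  set D := ⨆ n, d n
  have hdD : ∀ n, d n ≤ D := fun n => le_ciSup (f := d) ⟨K, by rintro _ ⟨n, rfl⟩; exact hdK n⟩ n
  have hex : ∀ n : ℕ, ∃ z ∈ S n, I z < d n + 1 / ((n : ℝ) + 1) := fun n => by
    obtain ⟨_, ⟨z, hz, rfl⟩, hlt⟩ := exists_lt_of_csInf_lt ((hne n).image I)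
      (show d n < d n + 1 / ((n : ℝ) + 1) from lt_add_of_pos_right _ (by positivity))
    exact ⟨z, hz, hlt⟩
  choose g hgS hgI using hex
  have hr : Tendsto (fun n : ℕ => D + 1 / ((n : ℝ) + 1) - d n) atTop (𝓝 0) := by
    have := (tendsto_const_nhds (x := D)).add tendsto_one_div_add_atTop_nhds_zero_nat |>.sub hdlim
    simpa using this
  have hK0 : 0 ≤ K := (hI0 _).trans (hS' 0 _ (hgS 0)).2
  obtain ⟨G, hG, hGlim⟩ := exists_tendsto_eLpNorm_of_integral_cauchy hp.le
    (f := fun n => (g n).2) (μ := volume.restrict Ω) (fun n => (hS' n _ (hgS n)).1.memLp_grad) (by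
      intro η hη
      -- Both energies are at most K, so with this ε the first term is at most η/2; K + 1 avoids
      -- division by zero.
      obtain ⟨C, hC0, hC⟩ := exists_norm_sub_rpow_le (E := RN N) hp
        (ε := η / (4 * (K + 1))) (by positivity)
      have h1 : Tendsto (fun n : ℕ => C * (D + 1 / ((n : ℝ) + 1) - d n)) atTop (𝓝 0) := by
        simpa using hr.const_mul C
      obtain ⟨n₀, hn₀⟩ := eventually_atTop.1 (h1.eventually_lt_const (half_pos hη))
      refine ⟨n₀, fun n hn m hnm => ?_⟩
      have hgn := hS' n _ (hgS n)
      have hgm := hS' m _ (hgS m)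
      have hmid : (1 / 2 : ℝ) • g m + (1 / 2 : ℝ) • g n ∈ S n :=
        convex_convexHull ℝ _ (hanti m n hnm (hgS m)) (hgS n) (by norm_num) (by norm_num)
          (by norm_num)
      have i1 := hgm.1.memLp_grad.integrable_rpow_norm hp0
      have i2 := hgn.1.memLp_grad.integrable_rpow_norm hp0
      have i3 := (hS' n _ hmid).1.memLp_grad.integrable_rpow_norm hp0
      have hint : ∫ x in Ω, ‖(g m).2 x - (g n).2 x‖ ^ p ≤
          η / (4 * (K + 1)) * (I (g m) + I (g n)) + C * (1 / 2 * I (g m) + 1 / 2 * I (g n) -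
            I ((1 / 2 : ℝ) • g m + (1 / 2 : ℝ) • g n)) := by
        simp only [I]
        have j12 : Integrable (fun x => 1 / 2 * ‖(g m).2 x‖ ^ p + 1 / 2 * ‖(g n).2 x‖ ^ p)
            (volume.restrict Ω) := (i1.const_mul _).add (i2.const_mul _)
        have j3 : Integrable (fun x => C * (1 / 2 * ‖(g m).2 x‖ ^ p + 1 / 2 * ‖(g n).2 x‖ ^ p -
            ‖((1 / 2 : ℝ) • g m + (1 / 2 : ℝ) • g n).2 x‖ ^ p)) (volume.restrict Ω) :=
          (j12.sub i3).const_mul C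
        have j4 : Integrable (fun x => η / (4 * (K + 1)) * (‖(g m).2 x‖ ^ p + ‖(g n).2 x‖ ^ p))
            (volume.restrict Ω) := (i1.add i2).const_mul _
        rw [← integral_add i1 i2, ← integral_const_mul, ← integral_const_mul (1 / 2 : ℝ),
          ← integral_const_mul (1 / 2 : ℝ), ← integral_add (i1.const_mul _) (i2.const_mul _),
          ← integral_sub j12 i3, ← integral_const_mul, ← integral_add j4 j3]
        exact integral_mono ((hgm.1.memLp_grad.sub hgn.1.memLp_grad).integrable_rpow_norm hp0)
          (j4.add j3) fun x => hC _ _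
      have hmn : (1 : ℝ) / ((m : ℝ) + 1) ≤ 1 / ((n : ℝ) + 1) := by
        have : (n : ℝ) ≤ m := by exact_mod_cast hnm
        gcongr
      have hdef : 1 / 2 * I (g m) + 1 / 2 * I (g n) - I ((1 / 2 : ℝ) • g m + (1 / 2 : ℝ) • g n) ≤
          D + 1 / ((n : ℝ) + 1) - d n := by
        have := hdle n _ hmid
        have := hgI m
        have := hgI n
        have := hdD m
        have := hdD n
        linarith
      have ha : η / (4 * (K + 1)) * (I (g m) + I (g n)) ≤ η / 2 := by
        calc η / (4 * (K + 1)) * (I (g m) + I (g n))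
            ≤ η / (4 * (K + 1)) * ((K + 1) + (K + 1)) := by
              have := hgm.2
              have := hgn.2
              gcongr <;> linarith
          _ = η / 2 := by field_simp; norm_num
      have hb := mul_le_mul_of_nonneg_left hdef hC0
      have hc := hn₀ n hn
      linarith)
  have hglim1 : Tendsto (fun n => eLpNorm (fun x => (g n).1 x - u x) (ENNReal.ofReal p)
      (volume.restrict Ω)) atTop (𝓝 0) := by
    refine ENNReal.tendsto_nhds_zero.2 fun ε hε => ?_
    obtain ⟨n₀, hn₀⟩ := eventually_atTop.1 (hu.eventually_le_const hε)
    filter_upwards [eventually_ge_atTop n₀] with n hn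
    exact (hS n ε e (fun j hj => hn₀ j (hn.trans hj)) (fun j _ => he j) _ (hgS n)).2.2.1
  have hglim2 : Tendsto (fun n => ∫ x in Ω, inner ℝ ((g n).2 x) (F x)) atTop (𝓝 l) := by
    refine Metric.tendsto_atTop.2 fun ε hε => ?_
    obtain ⟨n₀, hn₀⟩ := Metric.tendsto_atTop.1 hl (ε / 2) (half_pos hε)
    refine ⟨n₀, fun n hn => ?_⟩
    have := (hS n ⊤ (ε / 2) (fun _ _ => le_top)
      (fun j hj => by simpa [Real.dist_eq] using (hn₀ j (hn.trans hj)).le) _ (hgS n)).2.2.2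
    rw [Real.dist_eq]
    linarith
  refine ⟨G, memW01_of_tendsto hp hum hG (fun n => (hS' n _ (hgS n)).1) hglim1 hGlim, ?_⟩
  exact tendsto_nhds_unique (tendsto_integral_inner_of_eLpNorm_sub hpq
    (fun n => (hS' n _ (hgS n)).1.memLp_grad) hG hF hGlim) hglim2

end Mazur

/-! ### The exponential test function -/

section ExpTest

/-- The Boccardo–Murat–Puel test function `s e^{λ s²}`. -/
def expTest (lam s : ℝ) : ℝ := s * Real.exp (lam * s ^ 2)

theorem contDiff_expTest (lam : ℝ) : ContDiff ℝ ∞ (expTest lam) := by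
  unfold expTest
  fun_prop

@[simp] theorem expTest_zero (lam : ℝ) : expTest lam 0 = 0 := by simp [expTest]

theorem deriv_expTest (lam s : ℝ) :
    deriv (expTest lam) s = (1 + 2 * lam * s ^ 2) * Real.exp (lam * s ^ 2) := by
  have h1 : HasDerivAt (fun s : ℝ => lam * s ^ 2) (lam * (2 * s)) s := by
    simpa using (hasDerivAt_pow 2 s).const_mul lam
  have h2 := (hasDerivAt_id s).mul h1.exp
  have h3 : HasDerivAt (expTest lam)
      (1 * Real.exp (lam * s ^ 2) + s * (Real.exp (lam * s ^ 2) * (lam * (2 * s)))) s := h2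
  rw [h3.deriv]
  ring

theorem abs_expTest (lam s : ℝ) : |expTest lam s| = |s| * Real.exp (lam * s ^ 2) := by
  rw [expTest, abs_mul, abs_of_pos (Real.exp_pos _)]

/-- The value λ = B²/(4α²) completes the square: the right-hand side equals (α/2 + (α − B|s|)²/(2α))
e^{λs²}. -/
theorem half_le_deriv_expTest_sub {α B : ℝ} (hα : 0 < α) (s : ℝ) :
    α / 2 ≤ α * deriv (expTest (B ^ 2 / (4 * α ^ 2))) s -
      B * |expTest (B ^ 2 / (4 * α ^ 2)) s| := by
  rw [deriv_expTest, abs_expTest]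
  set e := Real.exp (B ^ 2 / (4 * α ^ 2) * s ^ 2) with he
  have h1 : 1 ≤ e := Real.one_le_exp (by positivity)
  have h2 : α * ((1 + 2 * (B ^ 2 / (4 * α ^ 2)) * s ^ 2) * e) - B * (|s| * e) =
      (α / 2 + (α - B * |s|) ^ 2 / (2 * α)) * e := by
    rw [← sq_abs s]
    field_simp
    ring
  rw [h2]
  have h3 : 0 ≤ (α - B * |s|) ^ 2 / (2 * α) := by positivity
  nlinarith

theorem deriv_expTest_le {lam s t : ℝ} (hlam : 0 ≤ lam) (hs : |s| ≤ t) :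
    deriv (expTest lam) s ≤ (1 + 2 * lam * t ^ 2) * Real.exp (lam * t ^ 2) := by
  rw [deriv_expTest]
  have : s ^ 2 ≤ t ^ 2 := sq_le_sq.2 (hs.trans (le_abs_self t))
  gcongr

theorem abs_expTest_le {lam s t : ℝ} (hlam : 0 ≤ lam) (hs : |s| ≤ t) :
    |expTest lam s| ≤ t * Real.exp (lam * t ^ 2) := by
  rw [abs_expTest]
  have : s ^ 2 ≤ t ^ 2 := sq_le_sq.2 (hs.trans (le_abs_self t))
  have : 0 ≤ t := (abs_nonneg s).trans hs
  gcongr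

theorem deriv_expTest_nonneg {lam : ℝ} (hlam : 0 ≤ lam) (s : ℝ) : 0 ≤ deriv (expTest lam) s := by
  rw [deriv_expTest]
  positivity

end ExpTest

/-! ### Consequences of the structure conditions -/

section Structure

variable {N : ℕ} {Ω : Set (RN N)} {p α β α₀ : ℝ}
  {a : RN N → ℝ → RN N → RN N} {a₀ : RN N → ℝ → ℝ} {H : RN N → ℝ → RN N → ℝ}
  {h f : RN N → ℝ} {b : ℝ → ℝ}

theorem abs_truncH_le (j : ℕ) (x : RN N) (s : ℝ) (ξ : RN N) : |truncH H j x s ξ| ≤ |H x s ξ| := by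
  rw [truncH, abs_div]
  have h1 : (1 : ℝ) ≤ 1 + 1 / (j : ℝ) * |H x s ξ| := by
    have : (0 : ℝ) ≤ 1 / (j : ℝ) * |H x s ξ| := by positivity
    linarith
  exact div_le_self (abs_nonneg _) (h1.trans (le_abs_self _))

/-- The map t ↦ t/(1 + |t|/j) is continuous and does not increase |t|, so f and b are kept; this
makes all later bounds independent of j. The case j = 0, where 1/j is 0 by convention, is harmless.
-/
theorem NaturalGrowthData.truncH (hD : NaturalGrowthData Ω p α β α₀ a a₀ H h f b) (j : ℕ) :
    NaturalGrowthData Ω p α β α₀ a a₀ (truncH H j) h f b :=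
  { hD with
    H_caratheodory := by
      have hpos : ∀ t : ℝ, (1 : ℝ) + 1 / (j : ℝ) * |t| ≠ 0 := fun t => by positivity
      have hc : Continuous fun t : ℝ => t / (1 + 1 / (j : ℝ) * |t|) :=
        continuous_id.div (by fun_prop) hpos
      refine ⟨fun s => hc.comp_aestronglyMeasurable (hD.H_caratheodory.1 s), ?_⟩
      filter_upwards [hD.H_caratheodory.2] with x hx
      exact hc.comp hx
    H_growth := by
      filter_upwards [hD.H_growth] with x hx s ξ
      exact (abs_truncH_le j x s ξ).trans (hx s ξ) }

variable {u : RN N → ℝ} {G : RN N → RN N} {R : ℝ}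

theorem memLp_norm_rpow_sub_one (hp : 1 < p)
    (hG : MemLp G (ENNReal.ofReal p) (volume.restrict Ω)) :
    MemLp (fun x => ‖G x‖ ^ (p - 1)) (ENNReal.ofReal (p / (p - 1))) (volume.restrict Ω) := by
  have hp1 : 0 < p - 1 := by linarith
  have hm : AEStronglyMeasurable (fun x => ‖G x‖ ^ (p - 1)) (volume.restrict Ω) :=
    (Real.continuous_rpow_const hp1.le).comp_aestronglyMeasurable hG.1.norm
  rw [memLp_ofReal_iff (div_pos (by linarith) hp1) hm]
  refine (hG.integrable_rpow_norm (by linarith)).congr (.of_forall fun x => ?_)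
  dsimp only
  rw [Real.norm_of_nonneg (by positivity), ← Real.rpow_mul (norm_nonneg _),
    mul_div_cancel₀ p hp1.ne']

theorem NaturalGrowthData.norm_a_le (hD : NaturalGrowthData Ω p α β α₀ a a₀ H h f b)
    (hp : 1 < p) (hβ : 0 < β) (hR : ∀ᵐ x ∂(volume.restrict Ω), |u x| ≤ R) (G : RN N → RN N) :
    ∀ᵐ x ∂(volume.restrict Ω),
      ‖a x (u x) (G x)‖ ≤ β * (|h x| + R ^ (p - 1) + ‖G x‖ ^ (p - 1)) := by
  filter_upwards [hD.a_growth, hR] with x h1 h2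
  refine (h1 _ _).trans ?_
  have : |u x| ^ (p - 1) ≤ R ^ (p - 1) := Real.rpow_le_rpow (abs_nonneg _) h2 (by linarith)
  have := le_abs_self (h x)
  gcongr

theorem NaturalGrowthData.abs_a₀_le (hD : NaturalGrowthData Ω p α β α₀ a a₀ H h f b)
    (hp : 1 < p) (hβ : 0 < β) (hR : ∀ᵐ x ∂(volume.restrict Ω), |u x| ≤ R) :
    ∀ᵐ x ∂(volume.restrict Ω), |a₀ x (u x)| ≤ β * (|h x| + R ^ (p - 1)) := by
  filter_upwards [hD.a₀_growth, hR] with x h1 h2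
  refine (h1 _).trans ?_
  have : |u x| ^ (p - 1) ≤ R ^ (p - 1) := Real.rpow_le_rpow (abs_nonneg _) h2 (by linarith)
  have := le_abs_self (h x)
  gcongr

theorem NaturalGrowthData.abs_H_le (hD : NaturalGrowthData Ω p α β α₀ a a₀ H h f b)
    (hR : ∀ᵐ x ∂(volume.restrict Ω), |u x| ≤ R) (G : RN N → RN N) :
    ∀ᵐ x ∂(volume.restrict Ω), |H x (u x) (G x)| ≤ f x + b R * ‖G x‖ ^ p := by
  filter_upwards [hD.H_growth, hR] with x h1 h2
  refine (h1 _ _).trans ?_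
  have : b |u x| ≤ b R := hD.b_mono (Set.mem_Ici.2 (abs_nonneg _))
    (Set.mem_Ici.2 ((abs_nonneg _).trans h2)) h2
  gcongr

theorem NaturalGrowthData.f_le (hD : NaturalGrowthData Ω p α β α₀ a a₀ H h f b) :
    ∀ᵐ x ∂(volume.restrict Ω), f x ≤ supNorm Ω f := by
  filter_upwards [ae_le_lpNorm_exponent_top hD.f_memLp] with x hx
  exact (le_abs_self _).trans hx

theorem holderConjugate_div (hp : 1 < p) : p.HolderConjugate (p / (p - 1)) :=
  Real.HolderConjugate.conjExponent hp

theorem NaturalGrowthData.aestronglyMeasurable_a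
    (hD : NaturalGrowthData Ω p α β α₀ a a₀ H h f b)
    (hu : AEStronglyMeasurable u (volume.restrict Ω))
    (hG : AEStronglyMeasurable G (volume.restrict Ω)) :
    AEStronglyMeasurable (fun x => a x (u x) (G x)) (volume.restrict Ω) :=
  hD.a_caratheodory.aestronglyMeasurable_comp (hu.prodMk hG)

theorem NaturalGrowthData.aestronglyMeasurable_H
    (hD : NaturalGrowthData Ω p α β α₀ a a₀ H h f b)
    (hu : AEStronglyMeasurable u (volume.restrict Ω))
    (hG : AEStronglyMeasurable G (volume.restrict Ω)) :
    AEStronglyMeasurable (fun x => H x (u x) (G x)) (volume.restrict Ω) :=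
  hD.H_caratheodory.aestronglyMeasurable_comp (hu.prodMk hG)

variable [IsFiniteMeasure (volume.restrict Ω)]

theorem NaturalGrowthData.memLp_growth (hD : NaturalGrowthData Ω p α β α₀ a a₀ H h f b)
    (hp : 1 < p) (hG : MemLp G (ENNReal.ofReal p) (volume.restrict Ω)) (R : ℝ) :
    MemLp (fun x => β * (|h x| + R ^ (p - 1) + ‖G x‖ ^ (p - 1))) (ENNReal.ofReal (p / (p - 1)))
      (volume.restrict Ω) :=
  ((hD.h_memLp.abs.add (memLp_const _)).add (memLp_norm_rpow_sub_one hp hG)).const_mul β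

theorem NaturalGrowthData.memLp_a (hD : NaturalGrowthData Ω p α β α₀ a a₀ H h f b)
    (hp : 1 < p) (hβ : 0 < β) (hu : AEStronglyMeasurable u (volume.restrict Ω))
    (hR : ∀ᵐ x ∂(volume.restrict Ω), |u x| ≤ R)
    (hG : MemLp G (ENNReal.ofReal p) (volume.restrict Ω)) :
    MemLp (fun x => a x (u x) (G x)) (ENNReal.ofReal (p / (p - 1))) (volume.restrict Ω) :=
  (hD.memLp_growth hp hG R).of_le (hD.aestronglyMeasurable_a hu hG.1)
    ((hD.norm_a_le hp hβ hR G).mono fun _ hx => hx.trans (le_abs_self _))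

theorem NaturalGrowthData.integrable_a₀ (hD : NaturalGrowthData Ω p α β α₀ a a₀ H h f b)
    (hp : 1 < p) (hβ : 0 < β) (hu : AEStronglyMeasurable u (volume.restrict Ω))
    (hR : ∀ᵐ x ∂(volume.restrict Ω), |u x| ≤ R) :
    Integrable (fun x => a₀ x (u x)) (volume.restrict Ω) := by
  have h1 : Integrable h (volume.restrict Ω) := memLp_one_iff_integrable.1
    (hD.h_memLp.mono_exponent (by simpa using (holderConjugate_div hp).symm.lt.le))
  exact ((h1.abs.add (integrable_const _)).const_mul β).mono'
    (hD.a₀_caratheodory.aestronglyMeasurable_comp hu) (hD.abs_a₀_le hp hβ hR)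

theorem NaturalGrowthData.integrable_H (hD : NaturalGrowthData Ω p α β α₀ a a₀ H h f b)
    (hp : 1 < p) (hu : AEStronglyMeasurable u (volume.restrict Ω))
    (hR : ∀ᵐ x ∂(volume.restrict Ω), |u x| ≤ R)
    (hG : MemLp G (ENNReal.ofReal p) (volume.restrict Ω)) :
    Integrable (fun x => H x (u x) (G x)) (volume.restrict Ω) := by
  have h1 : Integrable f (volume.restrict Ω) :=
    memLp_one_iff_integrable.1 (hD.f_memLp.mono_exponent le_top)
  exact (h1.add ((hG.integrable_rpow_norm (by linarith)).const_mul (b R))).mono'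
    (hD.aestronglyMeasurable_H hu hG.1) (hD.abs_H_le hR G)

end Structure

/-! ### Admissible test functions and the L^∞ bound -/

section Solution

variable {N : ℕ} {Ω : Set (RN N)} {p α β α₀ : ℝ}
  {a : RN N → ℝ → RN N → RN N} {a₀ : RN N → ℝ → ℝ} {H : RN N → ℝ → RN N → ℝ}
  {h f : RN N → ℝ} {b : ℝ → ℝ} {ψ u Ψ : W01 Ω p}

theorem W01.Bounded.ae_abs_le (hu : u.Bounded) :
    ∀ᵐ x ∂(volume.restrict Ω), |u.toFun x| ≤ supNorm Ω u.toFun :=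
  ae_le_lpNorm_exponent_top hu

theorem supNorm_nonneg (g : RN N → ℝ) : 0 ≤ supNorm Ω g := lpNorm_nonneg

theorem W01.bounded_of_ae_abs_le {R : ℝ} (hR : ∀ᵐ x ∂(volume.restrict Ω), |u.toFun x| ≤ R) :
    u.Bounded := memLp_top_of_bound u.memLp.1 R hR

variable [IsFiniteMeasure (volume.restrict Ω)]

/-- Take v = u − t z in the inequality and divide by t. The free scale t lets any bounded z be used
once some small multiple of it keeps v above ψ. -/
theorem IsObstacleSolution.integral_le_zero (hD : NaturalGrowthData Ω p α β α₀ a a₀ H h f b)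
    (hp : 1 < p) (hβ : 0 < β) (hu : IsObstacleSolution a a₀ H ψ u) {z : RN N → ℝ}
    {Z : RN N → RN N} (hz : MemW01 Ω p z Z) {R : ℝ} (hR : ∀ᵐ x ∂(volume.restrict Ω), |z x| ≤ R)
    {t : ℝ} (ht : 0 < t) (hψ : ∀ᵐ x ∂(volume.restrict Ω), ψ.toFun x ≤ u.toFun x - t * z x) :
    Integrable (fun x => inner ℝ (a x (u.toFun x) (u.grad x)) (Z x) +
      a₀ x (u.toFun x) * z x + H x (u.toFun x) (u.grad x) * z x) (volume.restrict Ω) ∧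
    ∫ x in Ω, (inner ℝ (a x (u.toFun x) (u.grad x)) (Z x) +
      a₀ x (u.toFun x) * z x + H x (u.toFun x) (u.grad x) * z x) ≤ 0 := by
  have huR := hu.2.1.ae_abs_le
  have i1 : Integrable (fun x => inner ℝ (a x (u.toFun x) (u.grad x)) (Z x)) (volume.restrict Ω) :=
    integrable_inner_of_memLp (holderConjugate_div hp).symm
      (hD.memLp_a hp hβ u.memLp.1 huR u.memLp_grad) hz.memLp_grad
  have i2 : Integrable (fun x => a₀ x (u.toFun x) * z x) (volume.restrict Ω) :=
    (hD.integrable_a₀ hp hβ u.memLp.1 huR).mul_bdd (c := R) hz.memLp.1 hR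
  have i3 : Integrable (fun x => H x (u.toFun x) (u.grad x) * z x) (volume.restrict Ω) :=
    (hD.integrable_H hp u.memLp.1 huR u.memLp_grad).mul_bdd (c := R) hz.memLp.1 hR
  have i12 : Integrable (fun x => inner ℝ (a x (u.toFun x) (u.grad x)) (Z x) +
      a₀ x (u.toFun x) * z x) (volume.restrict Ω) := i1.add i2
  refine ⟨i12.add i3, ?_⟩
  obtain ⟨v, hv1, hv2⟩ := u.memW01.linear_comb hp hz 1 (-t)
  have hvu : ∀ x, v.toFun x = u.toFun x - t * z x := fun x => by rw [hv1]; ring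
  have hvG : ∀ x, v.grad x - u.grad x = (-t) • Z x := fun x => by rw [hv2]; simp
  have key := hu.2.2 v (by
      filter_upwards [hψ] with x hx
      rwa [hvu]) (by
      refine W01.bounded_of_ae_abs_le (R := supNorm Ω u.toFun + t * R) ?_
      filter_upwards [huR, hR] with x h1 h2
      rw [hvu]
      refine (abs_sub _ _).trans ?_
      rw [abs_mul, abs_of_pos ht]
      gcongr)
  have e1 : ∀ x, v.toFun x - u.toFun x = -t * z x := fun x => by rw [hvu]; ring
  simp_rw [hvG, e1, inner_smul_right, mul_left_comm _ (-t)] at key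
  rw [integral_const_mul, integral_const_mul, integral_const_mul] at key
  rw [integral_add i12 i3, integral_add i1 i2]
  nlinarith

/-- The purpose of the first entry in the maximum: above the level C_∞ the coercive zero-order term
exceeds ‖f‖_∞. -/
theorem le_CInfty_rpow {F P : ℝ} (hp : 1 < p) (hα₀ : 0 < α₀) (hF : 0 ≤ F) :
    F ≤ α₀ * CInfty F α₀ p P ^ (p - 1) := by
  have hp1 : 0 < p - 1 := by linarith
  have h1 : (F / α₀) ^ (1 / (p - 1)) ≤ CInfty F α₀ p P := le_max_left _ _
  have h2 := Real.rpow_le_rpow (by positivity) h1 hp1.le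
  rw [← Real.rpow_mul (by positivity), one_div_mul_cancel hp1.ne', Real.rpow_one,
    div_le_iff₀ hα₀] at h2
  linarith

theorem CInfty_nonneg {F P : ℝ} (hP : 0 ≤ P) : 0 ≤ CInfty F α₀ p P := hP.trans (le_max_right _ _)

theorem expNegInvGlue_le {s : ℝ} (hs : 0 < s) : expNegInvGlue s ≤ s := by
  rw [expNegInvGlue, if_neg (not_le.2 hs), Real.exp_neg]
  refine inv_le_of_inv_le₀ hs ?_
  have := Real.add_one_le_exp s⁻¹
  linarith

/-- From below, u ≥ ψ ≥ −C. From above, test with θ(u), where θ vanishes up to C and αθ' ≥ b(R)θ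
with R = ‖u‖_∞. The gradient terms then have a favourable sign and ∫(a₀ − f)θ(u) ≤ 0 remains, whose
integrand is positive wherever u > C. R enters only the choice of θ, not the resulting bound. -/
theorem IsObstacleSolution.ae_abs_le (hD : NaturalGrowthData Ω p α β α₀ a a₀ H h f b)
    (hp : 1 < p) (hα : 0 < α) (hβ : 0 < β) (hα₀ : 0 < α₀) (hψ : ψ.Bounded)
    (hu : IsObstacleSolution a a₀ H ψ u) :
    ∀ᵐ x ∂(volume.restrict Ω),
      |u.toFun x| ≤ CInfty (supNorm Ω f) α₀ p (supNorm Ω ψ.toFun) := by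
  set C := CInfty (supNorm Ω f) α₀ p (supNorm Ω ψ.toFun) with hC
  have hC0 : 0 ≤ C := CInfty_nonneg (supNorm_nonneg _)
  have hψC : ∀ᵐ x ∂(volume.restrict Ω), |ψ.toFun x| ≤ C := by
    filter_upwards [hψ.ae_abs_le] with x hx
    exact hx.trans (le_max_right _ _)
  set R := supNorm Ω u.toFun
  have huR := hu.2.1.ae_abs_le
  have hR0 : 0 ≤ R := supNorm_nonneg _
  have hbR : 0 < b R := hD.b_pos R hR0
  set K := b R / α
  have hK : 0 ≤ K := by positivity
  -- A smooth substitute for e^{Ks}(s − C)⁺, so that the smooth chain rule suffices. The factor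
  -- e^{Ks} yields θ' ≥ Kθ, because `expNegInvGlue` is monotone.
  let θ : ℝ → ℝ := fun s => Real.exp (K * s) * expNegInvGlue (s - C)
  have hg : ContDiff ℝ ∞ expNegInvGlue := expNegInvGlue.contDiff
  have hθ : ContDiff ℝ ∞ θ := by
    have : ContDiff ℝ ∞ fun s : ℝ => expNegInvGlue (s - C) :=
      hg.comp (contDiff_id.sub contDiff_const)
    have h2 : ContDiff ℝ ∞ fun s : ℝ => Real.exp (K * s) := by fun_prop
    exact h2.mul this
  have hθzero : ∀ s, s ≤ C → θ s = 0 := fun s hs => by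
    simp only [θ]
    rw [expNegInvGlue.zero_of_nonpos (by linarith), mul_zero]
  have hθpos : ∀ s, C < s → 0 < θ s := fun s hs =>
    mul_pos (Real.exp_pos _) (expNegInvGlue.pos_of_pos (by linarith))
  have hθnn : ∀ s, 0 ≤ θ s := fun s =>
    mul_nonneg (Real.exp_pos _).le (expNegInvGlue.nonneg _)
  have hθ' : ∀ s, K * θ s ≤ deriv θ s := fun s => by
    have h1 : HasDerivAt (fun s : ℝ => Real.exp (K * s)) (Real.exp (K * s) * K) s := by
      simpa using ((hasDerivAt_id s).const_mul K).exp
    have h2 : HasDerivAt (fun s : ℝ => expNegInvGlue (s - C)) (deriv expNegInvGlue (s - C)) s := by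
      simpa using (hg.differentiable (by simp) (s - C)).hasDerivAt.comp_sub_const s C
    have h3 : HasDerivAt θ (Real.exp (K * s) * K * expNegInvGlue (s - C) +
      Real.exp (K * s) * deriv expNegInvGlue (s - C)) s := h1.mul h2
    rw [h3.deriv]
    have h4 : 0 ≤ deriv expNegInvGlue (s - C) := expNegInvGlue.monotone.deriv_nonneg
    have h5 : 0 ≤ Real.exp (K * s) * deriv expNegInvGlue (s - C) := by positivity
    simp only [θ]
    nlinarith
  -- The scale t = e^{−KR} makes tθ(u) ≤ u − C, so u − tθ(u) ≥ C ≥ ψ where u > C.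
  have hθle : ∀ s, |s| ≤ R → C < s → Real.exp (-(K * R)) * θ s ≤ s - C := fun s hs hsC => by
    have h1 : Real.exp (-(K * R)) * Real.exp (K * s) ≤ 1 := by
      rw [← Real.exp_add, Real.exp_le_one_iff]
      have := (le_abs_self s).trans hs
      nlinarith
    have h2 := expNegInvGlue_le (sub_pos.2 hsC)
    have h3 := expNegInvGlue.nonneg (s - C)
    simp only [θ]
    rw [← mul_assoc]
    nlinarith
  have hz := u.memW01.comp_of_bounded hp huR hθ (hθzero 0 hC0)
  obtain ⟨hi, hle⟩ := hu.integral_le_zero hD hp hβ hz (R := Real.exp (K * R) * R) (by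
      filter_upwards [huR] with x hx
      rw [abs_of_nonneg (hθnn _)]
      rcases le_or_gt (u.toFun x) C with h1 | h1
      · rw [hθzero _ h1]
        positivity
      · have h2 := hθle _ hx h1
        rw [Real.exp_neg, inv_mul_le_iff₀ (Real.exp_pos _)] at h2
        refine h2.trans ?_
        have := (le_abs_self _).trans hx
        gcongr
        linarith) (Real.exp_pos (-(K * R))) (by
      filter_upwards [huR, hu.1, hψC] with x h1 h2 h3
      rcases le_or_gt (u.toFun x) C with h4 | h4
      · rw [hθzero _ h4]
        linarith
      · have := hθle _ h1 h4
        have := (le_abs_self _).trans h3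
        linarith)
  have hlow : ∀ᵐ x ∂(volume.restrict Ω), (a₀ x (u.toFun x) - f x) * θ (u.toFun x) ≤
      inner ℝ (a x (u.toFun x) (u.grad x)) (deriv θ (u.toFun x) • u.grad x) +
        a₀ x (u.toFun x) * θ (u.toFun x) + H x (u.toFun x) (u.grad x) * θ (u.toFun x) := by
    filter_upwards [hD.a_coercive, hD.abs_H_le huR u.grad] with x h1 h2
    have h3 := h1 (u.toFun x) (u.grad x)
    rw [inner_smul_right]
    have h4 := hθ' (u.toFun x)
    have h5 := hθnn (u.toFun x)
    have h6 : 0 ≤ deriv θ (u.toFun x) := le_trans (by positivity) h4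
    have h7 : 0 ≤ ‖u.grad x‖ ^ p := by positivity
    have h8 := neg_le_of_abs_le h2
    have h9 := mul_le_mul_of_nonneg_left h3 h6
    have h10 := mul_le_mul_of_nonneg_right h8 h5
    have h11 : b R * θ (u.toFun x) ≤ α * deriv θ (u.toFun x) := by
      have := mul_le_mul_of_nonneg_left h4 hα.le
      have e : α * (K * θ (u.toFun x)) = b R * θ (u.toFun x) := by
        simp only [K]
        field_simp
      linarith
    have h12 := mul_le_mul_of_nonneg_right h11 h7
    linarith
  have hpos : ∀ᵐ x ∂(volume.restrict Ω), C < u.toFun x → f x < a₀ x (u.toFun x) := by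
    filter_upwards [hD.a₀_coercive, hD.f_le] with x h1 h2 h3
    have h4 : 0 < u.toFun x := hC0.trans_lt h3
    have h5 := h1 (u.toFun x)
    rw [abs_of_pos h4] at h5
    have h6 : u.toFun x ^ p = u.toFun x ^ (p - 1) * u.toFun x := by
      rw [← Real.rpow_add_one h4.ne', sub_add_cancel]
    rw [h6, ← mul_assoc] at h5
    have h7 := le_of_mul_le_mul_right h5 h4
    have h8 := le_CInfty_rpow (P := supNorm Ω ψ.toFun) hp hα₀ (supNorm_nonneg (Ω := Ω) f)
    have h9 : C ^ (p - 1) < u.toFun x ^ (p - 1) := Real.rpow_lt_rpow hC0 h3 (by linarith)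
    have h10 := mul_lt_mul_of_pos_left h9 hα₀
    linarith
  have hnn : 0 ≤ᵐ[volume.restrict Ω] fun x =>
      inner ℝ (a x (u.toFun x) (u.grad x)) (deriv θ (u.toFun x) • u.grad x) +
        a₀ x (u.toFun x) * θ (u.toFun x) + H x (u.toFun x) (u.grad x) * θ (u.toFun x) := by
    filter_upwards [hlow, hpos] with x h1 h2
    refine le_trans ?_ h1
    rcases le_or_gt (u.toFun x) C with h3 | h3
    · rw [hθzero _ h3, mul_zero]
      exact le_rfl
    · exact mul_nonneg (sub_nonneg.2 (h2 h3).le) (hθnn _)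
  have hzero := (integral_eq_zero_iff_of_nonneg_ae hnn hi).1
    (le_antisymm hle (integral_nonneg_of_ae hnn))
  filter_upwards [hzero, hlow, hpos, hu.1, hψC] with x h1 h2 h3 h4 h5
  refine abs_le.2 ⟨(neg_le_of_abs_le h5).trans h4, ?_⟩
  by_contra h6
  have h7 := mul_pos (sub_pos.2 (h3 (not_le.1 h6))) (hθpos _ (not_le.1 h6))
  rw [h1] at h2
  exact absurd h2 (not_le.2 h7)

/-- With t₀ = e^{−λt²} and s = u − Ψ, one has t₀ φ(s) = c s for some 0 < c ≤ 1. Thus u − t₀ φ(u − Ψ)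
lies between Ψ and u and is admissible. -/
theorem IsObstacleSolution.integral_expTest_le_zero
    (hD : NaturalGrowthData Ω p α β α₀ a a₀ H h f b) (hp : 1 < p) (hβ : 0 < β)
    (hu : IsObstacleSolution a a₀ H ψ u) (hΨ : Ψ ∈ obstacleSet ψ) {lam t : ℝ} (hlam : 0 ≤ lam)
    (ht : ∀ᵐ x ∂(volume.restrict Ω), |u.toFun x - Ψ.toFun x| ≤ t) :
    Integrable (fun x => inner ℝ (a x (u.toFun x) (u.grad x)) (u.grad x - Ψ.grad x) *
        deriv (expTest lam) (u.toFun x - Ψ.toFun x) +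
      a₀ x (u.toFun x) * expTest lam (u.toFun x - Ψ.toFun x) +
      H x (u.toFun x) (u.grad x) * expTest lam (u.toFun x - Ψ.toFun x)) (volume.restrict Ω) ∧
    ∫ x in Ω, (inner ℝ (a x (u.toFun x) (u.grad x)) (u.grad x - Ψ.grad x) *
        deriv (expTest lam) (u.toFun x - Ψ.toFun x) +
      a₀ x (u.toFun x) * expTest lam (u.toFun x - Ψ.toFun x) +
      H x (u.toFun x) (u.grad x) * expTest lam (u.toFun x - Ψ.toFun x)) ≤ 0 := by
  have hd : MemW01 Ω p (fun x => u.toFun x - Ψ.toFun x) (fun x => u.grad x - Ψ.grad x) := by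
    have := u.memW01.linear_comb hp Ψ.memW01 1 (-1)
    simpa [sub_eq_add_neg] using this
  have hz := hd.comp_of_bounded hp ht (contDiff_expTest lam) (expTest_zero lam)
  have key := hu.integral_le_zero hD hp hβ hz (R := t * Real.exp (lam * t ^ 2))
    (ht.mono fun x hx => abs_expTest_le hlam hx) (Real.exp_pos (-(lam * t ^ 2))) (by
      filter_upwards [ht, hu.1, hΨ] with x h1 h2 h3
      set s := u.toFun x - Ψ.toFun x with hs
      have h4 : Real.exp (-(lam * t ^ 2)) * expTest lam s =
          Real.exp (lam * s ^ 2 - lam * t ^ 2) * s := by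
        rw [expTest, sub_eq_neg_add, Real.exp_add]
        ring
      have h5 : Real.exp (lam * s ^ 2 - lam * t ^ 2) ≤ 1 := by
        rw [Real.exp_le_one_iff, ← mul_sub]
        have : s ^ 2 ≤ t ^ 2 := sq_le_sq.2 (h1.trans (le_abs_self t))
        exact mul_nonpos_of_nonneg_of_nonpos hlam (by linarith)
      have h6 := Real.exp_pos (lam * s ^ 2 - lam * t ^ 2)
      rw [h4]
      have h7 : u.toFun x = s + Ψ.toFun x := by simp [hs]
      nlinarith)
  simp only [inner_smul_right, mul_comm (deriv _ _)] at key
  exact key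

end Solution

/-! ### The gradient estimates -/

/-- Young's inequality, without sharp constants, from a dichotomy: either Bz ≤ εx and the first term
suffices, or x ≤ Bz/ε and the second does. -/
theorem mul_rpow_sub_one_mul_le {p ε B x z : ℝ} (hp : 1 < p) (hε : 0 < ε) (hB : 0 ≤ B)
    (hx : 0 ≤ x) (hz : 0 ≤ z) :
    B * (x ^ (p - 1) * z) ≤ ε * x ^ p + B ^ p / ε ^ (p - 1) * z ^ p := by
  have hp1 : 0 < p - 1 := by linarith
  have hpow : ∀ y : ℝ, 0 ≤ y → y ^ p = y ^ (p - 1) * y := fun y hy => by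
    conv_lhs => rw [← sub_add_cancel p 1]
    rw [Real.rpow_add_one' hy (by linarith)]
  rcases le_total (B * z) (ε * x) with h | h
  · have h1 : 0 ≤ B ^ p / ε ^ (p - 1) * z ^ p := by positivity
    have h2 : 0 ≤ x ^ (p - 1) := by positivity
    have h3 := mul_le_mul_of_nonneg_left h h2
    rw [hpow x hx]
    linarith
  · have h1 : 0 ≤ ε * x ^ p := by positivity
    have h2 : x ≤ B * z / ε := by rwa [le_div_iff₀ hε, mul_comm]
    have h3 : x ^ (p - 1) ≤ (B * z / ε) ^ (p - 1) := Real.rpow_le_rpow hx h2 hp1.le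
    have h4 : (B * z / ε) ^ (p - 1) = B ^ (p - 1) * z ^ (p - 1) / ε ^ (p - 1) := by
      rw [Real.div_rpow (by positivity) hε.le, Real.mul_rpow hB hz]
    have h5 : B ^ p / ε ^ (p - 1) * z ^ p = B ^ (p - 1) * z ^ (p - 1) / ε ^ (p - 1) * (B * z) := by
      rw [hpow B hB, hpow z hz]
      ring
    rw [h5]
    have h6 := mul_le_mul_of_nonneg_right (h3.trans_eq h4) (mul_nonneg hB hz)
    linarith

section Lp

variable {α E F : Type*} {m : MeasurableSpace α} {μ : Measure α} [NormedAddCommGroup E]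
  [NormedAddCommGroup F] {p q : ℝ}

theorem integral_mul_norm_le_lpNorm (hpq : p.HolderConjugate q) {f : α → E} {g : α → F}
    (hf : MemLp f (ENNReal.ofReal p) μ) (hg : MemLp g (ENNReal.ofReal q) μ) :
    ∫ x, ‖f x‖ * ‖g x‖ ∂μ ≤ lpNorm f (ENNReal.ofReal p) μ * lpNorm g (ENNReal.ofReal q) μ := by
  rw [lpNorm_ofReal_eq hpq.pos hf.1, lpNorm_ofReal_eq hpq.symm.pos hg.1, ← one_div, ← one_div]
  exact integral_mul_norm_le hpq hf hg

theorem integral_norm_le_lpNorm [IsFiniteMeasure μ] (hpq : p.HolderConjugate q) {f : α → E}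
    (hf : MemLp f (ENNReal.ofReal p) μ) :
    ∫ x, ‖f x‖ ∂μ ≤ lpNorm f (ENNReal.ofReal p) μ * (μ Set.univ).toReal ^ (1 / q) := by
  have h := integral_mul_norm_le hpq hf (memLp_const (1 : ℝ) (p := ENNReal.ofReal q) (μ := μ))
  rw [lpNorm_ofReal_eq hpq.pos hf.1, ← one_div]
  simpa [Measure.real] using h

end Lp

/-- The constant of the gradient estimates. -/
def estimateConst (p α m β L : ℝ) : ℝ :=
  max 1 (4 / α * (β ^ p / (α / 4) ^ (p - 1) * 2 ^ p + β * 2 ^ p * (1 + m ^ (1 / (p / (p - 1)))) +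
    L * (β * m ^ (1 / p) + β * m + m)))

/-- The maximum with 1 in the constant gives positivity with no sign condition on the parameters. -/
theorem estimateConst_pos (p α m β L : ℝ) : 0 < estimateConst p α m β L :=
  one_pos.trans_le (le_max_left _ _)

/-- Bookkeeping for both estimates at once: e stands for the bound on the test function, and (L, κ)
records how it compares with X = (1 + λT²)e^{4λT²}. Since X ≥ 1, one has X ≤ X^p, and the bound E on
the derivative satisfies E ≤ 2X; every term is thus at most a constant times X^p times the bracket.
-/
theorem le_estimateConst_mul {p α m β L lam T e Q D Hh Cp F κ : ℝ} (hp : 1 < p) (hα : 0 < α)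
    (hβ : 0 < β) (hm : 0 ≤ m) (hL : 0 ≤ L) (hlam : 0 ≤ lam) (hD : 0 ≤ D) (hHh : 0 ≤ Hh)
    (hCp : 0 ≤ Cp) (hF : 0 ≤ F) (hκ : 0 ≤ κ)
    (he : e ≤ L * κ * ((1 + lam * T ^ 2) * Real.exp (4 * lam * T ^ 2)))
    (hQ : α / 4 * Q ≤ β ^ p / (α / 4) ^ (p - 1) *
        (((1 + 2 * lam * T ^ 2) * Real.exp (lam * T ^ 2)) ^ p * D ^ p) +
      β * ((1 + 2 * lam * T ^ 2) * Real.exp (lam * T ^ 2)) *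
        (Hh * D + Cp * (D * m ^ (1 / (p / (p - 1))))) +
      e * (β * (Hh * m ^ (1 / p) + Cp * m) + F * m)) :
    Q ≤ estimateConst p α m β L * expFactor p lam T *
      (κ * (F + Hh + Cp) + D ^ p + D * (Hh + Cp)) := by
  have hp0 : 0 < p := by linarith
  set X := (1 + lam * T ^ 2) * Real.exp (4 * lam * T ^ 2) with hX
  set E := (1 + 2 * lam * T ^ 2) * Real.exp (lam * T ^ 2) with hE
  have hlT : 0 ≤ lam * T ^ 2 := by positivity
  have hX1 : 1 ≤ X := by
    have := Real.one_le_exp (show 0 ≤ 4 * lam * T ^ 2 by positivity)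
    nlinarith
  have hXp : X ≤ X ^ p := by
    simpa using Real.rpow_le_rpow_of_exponent_le hX1 hp.le
  have hE0 : 0 ≤ E := by positivity
  have hE2 : E ≤ 2 * X := by
    have : Real.exp (lam * T ^ 2) ≤ Real.exp (4 * lam * T ^ 2) :=
      Real.exp_le_exp.2 (by linarith)
    have h1 : 1 + 2 * lam * T ^ 2 ≤ 2 * (1 + lam * T ^ 2) := by linarith
    calc E ≤ 2 * (1 + lam * T ^ 2) * Real.exp (4 * lam * T ^ 2) := by
          simp only [hE]
          gcongr
      _ = 2 * X := by simp only [hX]; ring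
  have hEp : E ^ p ≤ 2 ^ p * X ^ p := by
    rw [← Real.mul_rpow (by norm_num) (by linarith)]
    exact Real.rpow_le_rpow hE0 hE2 hp0.le
  have h2p : (2 : ℝ) ≤ 2 ^ p := by
    simpa using Real.rpow_le_rpow_of_exponent_le (show (1 : ℝ) ≤ 2 by norm_num) hp.le
  have hE' : E ≤ 2 ^ p * X ^ p := hE2.trans (by gcongr)
  set m₁ := m ^ (1 / (p / (p - 1)))
  set m₂ := m ^ (1 / p)
  have hm₁ : 0 ≤ m₁ := by positivity
  have hm₂ : 0 ≤ m₂ := by positivity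
  set c := β ^ p / (α / 4) ^ (p - 1)
  have hc : 0 ≤ c := by positivity
  set S := κ * (F + Hh + Cp) + D ^ p + D * (Hh + Cp) with hS
  have hDp : 0 ≤ D ^ p := by positivity
  have hS1 : D ^ p ≤ S := by
    have : 0 ≤ κ * (F + Hh + Cp) + D * (Hh + Cp) := by positivity
    linarith
  have hS2 : D * (Hh + Cp) ≤ S := by
    have : 0 ≤ κ * (F + Hh + Cp) + D ^ p := by positivity
    linarith
  have hS3 : κ * (F + Hh + Cp) ≤ S := by
    have : 0 ≤ D ^ p + D * (Hh + Cp) := by positivity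
    linarith
  have hXp0 : 0 ≤ X ^ p := by positivity
  have t1 : c * (E ^ p * D ^ p) ≤ c * 2 ^ p * (X ^ p * S) := by
    calc c * (E ^ p * D ^ p) ≤ c * ((2 ^ p * X ^ p) * S) := by gcongr
      _ = c * 2 ^ p * (X ^ p * S) := by ring
  have t2 : β * E * (Hh * D + Cp * (D * m₁)) ≤ β * 2 ^ p * (1 + m₁) * (X ^ p * S) := by
    have h1 : Hh * D + Cp * (D * m₁) ≤ (1 + m₁) * (D * (Hh + Cp)) := by
      have : 0 ≤ Cp * D + m₁ * (D * Hh) := by positivity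
      nlinarith
    calc β * E * (Hh * D + Cp * (D * m₁)) ≤ β * (2 ^ p * X ^ p) * ((1 + m₁) * S) := by
          gcongr
          exact h1.trans (by gcongr)
      _ = β * 2 ^ p * (1 + m₁) * (X ^ p * S) := by ring
  have t3 : e * (β * (Hh * m₂ + Cp * m) + F * m) ≤
      L * (β * m₂ + β * m + m) * (X ^ p * S) := by
    have h1 : β * (Hh * m₂ + Cp * m) + F * m ≤ (β * m₂ + β * m + m) * (F + Hh + Cp) := by
      have : 0 ≤ β * m₂ * (F + Cp) + β * m * (F + Hh) + m * (Hh + Cp) := by positivity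
      nlinarith
    have h2 : e ≤ L * κ * X ^ p := he.trans (by gcongr)
    calc e * (β * (Hh * m₂ + Cp * m) + F * m)
        ≤ (L * κ * X ^ p) * ((β * m₂ + β * m + m) * (F + Hh + Cp)) := by gcongr
      _ = L * (β * m₂ + β * m + m) * (X ^ p * (κ * (F + Hh + Cp))) := by ring
      _ ≤ L * (β * m₂ + β * m + m) * (X ^ p * S) := by gcongr
  have hsum := hQ.trans (add_le_add (add_le_add t1 t2) t3)
  have hS0 : 0 ≤ S := hDp.trans hS1
  calc Q = 4 / α * (α / 4 * Q) := by field_simp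
    _ ≤ 4 / α * (c * 2 ^ p * (X ^ p * S) + β * 2 ^ p * (1 + m₁) * (X ^ p * S) +
          L * (β * m₂ + β * m + m) * (X ^ p * S)) := by gcongr
    _ = (4 / α * (c * 2 ^ p + β * 2 ^ p * (1 + m₁) + L * (β * m₂ + β * m + m))) * (X ^ p * S) := by
        ring
    _ ≤ estimateConst p α m β L * (X ^ p * S) := by
        gcongr
        exact le_max_right _ _
    _ = _ := by rw [expFactor]; ring

section Solution

variable {N : ℕ} {Ω : Set (RN N)} {p α β α₀ : ℝ}
  {a : RN N → ℝ → RN N → RN N} {a₀ : RN N → ℝ → ℝ} {H : RN N → ℝ → RN N → ℝ}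
  {h f : RN N → ℝ} {b : ℝ → ℝ} {ψ u Ψ : W01 Ω p} [IsFiniteMeasure (volume.restrict Ω)]

/-- Testing with φ(u − Ψ) leaves α/2 |Du|^p after H has been absorbed. Young's inequality spends α/4
of it on the cross term |Du|^{p−1}|DΨ|; the remaining terms involve only data. -/
theorem IsObstacleSolution.integral_norm_grad_le
    (hD : NaturalGrowthData Ω p α β α₀ a a₀ H h f b) (hp : 1 < p) (hα : 0 < α) (hβ : 0 < β)
    (hu : IsObstacleSolution a a₀ H ψ u) (hΨ : Ψ ∈ obstacleSet ψ) {C R : ℝ} (hC0 : 0 ≤ C)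
    (hC : ∀ᵐ x ∂(volume.restrict Ω), |u.toFun x| ≤ C)
    (hR : ∀ᵐ x ∂(volume.restrict Ω), |Ψ.toFun x| ≤ R) (hR0 : 0 ≤ R) :
    α / 4 * ∫ x in Ω, ‖u.grad x‖ ^ p ≤ β ^ p / (α / 4) ^ (p - 1) *
        (((1 + 2 * lambdaConst b α C * (C + R) ^ 2) *
          Real.exp (lambdaConst b α C * (C + R) ^ 2)) ^ p *
          lpNorm Ψ.grad (ENNReal.ofReal p) (volume.restrict Ω) ^ p) +
      β * ((1 + 2 * lambdaConst b α C * (C + R) ^ 2) *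
          Real.exp (lambdaConst b α C * (C + R) ^ 2)) *
        (lpNorm h (ENNReal.ofReal (p / (p - 1))) (volume.restrict Ω) *
            lpNorm Ψ.grad (ENNReal.ofReal p) (volume.restrict Ω) +
          C ^ (p - 1) * (lpNorm Ψ.grad (ENNReal.ofReal p) (volume.restrict Ω) *
            (volume Ω).toReal ^ (1 / (p / (p - 1))))) +
      (C + R) * Real.exp (lambdaConst b α C * (C + R) ^ 2) *
        (β * (lpNorm h (ENNReal.ofReal (p / (p - 1))) (volume.restrict Ω) *
            (volume Ω).toReal ^ (1 / p) + C ^ (p - 1) * (volume Ω).toReal) +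
          supNorm Ω f * (volume Ω).toReal) := by
  have hp0 : 0 < p := by linarith
  have hpq := holderConjugate_div hp
  set lam := lambdaConst b α C with hlam
  have hlam0 : 0 ≤ lam := by rw [hlam, lambdaConst]; positivity
  set T := C + R
  have hT0 : 0 ≤ T := by positivity
  have hT : ∀ᵐ x ∂(volume.restrict Ω), |u.toFun x - Ψ.toFun x| ≤ T := by
    filter_upwards [hC, hR] with x h1 h2
    exact (abs_sub _ _).trans (add_le_add h1 h2)
  set e := T * Real.exp (lam * T ^ 2) with he
  have he0 : 0 ≤ e := by positivity
  set E := (1 + 2 * lam * T ^ 2) * Real.exp (lam * T ^ 2) with hE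
  have hE0 : 0 ≤ E := by positivity
  obtain ⟨hi, hle⟩ := hu.integral_expTest_le_zero hD hp hβ hΨ hlam0 hT
  set F := supNorm Ω f
  set c := β ^ p / (α / 4) ^ (p - 1)
  have hpt : ∀ᵐ x ∂(volume.restrict Ω), α / 4 * ‖u.grad x‖ ^ p ≤
      (inner ℝ (a x (u.toFun x) (u.grad x)) (u.grad x - Ψ.grad x) *
        deriv (expTest lam) (u.toFun x - Ψ.toFun x) +
      a₀ x (u.toFun x) * expTest lam (u.toFun x - Ψ.toFun x) +
      H x (u.toFun x) (u.grad x) * expTest lam (u.toFun x - Ψ.toFun x)) +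
      (c * (E ^ p * ‖Ψ.grad x‖ ^ p) +
        β * E * (‖h x‖ * ‖Ψ.grad x‖ + C ^ (p - 1) * ‖Ψ.grad x‖) +
        e * (β * (‖h x‖ + C ^ (p - 1)) + F)) := by
    filter_upwards [hD.a_coercive, hD.norm_a_le hp hβ hC u.grad, hD.abs_a₀_le hp hβ hC,
      hD.abs_H_le hC u.grad, hD.f_le, hT, hD.f_nonneg] with x h1 h2 h3 h4 h5 h6 h7
    have k1 := h1 (u.toFun x) (u.grad x)
    set s := u.toFun x - Ψ.toFun x
    have k2 := half_le_deriv_expTest_sub (B := b C) hα s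
    rw [show b C ^ 2 / (4 * α ^ 2) = lam from rfl] at k2
    have k3 := deriv_expTest_le hlam0 h6
    have k4 := abs_expTest_le hlam0 h6
    have k5 := deriv_expTest_nonneg hlam0 s
    set d := deriv (expTest lam) s
    set P := expTest lam s
    set A := a x (u.toFun x) (u.grad x)
    have k6 : inner ℝ A (u.grad x - Ψ.grad x) * d ≥
        (α * ‖u.grad x‖ ^ p) * d - (‖A‖ * ‖Ψ.grad x‖) * d := by
      rw [inner_sub_right, ← sub_mul]
      have := real_inner_le_norm A (Ψ.grad x)
      gcongr
    have k7 : (‖A‖ * ‖Ψ.grad x‖) * d ≤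
        (β * (|h x| + C ^ (p - 1) + ‖u.grad x‖ ^ (p - 1)) * ‖Ψ.grad x‖) * E := by gcongr
    have k8 : -(β * (|h x| + C ^ (p - 1)) * e) ≤ a₀ x (u.toFun x) * P := by
      refine neg_le_of_abs_le ?_
      rw [abs_mul]
      gcongr
    have k9 : -((F + b C * ‖u.grad x‖ ^ p) * |P|) ≤ H x (u.toFun x) (u.grad x) * P := by
      refine neg_le_of_abs_le ?_
      rw [abs_mul]
      refine mul_le_mul_of_nonneg_right (h4.trans ?_) (abs_nonneg _)
      linarith
    have k10 : F * |P| ≤ F * e := mul_le_mul_of_nonneg_left k4 (supNorm_nonneg _)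
    have k11 := mul_le_mul_of_nonneg_right k2 (show 0 ≤ ‖u.grad x‖ ^ p by positivity)
    -- E bounds φ' on the range of u − Ψ; it is put inside z, whence the power E^p in the
    -- conclusion.
    have k12 := mul_rpow_sub_one_mul_le (z := E * ‖Ψ.grad x‖) hp (show 0 < α / 4 by positivity)
      hβ.le (norm_nonneg (u.grad x)) (by positivity)
    rw [Real.mul_rpow hE0 (norm_nonneg _)] at k12
    rw [Real.norm_eq_abs]
    linarith
  have hq := hD.h_memLp
  have hh1 := integral_mul_norm_le_lpNorm hpq.symm hq Ψ.memLp_grad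
  have hh2 := integral_norm_le_lpNorm hpq.symm hq
  have hh3 := integral_norm_le_lpNorm hpq Ψ.memLp_grad
  rw [Measure.restrict_apply_univ] at hh2 hh3
  have i1 : Integrable (fun x => ‖h x‖ * ‖Ψ.grad x‖) (volume.restrict Ω) :=
    integrable_mul_norm hpq.symm hq Ψ.memLp_grad
  have i2 : Integrable (fun x => ‖Ψ.grad x‖) (volume.restrict Ω) :=
    (memLp_one_iff_integrable.1 (Ψ.memLp_grad.mono_exponent (by simpa using hp.le))).norm
  have i3 : Integrable (fun x => ‖h x‖) (volume.restrict Ω) :=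
    (memLp_one_iff_integrable.1 (hq.mono_exponent (by simpa using hpq.symm.lt.le))).norm
  have i4 : Integrable (fun x => ‖Ψ.grad x‖ ^ p) (volume.restrict Ω) :=
    Ψ.memLp_grad.integrable_rpow_norm hp0
  have j1 : Integrable (fun x => c * (E ^ p * ‖Ψ.grad x‖ ^ p)) (volume.restrict Ω) :=
    (i4.const_mul _).const_mul _
  have j2' : Integrable (fun x => ‖h x‖ * ‖Ψ.grad x‖ + C ^ (p - 1) * ‖Ψ.grad x‖)
      (volume.restrict Ω) := i1.add (i2.const_mul _)
  have j2 : Integrable (fun x => β * E * (‖h x‖ * ‖Ψ.grad x‖ + C ^ (p - 1) * ‖Ψ.grad x‖))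
      (volume.restrict Ω) := j2'.const_mul _
  have j3'' : Integrable (fun x => ‖h x‖ + C ^ (p - 1)) (volume.restrict Ω) :=
    i3.add (integrable_const _)
  have j3' : Integrable (fun x => β * (‖h x‖ + C ^ (p - 1)) + F) (volume.restrict Ω) :=
    (j3''.const_mul β).add (integrable_const _)
  have j3 : Integrable (fun x => e * (β * (‖h x‖ + C ^ (p - 1)) + F)) (volume.restrict Ω) :=
    j3'.const_mul e
  have j12 : Integrable (fun x => c * (E ^ p * ‖Ψ.grad x‖ ^ p) +
      β * E * (‖h x‖ * ‖Ψ.grad x‖ + C ^ (p - 1) * ‖Ψ.grad x‖)) (volume.restrict Ω) := j1.add j2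
  have j123 : Integrable (fun x => c * (E ^ p * ‖Ψ.grad x‖ ^ p) +
      β * E * (‖h x‖ * ‖Ψ.grad x‖ + C ^ (p - 1) * ‖Ψ.grad x‖) +
      e * (β * (‖h x‖ + C ^ (p - 1)) + F)) (volume.restrict Ω) := j12.add j3
  have hint := integral_mono_ae ((u.memLp_grad.integrable_rpow_norm hp0).const_mul (α / 4))
    (hi.add j123) hpt
  rw [integral_const_mul] at hint
  simp only [Pi.add_apply] at hint
  rw [integral_add hi j123, integral_add j12 j3, integral_add j1 j2, integral_const_mul,
    integral_const_mul, integral_const_mul (β * E), integral_const_mul e,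
    integral_add i1 (i2.const_mul _), integral_const_mul,
    integral_add (j3''.const_mul β) (integrable_const _), integral_const_mul,
    integral_add i3 (integrable_const _), integral_const, integral_const] at hint
  simp only [Measure.real, Measure.restrict_apply_univ, smul_eq_mul] at hint
  rw [lpNorm_ofReal_rpow hp0 Ψ.memLp_grad.1]
  have hCp : 0 ≤ C ^ (p - 1) := by positivity
  refine hint.trans ?_
  have l1 : C ^ (p - 1) * (∫ x in Ω, ‖Ψ.grad x‖) ≤
      C ^ (p - 1) * (lpNorm Ψ.grad (ENNReal.ofReal p) (volume.restrict Ω) *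
            (volume Ω).toReal ^ (1 / (p / (p - 1)))) := mul_le_mul_of_nonneg_left hh3 hCp
  have l2 := mul_le_mul_of_nonneg_left (add_le_add hh1 l1) (mul_nonneg hβ.le hE0)
  have l3 := mul_le_mul_of_nonneg_left hh2 (mul_nonneg he0 hβ.le)
  linarith

theorem IsObstacleSolution.satisfiesEstimates
    (hD : NaturalGrowthData Ω p α β α₀ a a₀ H h f b) (hp : 1 < p) (hα : 0 < α) (hβ : 0 < β)
    (hα₀ : 0 < α₀) (hψ : ψ.Bounded) (hu : IsObstacleSolution a a₀ H ψ u) :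
    SatisfiesEstimates (estimateConst p α (volume Ω).toReal β 1)
      (estimateConst p α (volume Ω).toReal β (1 + 4 * α ^ 2 / b 0 ^ 2)) α α₀ h f b ψ u := by
  have hC := hu.ae_abs_le hD hp hα hβ hα₀ hψ
  unfold SatisfiesEstimates
  intro F C
  have hC0 : 0 ≤ C := CInfty_nonneg (supNorm_nonneg _)
  have hF0 : 0 ≤ F := supNorm_nonneg _
  refine ⟨?_, fun Ψ hΨ hΨb => ?_⟩
  · rw [eLpNorm_exponent_top]
    refine eLpNormEssSup_le_of_ae_bound hC
  · have hR0 : 0 ≤ supNorm Ω Ψ.toFun := supNorm_nonneg _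
    have hest := hu.integral_norm_grad_le hD hp hα hβ hΨ hC0 hC hΨb.ae_abs_le hR0
    set T := C + supNorm Ω Ψ.toFun
    have hT0 : 0 ≤ T := by positivity
    set lam := lambdaConst b α C with hlam
    have hlam0 : 0 ≤ lam := by rw [hlam, lambdaConst]; positivity
    have hlT : 0 ≤ lam * T ^ 2 := by positivity
    have hexp : Real.exp (lam * T ^ 2) ≤ Real.exp (4 * lam * T ^ 2) :=
      Real.exp_le_exp.2 (by linarith)
    refine ⟨le_estimateConst_mul hp hα hβ ENNReal.toReal_nonneg zero_le_one hlam0 lpNorm_nonneg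
      lpNorm_nonneg (by positivity) hF0 hT0 ?_ hest,
      le_estimateConst_mul hp hα hβ ENNReal.toReal_nonneg (by positivity) hlam0 lpNorm_nonneg
      lpNorm_nonneg (by positivity) hF0 zero_le_one ?_ hest⟩
    · have : Real.exp (lam * T ^ 2) ≤ (1 + lam * T ^ 2) * Real.exp (4 * lam * T ^ 2) := by
        have := Real.exp_pos (4 * lam * T ^ 2)
        nlinarith
      rw [one_mul]
      gcongr
    · have hb0 : 0 < b 0 := hD.b_pos 0 le_rfl
      have hb : b 0 ≤ b C := hD.b_mono Set.self_mem_Ici hC0 hC0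
      -- Monotonicity of b gives λ ≥ b(0)²/(4α²), so T ≤ 1 + T² is controlled by 1 + λT² with a
      -- constant depending on α and b(0). This replaces the factor C̃ by 1 in the second estimate.
      have h1 : 1 ≤ 4 * α ^ 2 / b 0 ^ 2 * lam := by
        have e1 : 4 * α ^ 2 / b 0 ^ 2 * lam = b C ^ 2 / b 0 ^ 2 := by
          rw [hlam, lambdaConst]
          field_simp
        rw [e1, one_le_div (by positivity)]
        gcongr
      set k := 4 * α ^ 2 / b 0 ^ 2
      have hk : 0 ≤ k := by positivity
      have h2 : T ≤ (1 + k) * 1 * (1 + lam * T ^ 2) := by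
        have h3 : T ^ 2 ≤ k * lam * T ^ 2 := le_mul_of_one_le_left (sq_nonneg T) h1
        nlinarith [sq_nonneg (T - 1)]
      calc T * Real.exp (lam * T ^ 2)
          ≤ ((1 + k) * 1 * (1 + lam * T ^ 2)) * Real.exp (4 * lam * T ^ 2) := by gcongr
        _ = _ := by ring

end Solution

/-! ### Vanishing of the Leray–Lions defect -/

theorem add_rpow_le {p x y : ℝ} (hp : 0 ≤ p) (hx : 0 ≤ x) (hy : 0 ≤ y) :
    (x + y) ^ p ≤ 2 ^ p * (x ^ p + y ^ p) := by
  have hxp : 0 ≤ x ^ p := by positivity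
  have hyp : 0 ≤ y ^ p := by positivity
  have h2 : (0 : ℝ) ≤ 2 ^ p := by positivity
  have key : ∀ {s t : ℝ}, 0 ≤ s → s ≤ t → (s + t) ^ p ≤ 2 ^ p * t ^ p := fun {s t} hs hst => by
    rw [← Real.mul_rpow (by norm_num) (hs.trans hst)]
    exact Real.rpow_le_rpow (by linarith) (by linarith) hp
  rcases le_total x y with h | h
  · refine (key hx h).trans ?_
    gcongr
    linarith
  · rw [add_comm x y]
    refine (key hy h).trans ?_
    gcongr
    linarith

theorem add_add_rpow_le {p x y z : ℝ} (hp : 0 ≤ p) (hx : 0 ≤ x) (hy : 0 ≤ y) (hz : 0 ≤ z) :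
    (x + y + z) ^ p ≤ 4 ^ p * (x ^ p + y ^ p + z ^ p) := by
  have h1 := add_rpow_le hp (add_nonneg hx hy) hz
  have h2 := add_rpow_le hp hx hy
  have h3 : (1 : ℝ) ≤ 2 ^ p := Real.one_le_rpow (by norm_num) hp
  have h4 : (4 : ℝ) ^ p = 2 ^ p * 2 ^ p := by
    rw [← Real.mul_rpow (by norm_num) (by norm_num)]
    norm_num
  have hzp : 0 ≤ z ^ p := by positivity
  rw [h4]
  calc (x + y + z) ^ p ≤ 2 ^ p * (2 ^ p * (x ^ p + y ^ p) + 2 ^ p * z ^ p) := by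
        refine h1.trans ?_
        gcongr
        exact le_mul_of_one_le_left hzp h3
    _ = _ := by ring

theorem norm_sub_rpow_le {E : Type*} [SeminormedAddCommGroup E] {p : ℝ} (hp : 0 ≤ p) (x y : E) :
    ‖x - y‖ ^ p ≤ 2 ^ p * (‖x‖ ^ p + ‖y‖ ^ p) :=
  (Real.rpow_le_rpow (norm_nonneg _) (norm_sub_le x y) hp).trans
    (add_rpow_le hp (norm_nonneg _) (norm_nonneg _))

theorem rpow_sub_one_rpow {p x : ℝ} (hp : 1 < p) (hx : 0 ≤ x) :
    (x ^ (p - 1)) ^ (p / (p - 1)) = x ^ p := by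
  have : p - 1 ≠ 0 := by linarith
  rw [← Real.rpow_mul hx, mul_div_cancel₀ p this]

/-- The preceding Young inequality at the conjugate exponent, applied to x^{p−1}. -/
theorem mul_le_rpow_add_rpow {p ε x z : ℝ} (hp : 1 < p) (hε : 0 < ε) (hx : 0 ≤ x) (hz : 0 ≤ z) :
    z * x ≤ ε * x ^ p + 1 / ε ^ (p / (p - 1) - 1) * z ^ (p / (p - 1)) := by
  have hp1 : 0 < p - 1 := by linarith
  have h := mul_rpow_sub_one_mul_le (x := x ^ (p - 1)) (holderConjugate_div hp).symm.lt hε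
    zero_le_one (by positivity) hz
  have e : (p - 1) * (p / (p - 1) - 1) = 1 := by field_simp; ring
  rw [one_mul, ← Real.rpow_mul hx, e, Real.rpow_one, rpow_sub_one_rpow hp hx, Real.one_rpow,
    mul_comm] at h
  exact h

/-- Leray–Lions: strict monotonicity forces pointwise convergence. -/
theorem tendsto_of_tendsto_inner_sub {N : ℕ} {A : ℝ × RN N → RN N} (hA : Continuous A)
    (hmono : ∀ (s : ℝ) (ξ η : RN N), ξ ≠ η → 0 < inner ℝ (A (s, ξ) - A (s, η)) (ξ - η))
    {s : ℕ → ℝ} {s₀ : ℝ} {ξ : ℕ → RN N} {ξ₀ : RN N} (hs : Tendsto s atTop (𝓝 s₀)) {K : ℝ}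
    (hK : ∀ n, ‖ξ n‖ ≤ K)
    (h : Tendsto (fun n => inner ℝ (A (s n, ξ n) - A (s n, ξ₀)) (ξ n - ξ₀)) atTop (𝓝 0)) :
    Tendsto ξ atTop (𝓝 ξ₀) := by
  refine tendsto_of_subseq_tendsto fun ns hns => ?_
  obtain ⟨η, -, ms, hms, hη⟩ := (isCompact_closedBall (0 : RN N) K).tendsto_subseq
    (x := fun n => ξ (ns n)) fun n => mem_closedBall_zero_iff.2 (hK _)
  have hsub := hns.comp hms.tendsto_atTop
  have h1 := (hs.comp hsub)
  -- Any cluster point η satisfies (A(s₀, η) − A(s₀, ξ₀))·(η − ξ₀) = 0, which strict monotonicity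
  -- allows only for η = ξ₀.
  have h2 := ((hA.tendsto _).comp (h1.prodMk_nhds hη)).sub
    ((hA.tendsto _).comp (h1.prodMk_nhds (tendsto_const_nhds (x := ξ₀))))
  have h3 := (h2.inner (hη.sub_const ξ₀) (𝕜 := ℝ))
  have h4 := tendsto_nhds_unique h3 (h.comp hsub)
  by_cases hne : η = ξ₀
  · exact ⟨ms, hne ▸ hη⟩
  · exact absurd h4 (hmono s₀ η ξ₀ hne).ne'

section Compactness

variable {N : ℕ} {Ω : Set (RN N)} {p α β α₀ : ℝ}
  {a : RN N → ℝ → RN N → RN N} {a₀ : RN N → ℝ → ℝ} {H : ℕ → RN N → ℝ → RN N → ℝ}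
  {h f : RN N → ℝ} {b : ℝ → ℝ} {ψ w : W01 Ω p} {v : ℕ → W01 Ω p} {C K : ℝ}
  [IsFiniteMeasure (volume.restrict Ω)]

theorem NaturalGrowthData.integral_norm_a_rpow_le {H : RN N → ℝ → RN N → ℝ}
    (hD : NaturalGrowthData Ω p α β α₀ a a₀ H h f b) (hp : 1 < p) (hβ : 0 < β)
    (hC0 : 0 ≤ C) {u : W01 Ω p} (hC : ∀ᵐ x ∂(volume.restrict Ω), |u.toFun x| ≤ C) :
    ∫ x in Ω, ‖a x (u.toFun x) (u.grad x)‖ ^ (p / (p - 1)) ≤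
      β ^ (p / (p - 1)) * (4 ^ (p / (p - 1)) * ((∫ x in Ω, |h x| ^ (p / (p - 1))) +
        (volume Ω).toReal * C ^ p + ∫ x in Ω, ‖u.grad x‖ ^ p)) := by
  have hpq := holderConjugate_div hp
  set q := p / (p - 1) with hq
  have hq0 : 0 < q := hpq.symm.pos
  have i1 : Integrable (fun x => |h x| ^ q) (volume.restrict Ω) :=
    hD.h_memLp.integrable_rpow_norm hq0
  have i2 := u.memLp_grad.integrable_rpow_norm hpq.pos
  have i12 : Integrable (fun x => |h x| ^ q + C ^ p) (volume.restrict Ω) :=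
    i1.add (integrable_const _)
  have i3 : Integrable (fun x => β ^ q * (4 ^ q * (|h x| ^ q + C ^ p + ‖u.grad x‖ ^ p)))
      (volume.restrict Ω) := ((i12.add i2).const_mul _).const_mul _
  have hle := integral_mono_ae
    ((hD.memLp_a hp hβ u.memLp.1 hC u.memLp_grad).integrable_rpow_norm hq0) i3 (by
      filter_upwards [hD.norm_a_le hp hβ hC u.grad] with x hx
      have h1 := Real.rpow_le_rpow (norm_nonneg _) hx hq0.le
      rw [Real.mul_rpow hβ.le (by positivity)] at h1
      refine h1.trans ?_
      have h2 := add_add_rpow_le hq0.le (abs_nonneg (h x))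
        (show 0 ≤ C ^ (p - 1) by positivity) (show 0 ≤ ‖u.grad x‖ ^ (p - 1) by positivity)
      rw [rpow_sub_one_rpow hp hC0, rpow_sub_one_rpow hp (norm_nonneg _)] at h2
      gcongr)
  refine hle.trans (le_of_eq ?_)
  rw [integral_const_mul, integral_const_mul, integral_add i12 i2,
    integral_add i1 (integrable_const _), integral_const]
  simp [Measure.real]

/-- Test with φ(v_n − w), after bounding |Dv_n|^p by a(x,v_n,Dv_n)·Dv_n/α. That product is the
defect density plus a(x,v_n,Dw)·(Dv_n − Dw) plus a(x,v_n,Dv_n)·Dw, so the defect acquires the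
coefficient αφ' − B|φ| ≥ α/2. The rest vanishes: φ(v_n − w) → 0 and φ'(v_n − w) → 1 a.e. and
boundedly, a(x,v_n,Dw) converges strongly in L^{p'}, and weak convergence of Dv_n is used only
against the single field a(x,w,Dw). -/
theorem tendsto_integral_defect_zero
    (hD : ∀ n, NaturalGrowthData Ω p α β α₀ a a₀ (H n) h f b) (hp : 1 < p) (hα : 0 < α)
    (hβ : 0 < β) (hC0 : 0 ≤ C) (hv : ∀ n, IsObstacleSolution a a₀ (H n) ψ (v n))
    (hC : ∀ n, ∀ᵐ x ∂(volume.restrict Ω), |(v n).toFun x| ≤ C)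
    (hK : ∀ n, ∫ x in Ω, ‖(v n).grad x‖ ^ p ≤ K) (hw : w ∈ obstacleSet ψ)
    (hwC : ∀ᵐ x ∂(volume.restrict Ω), |w.toFun x| ≤ C)
    (hlim : ∀ᵐ x ∂(volume.restrict Ω), Tendsto (fun n => (v n).toFun x) atTop (𝓝 (w.toFun x)))
    (hweak : Tendsto (fun n => ∫ x in Ω, inner ℝ ((v n).grad x)
      (a x (w.toFun x) (w.grad x))) atTop
        (𝓝 (∫ x in Ω, inner ℝ (w.grad x) (a x (w.toFun x) (w.grad x))))) :
    (∀ n, Integrable (fun x => inner ℝ (a x ((v n).toFun x) ((v n).grad x) -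
        a x ((v n).toFun x) (w.grad x)) ((v n).grad x - w.grad x)) (volume.restrict Ω)) ∧
    (∀ n, ∀ᵐ x ∂(volume.restrict Ω), 0 ≤ inner ℝ (a x ((v n).toFun x) ((v n).grad x) -
        a x ((v n).toFun x) (w.grad x)) ((v n).grad x - w.grad x)) ∧
    Tendsto (fun n => ∫ x in Ω, inner ℝ (a x ((v n).toFun x) ((v n).grad x) -
        a x ((v n).toFun x) (w.grad x)) ((v n).grad x - w.grad x)) atTop (𝓝 0) := by
  have hp0 : 0 < p := by linarith
  have hpq := holderConjugate_div hp
  have hq0 := hpq.symm.pos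
  have hD0 := hD 0
  set B := b C
  have hB : 0 < B := hD0.b_pos C hC0
  set lam := B ^ 2 / (4 * α ^ 2) with hlam
  have hlam0 : 0 ≤ lam := by positivity
  set F := supNorm Ω f
  have hF0 : 0 ≤ F := supNorm_nonneg _
  set E := (1 + 2 * lam * (C + C) ^ 2) * Real.exp (lam * (C + C) ^ 2) with hE
  have hE0 : 0 ≤ E := by positivity
  set e := (C + C) * Real.exp (lam * (C + C) ^ 2)
  have he0 : 0 ≤ e := by positivity
  have hT : ∀ n, ∀ᵐ x ∂(volume.restrict Ω), |(v n).toFun x - w.toFun x| ≤ C + C := fun n => by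
    filter_upwards [hC n, hwC] with x h1 h2
    exact (abs_sub _ _).trans (add_le_add h1 h2)
  let an : ℕ → RN N → RN N := fun n x => a x ((v n).toFun x) ((v n).grad x)
  let ac : ℕ → RN N → RN N := fun n x => a x ((v n).toFun x) (w.grad x)
  let F₀ : RN N → RN N := fun x => a x (w.toFun x) (w.grad x)
  let d : ℕ → RN N → ℝ := fun n x => deriv (expTest lam) ((v n).toFun x - w.toFun x)
  let P : ℕ → RN N → ℝ := fun n x => expTest lam ((v n).toFun x - w.toFun x)
  let g : ℕ → RN N → RN N := fun n x => (v n).grad x - w.grad x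
  have han : ∀ n, MemLp (an n) (ENNReal.ofReal (p / (p - 1))) (volume.restrict Ω) := fun n =>
    hD0.memLp_a hp hβ (v n).memLp.1 (hC n) (v n).memLp_grad
  have hac : ∀ n, MemLp (ac n) (ENNReal.ofReal (p / (p - 1))) (volume.restrict Ω) := fun n =>
    hD0.memLp_a hp hβ (v n).memLp.1 (hC n) w.memLp_grad
  have hF₀ : MemLp F₀ (ENNReal.ofReal (p / (p - 1))) (volume.restrict Ω) :=
    hD0.memLp_a hp hβ w.memLp.1 hwC w.memLp_grad
  have hg : ∀ n, MemLp (g n) (ENNReal.ofReal p) (volume.restrict Ω) := fun n =>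
    (v n).memLp_grad.sub w.memLp_grad
  have hdc : Continuous (deriv (expTest lam)) :=
    (contDiff_expTest lam).continuous_deriv (by simp)
  have hPc : Continuous (expTest lam) := (contDiff_expTest lam).continuous
  have hdm : ∀ n, AEStronglyMeasurable (d n) (volume.restrict Ω) := fun n =>
    hdc.comp_aestronglyMeasurable ((v n).memLp.1.sub w.memLp.1)
  have hPm : ∀ n, AEStronglyMeasurable (P n) (volume.restrict Ω) := fun n =>
    hPc.comp_aestronglyMeasurable ((v n).memLp.1.sub w.memLp.1)
  have hdb : ∀ n, ∀ᵐ x ∂(volume.restrict Ω), ‖d n x‖ ≤ E := fun n => by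
    filter_upwards [hT n] with x hx
    rw [Real.norm_of_nonneg (deriv_expTest_nonneg hlam0 _)]
    exact deriv_expTest_le hlam0 hx
  have hPb : ∀ n, ∀ᵐ x ∂(volume.restrict Ω), ‖P n x‖ ≤ e := fun n => by
    filter_upwards [hT n] with x hx
    exact abs_expTest_le hlam0 hx
  have hd_lim : ∀ᵐ x ∂(volume.restrict Ω), Tendsto (fun n => d n x) atTop (𝓝 1) := by
    filter_upwards [hlim] with x hx
    have h1 := (hdc.tendsto 0).comp ((hx.sub_const (w.toFun x)).trans (by rw [sub_self]))
    have e0 : deriv (expTest lam) 0 = 1 := by simp [deriv_expTest]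
    rwa [e0] at h1
  have hP_lim : ∀ᵐ x ∂(volume.restrict Ω), Tendsto (fun n => P n x) atTop (𝓝 0) := by
    filter_upwards [hlim] with x hx
    have h1 := (hPc.tendsto 0).comp ((hx.sub_const (w.toFun x)).trans (by rw [sub_self]))
    rwa [expTest_zero] at h1
  have hac_lim : ∀ᵐ x ∂(volume.restrict Ω), Tendsto (fun n => ac n x) atTop (𝓝 (F₀ x)) := by
    filter_upwards [hlim, hD0.a_caratheodory.2] with x hx hc
    exact (hc.tendsto (w.toFun x, w.grad x)).comp (hx.prodMk_nhds tendsto_const_nhds)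
  have hei : ∀ n, Integrable (fun x => inner ℝ (an n x - ac n x) (g n x)) (volume.restrict Ω) :=
    fun n => integrable_inner_of_memLp hpq.symm ((han n).sub (hac n)) (hg n)
  have he_nonneg : ∀ n, ∀ᵐ x ∂(volume.restrict Ω), 0 ≤ inner ℝ (an n x - ac n x) (g n x) := by
    intro n
    filter_upwards [hD0.a_monotone] with x hx
    by_cases hne : (v n).grad x = w.grad x
    · simp [g, hne]
    · exact (hx _ _ _ hne).le
  refine ⟨hei, he_nonneg, ?_⟩
  have hKg : ∀ n, ∫ x in Ω, ‖g n x‖ ^ p ≤ 2 ^ p * (K + ∫ x in Ω, ‖w.grad x‖ ^ p) := fun n => by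
    have i1 := (v n).memLp_grad.integrable_rpow_norm hp0
    have i2 := w.memLp_grad.integrable_rpow_norm hp0
    refine (integral_mono ((hg n).integrable_rpow_norm hp0) ((i1.add i2).const_mul _)
      fun x => norm_sub_rpow_le hp0.le _ _).trans ?_
    rw [integral_const_mul]
    refine mul_le_mul_of_nonneg_left ?_ (by positivity)
    refine (integral_add i1 i2).trans_le ?_
    exact add_le_add (hK n) le_rfl
  obtain ⟨K', hK'⟩ : ∃ K', ∀ n, ∫ x in Ω, ‖an n x‖ ^ (p / (p - 1)) ≤ K' := by
    refine ⟨β ^ (p / (p - 1)) * (4 ^ (p / (p - 1)) * ((∫ x in Ω, |h x| ^ (p / (p - 1))) +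
        (volume Ω).toReal * C ^ p + K)), fun n => ?_⟩
    refine (hD0.integral_norm_a_rpow_le hp hβ hC0 (hC n)).trans ?_
    have := hK n
    gcongr
  set gr : RN N → ℝ := fun x => β * (|h x| + C ^ (p - 1) + ‖w.grad x‖ ^ (p - 1))
  have hgr : MemLp gr (ENNReal.ofReal (p / (p - 1))) (volume.restrict Ω) :=
    hD0.memLp_growth hp w.memLp_grad C
  have hacb : ∀ n, ∀ᵐ x ∂(volume.restrict Ω), ‖ac n x‖ ≤ gr x := fun n =>
    hD0.norm_a_le hp hβ (hC n) w.grad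
  have hF₀b : ∀ᵐ x ∂(volume.restrict Ω), ‖F₀ x‖ ≤ gr x := hD0.norm_a_le hp hβ hwC w.grad
  have hdac : ∀ n, MemLp (fun x => d n x • ac n x) (ENNReal.ofReal (p / (p - 1)))
      (volume.restrict Ω) := fun n => (hac n).of_le_mul ((hdm n).smul (hac n).1) (c := E) (by
        filter_upwards [hdb n] with x hx
        rw [norm_smul]
        gcongr)
  have hPac : ∀ n, MemLp (fun x => P n x • ac n x) (ENNReal.ofReal (p / (p - 1)))
      (volume.restrict Ω) := fun n => (hac n).of_le_mul ((hPm n).smul (hac n).1) (c := e) (by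
        filter_upwards [hPb n] with x hx
        rw [norm_smul]
        gcongr)
  have hPw : ∀ n, MemLp (fun x => P n x • w.grad x) (ENNReal.ofReal p)
      (volume.restrict Ω) := fun n =>
        w.memLp_grad.of_le_mul ((hPm n).smul w.memLp_grad.1) (c := e) (by
          filter_upwards [hPb n] with x hx
          rw [norm_smul]
          gcongr)
  have T1 : Tendsto (fun n => ∫ x in Ω, inner ℝ (g n x) (F₀ x)) atTop (𝓝 0) := by
    have h1 := hweak.sub_const (∫ x in Ω, inner ℝ (w.grad x) (F₀ x))
    rw [sub_self] at h1
    refine h1.congr fun n => ?_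
    rw [← integral_sub (integrable_inner_of_memLp hpq (v n).memLp_grad hF₀)
      (integrable_inner_of_memLp hpq w.memLp_grad hF₀)]
    exact integral_congr_ae (.of_forall fun x => (inner_sub_left _ _ _).symm)
  -- The factor φ'(v_n − w) is attached to a(x,v_n,Dw), and their product converges strongly to F₀;
  -- so only F₀ itself has to be paired with the weakly convergent gradients.
  have T2 : Tendsto (fun n => ∫ x in Ω, ‖g n x‖ * ‖d n x • ac n x - F₀ x‖) atTop (𝓝 0) := by
    refine tendsto_integral_mul_norm_zero hpq hg (fun n => (hdac n).sub hF₀) hKg ?_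
    refine tendsto_eLpNorm_sub_of_dominated hq0 (fun n => (hdac n).1) ?_
      (hgr.const_mul (E + 1)) fun n => ?_
    · filter_upwards [hd_lim, hac_lim] with x h1 h2
      simpa using h1.smul h2
    · filter_upwards [hdb n, hacb n, hF₀b] with x h1 h2 h3
      refine (norm_sub_le _ _).trans ?_
      rw [norm_smul, add_mul, one_mul]
      gcongr
  have T3 : Tendsto (fun n => ∫ x in Ω, (β * (|h x| + C ^ (p - 1)) + F) * |P n x|) atTop
      (𝓝 0) := by
    have ih : Integrable (fun x => β * (|h x| + C ^ (p - 1)) + F) (volume.restrict Ω) :=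
      (((memLp_one_iff_integrable.1 (hD0.h_memLp.mono_exponent
        (by simpa using hpq.symm.lt.le))).abs.add (integrable_const _)).const_mul β).add
          (integrable_const _)
    rw [← integral_zero (RN N) ℝ (μ := volume.restrict Ω)]
    refine tendsto_integral_of_dominated_convergence _
      (fun n => ih.1.mul (hPm n).norm) (ih.mul_const e) (fun n => ?_) ?_
    · filter_upwards [hPb n] with x hx
      have hnn : 0 ≤ β * (|h x| + C ^ (p - 1)) + F := by positivity
      rw [Real.norm_of_nonneg (by positivity)]
      gcongr
      exact hx
    · filter_upwards [hP_lim] with x hx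
      simpa using hx.abs.const_mul (β * (|h x| + C ^ (p - 1)) + F)
  have T4 : Tendsto (fun n => ∫ x in Ω, ‖g n x‖ * ‖P n x • ac n x‖) atTop (𝓝 0) := by
    refine tendsto_integral_mul_norm_zero hpq hg hPac hKg ?_
    have := tendsto_eLpNorm_sub_of_dominated hq0 (f₀ := fun _ => (0 : RN N))
      (fun n => (hPac n).1) ?_ (hgr.const_mul e) fun n => ?_
    · simpa using this
    · filter_upwards [hP_lim, hac_lim] with x h1 h2
      simpa using h1.smul h2
    · filter_upwards [hPb n, hacb n] with x h1 h2
      rw [sub_zero, norm_smul]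
      gcongr
  have T5 : Tendsto (fun n => ∫ x in Ω, ‖an n x‖ * ‖P n x • w.grad x‖) atTop (𝓝 0) := by
    refine tendsto_integral_mul_norm_zero hpq.symm han hPw hK' ?_
    have := tendsto_eLpNorm_sub_of_dominated hp0 (f₀ := fun _ => (0 : RN N))
      (fun n => (hPw n).1) ?_ (w.memLp_grad.norm.const_mul e) fun n => ?_
    · simpa using this
    · filter_upwards [hP_lim] with x h1
      simpa using h1.smul_const (w.grad x)
    · filter_upwards [hPb n] with x h1
      rw [sub_zero, norm_smul]
      gcongr
  have hsum := (((T1.const_mul (-α)).add (T2.const_mul α)).add (T3.const_mul α)).add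
    ((T4.add T5).const_mul B)
  simp only [mul_zero, add_zero] at hsum
  have hsum2 := hsum.const_mul (2 / α)
  rw [mul_zero] at hsum2
  refine squeeze_zero (fun n => integral_nonneg_of_ae (he_nonneg n)) (fun n => ?_) hsum2
  obtain ⟨hi, hle⟩ := (hv n).integral_expTest_le_zero (hD n) hp hβ hw hlam0 (hT n)
  have i1 : Integrable (fun x => inner ℝ (g n x) (F₀ x)) (volume.restrict Ω) :=
    integrable_inner_of_memLp hpq (hg n) hF₀
  have i2 : Integrable (fun x => ‖g n x‖ * ‖d n x • ac n x - F₀ x‖) (volume.restrict Ω) :=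
    integrable_mul_norm hpq (hg n) ((hdac n).sub hF₀)
  have i3 : Integrable (fun x => (β * (|h x| + C ^ (p - 1)) + F) * |P n x|)
      (volume.restrict Ω) := by
    have ih : Integrable (fun x => β * (|h x| + C ^ (p - 1)) + F) (volume.restrict Ω) :=
      (((memLp_one_iff_integrable.1 (hD0.h_memLp.mono_exponent
        (by simpa using hpq.symm.lt.le))).abs.add (integrable_const _)).const_mul β).add
          (integrable_const _)
    refine ih.mul_bdd (c := e) (hPm n).norm ?_
    filter_upwards [hPb n] with x hx
    simpa using hx
  have i4 : Integrable (fun x => ‖g n x‖ * ‖P n x • ac n x‖) (volume.restrict Ω) :=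
    integrable_mul_norm hpq (hg n) (hPac n)
  have i5 : Integrable (fun x => ‖an n x‖ * ‖P n x • w.grad x‖) (volume.restrict Ω) :=
    integrable_mul_norm hpq.symm (han n) (hPw n)
  have i45 : Integrable (fun x => B * (‖g n x‖ * ‖P n x • ac n x‖ +
      ‖an n x‖ * ‖P n x • w.grad x‖)) (volume.restrict Ω) := (i4.add i5).const_mul B
  have i12 : Integrable (fun x => -α * inner ℝ (g n x) (F₀ x) +
      α * (‖g n x‖ * ‖d n x • ac n x - F₀ x‖)) (volume.restrict Ω) :=
    (i1.const_mul (-α)).add (i2.const_mul α)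
  have i123 : Integrable (fun x => -α * inner ℝ (g n x) (F₀ x) +
      α * (‖g n x‖ * ‖d n x • ac n x - F₀ x‖) +
      α * ((β * (|h x| + C ^ (p - 1)) + F) * |P n x|)) (volume.restrict Ω) :=
    i12.add (i3.const_mul α)
  have i0 : Integrable (fun x => -α * inner ℝ (g n x) (F₀ x) +
      α * (‖g n x‖ * ‖d n x • ac n x - F₀ x‖) +
      α * ((β * (|h x| + C ^ (p - 1)) + F) * |P n x|) +
      B * (‖g n x‖ * ‖P n x • ac n x‖ + ‖an n x‖ * ‖P n x • w.grad x‖)) (volume.restrict Ω) :=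
    i123.add i45
  -- The tested inequality is multiplied by α, so that coercivity can be inserted in the Hamiltonian
  -- term without dividing.
  have hmain := integral_mono_ae ((hei n).const_mul (α / 2)) ((hi.const_mul α).add i0) (by
    filter_upwards [hD0.a_coercive, hD0.abs_a₀_le hp hβ (hC n), (hD n).abs_H_le (hC n) (v n).grad,
      hD0.f_le, he_nonneg n] with x h1 h3 h4 h5 h6
    have k1 : α * ‖(v n).grad x‖ ^ p ≤ inner ℝ (an n x) ((v n).grad x) := h1 _ _
    have k2 : α / 2 ≤ α * d n x - B * |P n x| := half_le_deriv_expTest_sub (B := B) hα _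
    have k3 : inner ℝ (an n x) ((v n).grad x) = inner ℝ (an n x - ac n x) (g n x) +
        inner ℝ (ac n x) (g n x) + inner ℝ (an n x) (w.grad x) := by
      simp only [g, inner_sub_left, inner_sub_right]
      ring
    have k4 : inner ℝ (an n x) (g n x) = inner ℝ (an n x - ac n x) (g n x) +
        inner ℝ (ac n x) (g n x) := by rw [inner_sub_left]; ring
    set en := inner ℝ (an n x - ac n x) (g n x)
    have k5 : inner ℝ (ac n x) (g n x) ≤ ‖g n x‖ * ‖ac n x‖ :=
      (real_inner_le_norm _ _).trans_eq (mul_comm _ _)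
    have k6 : inner ℝ (an n x) (w.grad x) ≤ ‖an n x‖ * ‖w.grad x‖ := real_inner_le_norm _ _
    have k7 : inner ℝ (g n x) (F₀ x) - ‖g n x‖ * ‖d n x • ac n x - F₀ x‖ ≤
        inner ℝ (ac n x) (g n x) * d n x := by
      have e1 : inner ℝ (ac n x) (g n x) * d n x =
          inner ℝ (g n x) (F₀ x) + inner ℝ (g n x) (d n x • ac n x - F₀ x) := by
        rw [inner_sub_right (g n x) (d n x • ac n x) (F₀ x),
          inner_smul_right (g n x) (ac n x) (d n x), real_inner_comm (ac n x) (g n x)]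
        ring
      rw [e1]
      have := neg_le_of_abs_le (abs_real_inner_le_norm (g n x) (d n x • ac n x - F₀ x))
      linarith
    have k8 : -(β * (|h x| + C ^ (p - 1)) * |P n x|) ≤ a₀ x ((v n).toFun x) * P n x := by
      refine neg_le_of_abs_le ?_
      rw [abs_mul]
      gcongr
    have k9 : -((F + B * ‖(v n).grad x‖ ^ p) * |P n x|) ≤
        H n x ((v n).toFun x) ((v n).grad x) * P n x := by
      refine neg_le_of_abs_le ?_
      rw [abs_mul]
      refine mul_le_mul_of_nonneg_right (h4.trans ?_) (abs_nonneg _)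
      linarith
    have k10 := mul_le_mul_of_nonneg_right k2 h6
    have hBP : 0 ≤ B * |P n x| := by positivity
    have k11 := mul_le_mul_of_nonneg_left
      (k1.trans (k3.le.trans (add_le_add (add_le_add le_rfl k5) k6))) hBP
    have k12 := mul_le_mul_of_nonneg_left k7 hα.le
    have k13 := mul_le_mul_of_nonneg_left k8 hα.le
    have k14 := mul_le_mul_of_nonneg_left k9 hα.le
    have e2 : ‖P n x • ac n x‖ = |P n x| * ‖ac n x‖ := norm_smul _ _
    have e3 : ‖P n x • w.grad x‖ = |P n x| * ‖w.grad x‖ := norm_smul _ _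
    have k15 : α * (inner ℝ (an n x) (g n x) * d n x) =
        α * d n x * en + α * (inner ℝ (ac n x) (g n x) * d n x) := by rw [k4]; ring
    simp only [Pi.add_apply]
    rw [e2, e3]
    change _ ≤ α * (inner ℝ (an n x) (g n x) * d n x + a₀ x ((v n).toFun x) * P n x +
      H n x ((v n).toFun x) ((v n).grad x) * P n x) + _
    linarith)
  rw [integral_const_mul] at hmain
  simp only [Pi.add_apply] at hmain
  rw [integral_add (hi.const_mul α) i0, integral_const_mul, integral_add i123 i45,
    integral_add i12 (i3.const_mul α), integral_add (i1.const_mul _) (i2.const_mul _),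
    integral_const_mul, integral_const_mul, integral_const_mul α, integral_const_mul B,
    integral_add i4 i5] at hmain
  have hle' := mul_nonpos_of_nonneg_of_nonpos hα.le hle
  have e4 : ∀ y : ℝ, y = 2 / α * (α / 2 * y) := fun y => by field_simp
  rw [e4 (∫ x in Ω, inner ℝ (a x ((v n).toFun x) ((v n).grad x) -
        a x ((v n).toFun x) (w.grad x)) ((v n).grad x - w.grad x))]
  refine mul_le_mul_of_nonneg_left ?_ (by positivity)
  refine hmain.trans ?_
  linarith

end Compactness

/-! ### Strong convergence of the gradients -/

/-- Expand the inner product: A·ξ is coercive, and each of the cross terms B·ξ and A·η gives back at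
most α/4 |ξ|^p by Young. The defect thus controls |Dv_n|^p up to a function independent of n. -/
theorem half_mul_norm_rpow_le_inner_sub {E : Type*} [NormedAddCommGroup E] [InnerProductSpace ℝ E]
    {p α β k g : ℝ} (hp : 1 < p) (hα : 0 < α) (hβ : 0 < β) {ξ η A B : E}
    (hc : α * ‖ξ‖ ^ p ≤ inner ℝ A ξ) (hA : ‖A‖ ≤ k + β * ‖ξ‖ ^ (p - 1)) (hB : ‖B‖ ≤ g)
    (hk : k ≤ g) :
    α / 2 * ‖ξ‖ ^ p ≤ inner ℝ (A - B) (ξ - η) + (1 / (α / 4) ^ (p / (p - 1) - 1) *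
      g ^ (p / (p - 1)) + β ^ p / (α / 4) ^ (p - 1) * ‖η‖ ^ p + 2 * (g * ‖η‖)) := by
  have hα4 : 0 < α / 4 := by positivity
  have hg : 0 ≤ g := (norm_nonneg _).trans hB
  have h1 := mul_le_rpow_add_rpow hp hα4 (norm_nonneg ξ) hg
  have h2 := mul_rpow_sub_one_mul_le hp hα4 hβ.le (norm_nonneg ξ) (norm_nonneg η)
  have h3 : inner ℝ (A - B) (ξ - η) = inner ℝ A ξ - inner ℝ B ξ - inner ℝ A η + inner ℝ B η := by
    rw [inner_sub_left, inner_sub_right, inner_sub_right]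
    ring
  have h4 : inner ℝ B ξ ≤ g * ‖ξ‖ := (real_inner_le_norm _ _).trans (by gcongr)
  have h5 : inner ℝ A η ≤ (g + β * ‖ξ‖ ^ (p - 1)) * ‖η‖ :=
    (real_inner_le_norm _ _).trans (by gcongr; linarith)
  have h6 : -(g * ‖η‖) ≤ inner ℝ B η :=
    (neg_le_neg (by gcongr)).trans (neg_le_of_abs_le (abs_real_inner_le_norm B η))
  rw [h3]
  linarith

section StrongConvergence

variable {N : ℕ} {Ω : Set (RN N)} {p α β α₀ : ℝ}
  {a : RN N → ℝ → RN N → RN N} {a₀ : RN N → ℝ → ℝ}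
  {h f : RN N → ℝ} {b : ℝ → ℝ} {ψ w : W01 Ω p} {v : ℕ → W01 Ω p} {C : ℝ}
  [IsFiniteMeasure (volume.restrict Ω)]

/-- Where the defect tends to 0, the same coercivity bound keeps Dv_n(x) bounded, and strict
monotonicity forces Dv_n(x) → Dw(x). That bound also supplies the majorant for generalised dominated
convergence, with the defect as its vanishing part. -/
theorem NaturalGrowthData.exists_subseq_tendsto_grad {H : RN N → ℝ → RN N → ℝ}
    (hD : NaturalGrowthData Ω p α β α₀ a a₀ H h f b) (hp : 1 < p) (hα : 0 < α)
    (hβ : 0 < β) (hC0 : 0 ≤ C)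
    (hC : ∀ n, ∀ᵐ x ∂(volume.restrict Ω), |(v n).toFun x| ≤ C)
    (hlim : ∀ᵐ x ∂(volume.restrict Ω), Tendsto (fun n => (v n).toFun x) atTop (𝓝 (w.toFun x)))
    (he : ∀ n, Integrable (fun x => inner ℝ (a x ((v n).toFun x) ((v n).grad x) -
        a x ((v n).toFun x) (w.grad x)) ((v n).grad x - w.grad x)) (volume.restrict Ω))
    (he0 : ∀ n, ∀ᵐ x ∂(volume.restrict Ω), 0 ≤ inner ℝ (a x ((v n).toFun x) ((v n).grad x) -
        a x ((v n).toFun x) (w.grad x)) ((v n).grad x - w.grad x))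
    (helim : Tendsto (fun n => ∫ x in Ω, inner ℝ (a x ((v n).toFun x) ((v n).grad x) -
        a x ((v n).toFun x) (w.grad x)) ((v n).grad x - w.grad x)) atTop (𝓝 0)) :
    ∃ ns : ℕ → ℕ, StrictMono ns ∧
      Tendsto (fun i => eLpNorm (fun x => (v (ns i)).grad x - w.grad x) (ENNReal.ofReal p)
        (volume.restrict Ω)) atTop (𝓝 0) := by
  have hp0 : 0 < p := by linarith
  have hpq := holderConjugate_div hp
  set e : ℕ → RN N → ℝ := fun n x => inner ℝ (a x ((v n).toFun x) ((v n).grad x) -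
        a x ((v n).toFun x) (w.grad x)) ((v n).grad x - w.grad x) with hedef
  obtain ⟨ns, hns, hae⟩ := exists_seq_tendsto_ae_of_tendsto_integral he he0 helim
  refine ⟨ns, hns, ?_⟩
  set gr : RN N → ℝ := fun x => β * (|h x| + C ^ (p - 1) + ‖w.grad x‖ ^ (p - 1))
  have hgr : MemLp gr (ENNReal.ofReal (p / (p - 1))) (volume.restrict Ω) :=
    hD.memLp_growth hp w.memLp_grad C
  have hgr0 : ∀ x, 0 ≤ gr x := fun x => by positivity
  set Γ : RN N → ℝ := fun x => 1 / (α / 4) ^ (p / (p - 1) - 1) *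
      gr x ^ (p / (p - 1)) + β ^ p / (α / 4) ^ (p - 1) * ‖w.grad x‖ ^ p + 2 * (gr x * ‖w.grad x‖)
  have hΓ : Integrable Γ (volume.restrict Ω) := by
    have i1 : Integrable (fun x => gr x ^ (p / (p - 1))) (volume.restrict Ω) :=
      (hgr.integrable_rpow_norm hpq.symm.pos).congr (.of_forall fun x => by
        dsimp only
        rw [Real.norm_of_nonneg (hgr0 x)])
    have i2 : Integrable (fun x => gr x * ‖w.grad x‖) (volume.restrict Ω) :=
      (integrable_mul_norm hpq.symm hgr w.memLp_grad).congr (.of_forall fun x => by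
        dsimp only
        rw [Real.norm_of_nonneg (hgr0 x)])
    exact ((i1.const_mul _).add ((w.memLp_grad.integrable_rpow_norm hp0).const_mul _)).add
      (i2.const_mul 2)
  have hb : ∀ n, ∀ᵐ x ∂(volume.restrict Ω), α / 2 * ‖(v n).grad x‖ ^ p ≤ e n x + Γ x := fun n => by
    filter_upwards [hD.a_coercive, hD.norm_a_le hp hβ (hC n) (v n).grad,
      hD.norm_a_le hp hβ (hC n) w.grad] with x h1 h2 h3
    refine half_mul_norm_rpow_le_inner_sub (k := β * (|h x| + C ^ (p - 1))) hp hα hβ (h1 _ _)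
      (h2.trans_eq (by ring)) h3 ?_
    have : 0 ≤ ‖w.grad x‖ ^ (p - 1) := by positivity
    refine mul_le_mul_of_nonneg_left ?_ hβ.le
    linarith
  have hb' : ∀ n, ∀ᵐ x ∂(volume.restrict Ω), ‖(v n).grad x‖ ^ p ≤ 2 / α * (e n x + Γ x) :=
    fun n => by
      filter_upwards [hb n] with x hx
      have := mul_le_mul_of_nonneg_left hx (by positivity : 0 ≤ 2 / α)
      refine le_trans (le_of_eq ?_) this
      field_simp
  have hgrad : ∀ᵐ x ∂(volume.restrict Ω),
      Tendsto (fun i => (v (ns i)).grad x) atTop (𝓝 (w.grad x)) := by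
    filter_upwards [hae, hlim, hD.a_caratheodory.2, hD.a_monotone, ae_all_iff.2 hb'] with
      x h1 h2 h3 h4 h5
    obtain ⟨R, hR⟩ := h1.bddAbove_range
    have hle : ∀ n, ‖(v (ns n)).grad x‖ ^ p ≤ 2 / α * (R + Γ x) := fun n => by
      have hRn : e (ns n) x ≤ R := hR (Set.mem_range_self n)
      exact (h5 (ns n)).trans (by gcongr)
    refine tendsto_of_tendsto_inner_sub h3 h4 (h2.comp hns.tendsto_atTop)
      (K := (2 / α * (R + Γ x)) ^ p⁻¹) (fun n => ?_) h1
    refine (Real.le_rpow_inv_iff_of_pos (norm_nonneg _) ?_ hp0).2 ?_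
    · exact le_trans (by positivity) (hle n)
    · exact hle n
  have hm : ∀ i, MemLp (fun x => (v (ns i)).grad x - w.grad x) (ENNReal.ofReal p)
      (volume.restrict Ω) := fun i => (v (ns i)).memLp_grad.sub w.memLp_grad
  rw [tendsto_eLpNorm_ofReal_zero_iff hp0 hm, ← integral_zero (RN N) ℝ (μ := volume.restrict Ω)]
  refine (integrable_and_tendsto_integral_of_norm_le_add
    (g := fun x => 2 ^ p * (2 / α * Γ x + ‖w.grad x‖ ^ p))
    (e := fun i x => 2 ^ p * (2 / α * e (ns i) x)) (fun i => ((hm i).integrable_rpow_norm hp0).1)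
    ?_ (((hΓ.const_mul _).add (w.memLp_grad.integrable_rpow_norm hp0)).const_mul _)
    (fun i => ((he _).const_mul _).const_mul _) (fun i => ?_) ?_ fun i => ?_).2
  · filter_upwards [hgrad] with x hx
    have h1 := ((hx.sub_const (w.grad x)).norm).rpow_const (p := p) (Or.inr hp0.le)
    simpa [hp0.ne'] using h1
  · filter_upwards [he0 (ns i)] with x hx
    have : 0 ≤ e (ns i) x := hx
    positivity
  · have h1 := ((helim.comp hns.tendsto_atTop).const_mul (2 / α)).const_mul (2 ^ p)
    rw [mul_zero, mul_zero] at h1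
    refine h1.congr fun i => ?_
    rw [integral_const_mul, integral_const_mul]
    rfl
  · filter_upwards [hb' (ns i)] with x hx
    rw [Real.norm_of_nonneg (by positivity)]
    refine (norm_sub_rpow_le hp0.le _ _).trans ?_
    rw [← mul_add]
    refine mul_le_mul_of_nonneg_left ?_ (by positivity)
    linarith

theorem exists_subseq_strongConv (hΩ : IsOpen Ω) {H : ℕ → RN N → ℝ → RN N → ℝ}
    (hD : ∀ n, NaturalGrowthData Ω p α β α₀ a a₀ (H n) h f b) (hp : 1 < p) (hα : 0 < α)
    (hβ : 0 < β) (hα₀ : 0 < α₀) (hψ : ψ.Bounded)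
    (hv : ∀ n, IsObstacleSolution a a₀ (H n) ψ (v n)) :
    ∃ (k : ℕ → ℕ) (w : W01 Ω p), StrictMono k ∧ W01.StrongConv (fun n => v (k n)) w := by
  have hp0 : 0 < p := by linarith
  have hpq := holderConjugate_div hp
  set C := CInfty (supNorm Ω f) α₀ p (supNorm Ω ψ.toFun)
  have hC0 : 0 ≤ C := CInfty_nonneg (supNorm_nonneg _)
  have hC : ∀ n, ∀ᵐ x ∂(volume.restrict Ω), |(v n).toFun x| ≤ C := fun n =>
    (hv n).ae_abs_le (hD n) hp hα hβ hα₀ hψ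
  -- The obstacle itself is an admissible Ψ in the gradient estimate.
  obtain ⟨K, hK⟩ : ∃ K, ∀ n, ∫ x in Ω, ‖(v n).grad x‖ ^ p ≤ K := ⟨_, fun n =>
    (((hv n).satisfiesEstimates (hD n) hp hα hβ hα₀ hψ).2 ψ
      (ae_of_all (volume.restrict Ω) fun _ => le_rfl) hψ).1⟩
  obtain ⟨n₁, u, hn₁, hum, hu⟩ := W01.exists_subseq_tendsto_ae hΩ.measurableSet hp hC hK
  have huC : ∀ᵐ x ∂(volume.restrict Ω), |u x| ≤ C := by
    filter_upwards [hu, ae_all_iff.2 hC] with x h1 h2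
    exact le_of_tendsto' h1.abs fun i => h2 _
  have huLp : MemLp u (ENNReal.ofReal p) (volume.restrict Ω) := MemLp.of_bound hum C huC
  have hlp : ∀ {ns : ℕ → ℕ}, (∀ᵐ x ∂(volume.restrict Ω),
      Tendsto (fun i => (v (ns i)).toFun x) atTop (𝓝 (u x))) →
      Tendsto (fun i => eLpNorm (fun x => (v (ns i)).toFun x - u x) (ENNReal.ofReal p)
        (volume.restrict Ω)) atTop (𝓝 0) := fun {ns} hns =>
    tendsto_eLpNorm_sub_of_dominated hp0 (fun i => (v (ns i)).memLp.1) hns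
      (memLp_const (C + C)) fun i => by
        filter_upwards [hC (ns i), huC] with x h1 h2
        exact (norm_sub_le _ _).trans (add_le_add h1 h2)
  -- First use, with the trivial field: it only produces w. The field F₀ of interest involves Dw and
  -- cannot be chosen before w is known.
  obtain ⟨G, ⟨w, rfl, -⟩, -⟩ := W01.exists_grad_of_tendsto hpq (fun n => hK (n₁ n)) huLp (hlp hu)
    (F := 0) (MemLp.zero) (l := 0) (by simp)
  have hwψ : w ∈ obstacleSet ψ := by
    have h1 : ∀ n, ∀ᵐ x ∂(volume.restrict Ω), ψ.toFun x ≤ (v n).toFun x := fun n => (hv n).1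
    change ∀ᵐ x ∂(volume.restrict Ω), ψ.toFun x ≤ w.toFun x
    filter_upwards [hu, ae_all_iff.2 h1] with x h1 h2
    exact ge_of_tendsto' h1 fun i => h2 _
  set F₀ : RN N → RN N := fun x => a x (w.toFun x) (w.grad x) with hF₀def
  have hF₀ : MemLp F₀ (ENNReal.ofReal (p / (p - 1))) (volume.restrict Ω) :=
    (hD 0).memLp_a hp hβ w.memLp.1 huC w.memLp_grad
  obtain ⟨R, hR⟩ : ∃ R, ∀ n, |∫ x in Ω, inner ℝ ((v n).grad x) (F₀ x)| ≤ R := by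
    refine ⟨K ^ (1 / p) * (∫ x in Ω, ‖F₀ x‖ ^ (p / (p - 1))) ^ (1 / (p / (p - 1))), fun n => ?_⟩
    refine (abs_integral_le_integral_abs).trans ((integral_mono
      (integrable_inner_of_memLp hpq (v n).memLp_grad hF₀).abs
      (integrable_mul_norm hpq (v n).memLp_grad hF₀) fun x => abs_real_inner_le_norm _ _).trans ?_)
    refine (integral_mul_norm_le hpq (v n).memLp_grad hF₀).trans ?_
    have h1 : 0 ≤ ∫ x in Ω, ‖(v n).grad x‖ ^ p := integral_nonneg fun x => by positivity
    have h2 : 0 ≤ ∫ x in Ω, ‖F₀ x‖ ^ (p / (p - 1)) := integral_nonneg fun x => by positivity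
    have h3 := hK n
    gcongr
  -- Only one field is tested, so compactness of a bounded real sequence replaces weak compactness
  -- of the gradients.
  obtain ⟨l, -, n₂, hn₂, hl⟩ := (isCompact_Icc (a := -R) (b := R)).tendsto_subseq
    (x := fun n => ∫ x in Ω, inner ℝ ((v (n₁ n)).grad x) (F₀ x)) fun n => abs_le.1 (hR _)
  have hu₂ : ∀ᵐ x ∂(volume.restrict Ω),
      Tendsto (fun i => (v (n₁ (n₂ i))).toFun x) atTop (𝓝 (w.toFun x)) := by
    filter_upwards [hu] with x hx
    exact hx.comp hn₂.tendsto_atTop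
  obtain ⟨G, ⟨w', hw', rfl⟩, hGl⟩ := W01.exists_grad_of_tendsto hpq
    (fun n => hK (n₁ (n₂ n))) huLp (hlp (ns := fun n => n₁ (n₂ n)) hu₂) hF₀ hl
  -- The second use yields a possibly different gradient representative; uniqueness identifies l as
  -- the pairing with Dw.
  have hww : w'.grad =ᵐ[volume.restrict Ω] w.grad := W01.grad_ae_eq hΩ hp (by rw [hw'])
  have hl' : ∫ x in Ω, inner ℝ (w.grad x) (F₀ x) = l := by
    rw [← hGl]
    refine integral_congr_ae ?_
    filter_upwards [hww] with x hx
    rw [hx]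
  rw [← hl'] at hl
  obtain ⟨he, he0, helim⟩ := tendsto_integral_defect_zero (v := fun n => v (n₁ (n₂ n)))
    (fun n => hD (n₁ (n₂ n))) hp hα hβ hC0 (fun n => hv _) (fun n => hC _) (fun n => hK _) hwψ huC
    hu₂ hl
  obtain ⟨n₃, hn₃, hgrad⟩ := (hD 0).exists_subseq_tendsto_grad (v := fun n => v (n₁ (n₂ n))) hp hα
    hβ hC0 (fun n => hC _) hu₂ he he0 helim
  refine ⟨fun n => n₁ (n₂ (n₃ n)), w, hn₁.comp (hn₂.comp hn₃), ?_, hgrad⟩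
  exact (hlp (ns := fun n => n₁ (n₂ n)) hu₂).comp hn₃.tendsto_atTop

end StrongConvergence

/-! ### Passage to the limit in the obstacle problem -/

section Limit

variable {N : ℕ} {Ω : Set (RN N)} {p α β α₀ : ℝ}
  {a : RN N → ℝ → RN N → RN N} {a₀ : RN N → ℝ → ℝ} {H : RN N → ℝ → RN N → ℝ}
  {h f : RN N → ℝ} {b : ℝ → ℝ} {ψ w : W01 Ω p} {v : ℕ → W01 Ω p}

theorem tendsto_truncH {j : ℕ → ℕ} (hj : Tendsto j atTop atTop) {x : RN N}
    (hH : Continuous fun q : ℝ × RN N => H x q.1 q.2) {s : ℕ → ℝ} {s₀ : ℝ} {ξ : ℕ → RN N}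
    {ξ₀ : RN N} (hs : Tendsto s atTop (𝓝 s₀)) (hξ : Tendsto ξ atTop (𝓝 ξ₀)) :
    Tendsto (fun n => truncH H (j n) x (s n) (ξ n)) atTop (𝓝 (H x s₀ ξ₀)) := by
  have h1 : Tendsto (fun n => H x (s n) (ξ n)) atTop (𝓝 (H x s₀ ξ₀)) :=
    (hH.tendsto (s₀, ξ₀)).comp (hs.prodMk_nhds hξ)
  have h2 : Tendsto (fun n => 1 / (j n : ℝ)) atTop (𝓝 0) :=
    tendsto_one_div_atTop_nhds_zero_nat.comp hj
  have h3 := h1.div ((h2.mul h1.abs).const_add 1) (by simp)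
  rw [zero_mul, add_zero, div_one] at h3
  exact h3

theorem W01.StrongConv.exists_subseq_tendsto_ae (hp : 1 < p) (hvw : W01.StrongConv v w) :
    ∃ ns : ℕ → ℕ, StrictMono ns ∧
      (∀ᵐ x ∂(volume.restrict Ω),
        Tendsto (fun i => (v (ns i)).toFun x) atTop (𝓝 (w.toFun x))) ∧
      ∀ᵐ x ∂(volume.restrict Ω), Tendsto (fun i => (v (ns i)).grad x) atTop (𝓝 (w.grad x)) := by
  have hp0 : ENNReal.ofReal p ≠ 0 := by
    simp only [ne_eq, ENNReal.ofReal_eq_zero, not_le]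
    linarith
  obtain ⟨n₁, hn₁, h1⟩ := exists_seq_tendsto_ae_of_eLpNorm hp0 (fun n => (v n).memLp.1) w.memLp.1
    hvw.1
  obtain ⟨n₂, hn₂, h2⟩ := exists_seq_tendsto_ae_of_eLpNorm hp0
    (fun n => (v (n₁ n)).memLp_grad.1) w.memLp_grad.1 (hvw.2.comp hn₁.tendsto_atTop)
  refine ⟨fun n => n₁ (n₂ n), hn₁.comp hn₂, ?_, h2⟩
  filter_upwards [h1] with x hx
  exact hx.comp hn₂.tendsto_atTop

/-- The whole integrand is bounded by a fixed function of the data and φ plus a constant times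
|Du|^p, the form required by generalised dominated convergence. -/
theorem NaturalGrowthData.norm_integrand_le (hD : NaturalGrowthData Ω p α β α₀ a a₀ H h f b)
    (hp : 1 < p) (hβ : 0 < β) {u φ : W01 Ω p} {C R : ℝ} (hC0 : 0 ≤ C)
    (hu : ∀ᵐ x ∂(volume.restrict Ω), |u.toFun x| ≤ C)
    (hφ : ∀ᵐ x ∂(volume.restrict Ω), |φ.toFun x| ≤ R) :
    ∀ᵐ x ∂(volume.restrict Ω),
      ‖inner ℝ (a x (u.toFun x) (u.grad x)) (φ.grad x - u.grad x)
        + a₀ x (u.toFun x) * (φ.toFun x - u.toFun x)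
        + H x (u.toFun x) (u.grad x) * (φ.toFun x - u.toFun x)‖ ≤
      2 ^ p * ‖φ.grad x‖ ^ p + β ^ (p / (p - 1)) * (4 ^ (p / (p - 1)) *
        (|h x| ^ (p / (p - 1)) + C ^ p)) + (β * (|h x| + C ^ (p - 1)) + supNorm Ω f) * (R + C) +
      (2 ^ p + β ^ (p / (p - 1)) * 4 ^ (p / (p - 1)) + b C * (R + C)) * ‖u.grad x‖ ^ p := by
  have hq0 := (holderConjugate_div hp).symm.pos
  filter_upwards [hu, hφ, hD.norm_a_le hp hβ hu u.grad, hD.abs_a₀_le hp hβ hu,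
    hD.abs_H_le hu u.grad, hD.f_le] with x h1 h2 h3 h4 h5 h6
  have hd : |φ.toFun x - u.toFun x| ≤ R + C := (abs_sub _ _).trans (add_le_add h2 h1)
  have k1 : ‖a x (u.toFun x) (u.grad x)‖ ^ (p / (p - 1)) ≤ β ^ (p / (p - 1)) *
      (4 ^ (p / (p - 1)) * (|h x| ^ (p / (p - 1)) + C ^ p + ‖u.grad x‖ ^ p)) := by
    refine (Real.rpow_le_rpow (norm_nonneg _) h3 hq0.le).trans ?_
    rw [Real.mul_rpow hβ.le (by positivity), ← rpow_sub_one_rpow hp hC0,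
      ← rpow_sub_one_rpow hp (norm_nonneg (u.grad x))]
    refine mul_le_mul_of_nonneg_left ?_ (by positivity)
    exact add_add_rpow_le hq0.le (by positivity) (by positivity) (by positivity)
  have k2 := norm_sub_rpow_le (by linarith : 0 ≤ p) (φ.grad x) (u.grad x)
  have k3 := mul_le_rpow_add_rpow hp one_pos (norm_nonneg (φ.grad x - u.grad x))
    (norm_nonneg (a x (u.toFun x) (u.grad x)))
  rw [Real.one_rpow, one_mul, div_one, one_mul] at k3
  have k4 : |a₀ x (u.toFun x) * (φ.toFun x - u.toFun x)| ≤
      β * (|h x| + C ^ (p - 1)) * (R + C) := by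
    rw [abs_mul]
    gcongr
  have k5 : |H x (u.toFun x) (u.grad x) * (φ.toFun x - u.toFun x)| ≤
      (supNorm Ω f + b C * ‖u.grad x‖ ^ p) * (R + C) := by
    rw [abs_mul]
    refine mul_le_mul (h5.trans (by linarith)) hd (abs_nonneg _) ?_
    exact (abs_nonneg _).trans (h5.trans (by linarith))
  refine (norm_add₃_le).trans ?_
  have k6 := (norm_inner_le_norm (𝕜 := ℝ) (a x (u.toFun x) (u.grad x))
    (φ.grad x - u.grad x)).trans (k3.trans (add_le_add k2 k1))
  rw [Real.norm_eq_abs] at k6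
  simp only [Real.norm_eq_abs]
  linarith

variable [IsFiniteMeasure (volume.restrict Ω)]

theorem NaturalGrowthData.integral_add_eq (hD : NaturalGrowthData Ω p α β α₀ a a₀ H h f b)
    (hp : 1 < p) (hβ : 0 < β) {u φ : W01 Ω p} {C R : ℝ}
    (hu : ∀ᵐ x ∂(volume.restrict Ω), |u.toFun x| ≤ C)
    (hφ : ∀ᵐ x ∂(volume.restrict Ω), |φ.toFun x| ≤ R) :
    Integrable (fun x => inner ℝ (a x (u.toFun x) (u.grad x)) (φ.grad x - u.grad x)
      + a₀ x (u.toFun x) * (φ.toFun x - u.toFun x)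
      + H x (u.toFun x) (u.grad x) * (φ.toFun x - u.toFun x)) (volume.restrict Ω) ∧
    ∫ x in Ω, inner ℝ (a x (u.toFun x) (u.grad x)) (φ.grad x - u.grad x)
      + a₀ x (u.toFun x) * (φ.toFun x - u.toFun x)
      + H x (u.toFun x) (u.grad x) * (φ.toFun x - u.toFun x) =
    (∫ x in Ω, inner ℝ (a x (u.toFun x) (u.grad x)) (φ.grad x - u.grad x))
      + (∫ x in Ω, a₀ x (u.toFun x) * (φ.toFun x - u.toFun x))
      + ∫ x in Ω, H x (u.toFun x) (u.grad x) * (φ.toFun x - u.toFun x) := by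
  have hm : AEStronglyMeasurable (fun x => φ.toFun x - u.toFun x) (volume.restrict Ω) :=
    φ.memLp.1.sub u.memLp.1
  have hb : ∀ᵐ x ∂(volume.restrict Ω), ‖φ.toFun x - u.toFun x‖ ≤ R + C := by
    filter_upwards [hu, hφ] with x h1 h2
    exact (norm_sub_le _ _).trans (add_le_add h2 h1)
  have i1 : Integrable (fun x => inner ℝ (a x (u.toFun x) (u.grad x)) (φ.grad x - u.grad x))
      (volume.restrict Ω) := integrable_inner_of_memLp (holderConjugate_div hp).symm
    (hD.memLp_a hp hβ u.memLp.1 hu u.memLp_grad) (φ.memLp_grad.sub u.memLp_grad)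
  have i2 := (hD.integrable_a₀ hp hβ u.memLp.1 hu).mul_bdd hm hb
  have i3 := (hD.integrable_H hp u.memLp.1 hu u.memLp_grad).mul_bdd hm hb
  refine ⟨(i1.add i2).add i3, ?_⟩
  exact (integral_add (i1.add i2) i3).trans (congrArg (· + _) (integral_add i1 i2))

/-- Along a subsequence, functions and gradients converge a.e., so the merged integrand converges
a.e., including H_j since j → ∞. Its majorant contains |Dv_n|^p ≤ 2^p(|Dw|^p + |Dv_n − Dw|^p), a
fixed integrable part plus an L¹-null part. -/
theorem IsObstacleSolution.of_strongConv (hD : NaturalGrowthData Ω p α β α₀ a a₀ H h f b)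
    (hp : 1 < p) (hα : 0 < α) (hβ : 0 < β) (hα₀ : 0 < α₀) (hψ : ψ.Bounded) {j : ℕ → ℕ}
    (hj : Tendsto j atTop atTop)
    (hv : ∀ n, IsObstacleSolution a a₀ (truncH H (j n)) ψ (v n)) (hvw : W01.StrongConv v w) :
    IsObstacleSolution a a₀ H ψ w := by
  have hp0 : 0 < p := by linarith
  have hpq := holderConjugate_div hp
  set C := CInfty (supNorm Ω f) α₀ p (supNorm Ω ψ.toFun)
  have hC0 : 0 ≤ C := CInfty_nonneg (supNorm_nonneg _)
  have hC : ∀ n, ∀ᵐ x ∂(volume.restrict Ω), |(v n).toFun x| ≤ C := fun n =>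
    (hv n).ae_abs_le (hD.truncH _) hp hα hβ hα₀ hψ
  obtain ⟨ns, hns, hfun, hgrad⟩ := hvw.exists_subseq_tendsto_ae hp
  have hwC : ∀ᵐ x ∂(volume.restrict Ω), |w.toFun x| ≤ C := by
    filter_upwards [hfun, ae_all_iff.2 hC] with x h1 h2
    exact le_of_tendsto' h1.abs fun i => h2 _
  refine ⟨?_, W01.bounded_of_ae_abs_le hwC, fun φ hφ hφb => ?_⟩
  · have h1 : ∀ n, ∀ᵐ x ∂(volume.restrict Ω), ψ.toFun x ≤ (v n).toFun x := fun n => (hv n).1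
    change ∀ᵐ x ∂(volume.restrict Ω), ψ.toFun x ≤ w.toFun x
    filter_upwards [hfun, ae_all_iff.2 h1] with x h1 h2
    exact ge_of_tendsto' h1 fun i => h2 _
  set R := supNorm Ω φ.toFun
  have hR0 : 0 ≤ R := supNorm_nonneg _
  have hR : ∀ᵐ x ∂(volume.restrict Ω), |φ.toFun x| ≤ R := hφb.ae_abs_le
  have hsplit := fun n => (hD.truncH (j n)).integral_add_eq hp hβ (hC n) hR
  rw [← (hD.integral_add_eq hp hβ hwC hR).2]
  have hbC : 0 < b C := hD.b_pos C hC0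
  set c := 2 ^ p + β ^ (p / (p - 1)) * 4 ^ (p / (p - 1)) + b C * (R + C) with hc
  have hc0 : 0 ≤ c := by positivity
  have hdi : ∀ n, MemLp (fun x => (v n).grad x - w.grad x) (ENNReal.ofReal p)
      (volume.restrict Ω) := fun n => (v n).memLp_grad.sub w.memLp_grad
  have hwi := w.memLp_grad.integrable_rpow_norm hp0
  refine ge_of_tendsto' (integrable_and_tendsto_integral_of_norm_le_add
    (fun i => (hsplit (ns i)).1.1) ?_
    (g := fun x => 2 ^ p * ‖φ.grad x‖ ^ p + β ^ (p / (p - 1)) * (4 ^ (p / (p - 1)) *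
        (|h x| ^ (p / (p - 1)) + C ^ p)) + (β * (|h x| + C ^ (p - 1)) + supNorm Ω f) * (R + C) +
        c * (2 ^ p * ‖w.grad x‖ ^ p))
    (e := fun i x => c * (2 ^ p * ‖(v (ns i)).grad x - w.grad x‖ ^ p)) ?_
    (fun i => (((hdi _).integrable_rpow_norm hp0).const_mul _).const_mul _)
    (fun i => .of_forall fun x => by positivity) ?_ fun i => ?_).2 fun i => ?_
  · filter_upwards [hfun, hgrad, hD.a_caratheodory.2, hD.a₀_caratheodory.2,
      hD.H_caratheodory.2] with x h1 h2 h3 h4 h5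
    have ha : Tendsto (fun i => a x ((v (ns i)).toFun x) ((v (ns i)).grad x)) atTop
        (𝓝 (a x (w.toFun x) (w.grad x))) :=
      (h3.tendsto (w.toFun x, w.grad x)).comp (h1.prodMk_nhds h2)
    have hd := h1.const_sub (φ.toFun x)
    exact ((ha.inner (h2.const_sub (φ.grad x))).add (((h4.tendsto _).comp h1).mul hd)).add
      ((tendsto_truncH (hj.comp hns.tendsto_atTop) h5 h1 h2).mul hd)
  · have hh : Integrable h (volume.restrict Ω) := memLp_one_iff_integrable.1
      (hD.h_memLp.mono_exponent (by simpa using hpq.symm.lt.le))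
    exact ((((φ.memLp_grad.integrable_rpow_norm hp0).const_mul _).add
      ((((hD.h_memLp.integrable_rpow_norm hpq.symm.pos).add (integrable_const _)).const_mul
        _).const_mul _)).add ((((hh.abs.add (integrable_const _)).const_mul β).add
          (integrable_const _)).mul_const _)).add ((hwi.const_mul _).const_mul _)
  · have h1 := (tendsto_eLpNorm_ofReal_zero_iff hp0 hdi).1 hvw.2
    have h2 := ((h1.comp hns.tendsto_atTop).const_mul (2 ^ p)).const_mul c
    rw [mul_zero, mul_zero] at h2
    refine h2.congr fun i => ?_
    rw [integral_const_mul, integral_const_mul]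
    rfl
  · filter_upwards [(hD.truncH (j (ns i))).norm_integrand_le hp hβ hC0 (hC (ns i)) hR] with x hx
    refine hx.trans ?_
    rw [add_assoc _ (c * _), ← mul_add]
    refine add_le_add le_rfl (mul_le_mul_of_nonneg_left ?_ hc0)
    have h1 := norm_sub_rpow_le hp0.le (w.grad x) (w.grad x - (v (ns i)).grad x)
    rw [sub_sub_cancel, norm_sub_rev (w.grad x)] at h1
    linarith
  · rw [(hsplit (ns i)).2]
    exact (hv (ns i)).2.2 φ hφ hφb

end Limit

/-! ### Continuity of C_∞ and the main theorem -/

/-- The base of the power may vanish, when ‖f‖_∞ = 0; continuity persists there because the exponent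
1/(p − 1) is positive. -/
theorem continuousOn_CInfty :
    ContinuousOn (fun q : ℝ × ℝ × ℝ × ℝ => CInfty q.1 q.2.1 q.2.2.1 q.2.2.2)
      {q | 0 ≤ q.1 ∧ 0 < q.2.1 ∧ 1 < q.2.2.1 ∧ 0 ≤ q.2.2.2} := by
  unfold CInfty
  refine ContinuousOn.sup ?_ (by fun_prop)
  refine ContinuousOn.rpow (ContinuousOn.div (by fun_prop) (by fun_prop) fun q hq => hq.2.1.ne')
    (ContinuousOn.div (by fun_prop) (by fun_prop) fun q hq => ?_) fun q hq => Or.inr ?_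
  · exact (sub_pos.2 hq.2.2.1).ne'
  · exact one_div_pos.2 (sub_pos.2 hq.2.2.1)

end

theorem mainTheorem2 :
    -- `M` depends on `p, α, |Ω|, β` only; `M'` depends on `p, α, |Ω|, β` and `b(0)` only
    ∃ (M : ℝ → ℝ → ℝ → ℝ → ℝ) (M' : ℝ → ℝ → ℝ → ℝ → ℝ → ℝ),
      (∀ p α m β : ℝ, 0 < M p α m β) ∧ (∀ p α m β b₀ : ℝ, 0 < M' p α m β b₀) ∧
      -- `C_∞` depends continuously on `‖f‖_∞, α₀, p, ‖ψ‖_∞`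
      ContinuousOn (fun q : ℝ × ℝ × ℝ × ℝ => CInfty q.1 q.2.1 q.2.2.1 q.2.2.2)
        {q | 0 ≤ q.1 ∧ 0 < q.2.1 ∧ 1 < q.2.2.1 ∧ 0 ≤ q.2.2.2} ∧
      ∀ (N : ℕ) (Ω : Set (RN N)) (p α β α₀ : ℝ)
        (a : RN N → ℝ → RN N → RN N) (a₀ : RN N → ℝ → ℝ) (H : RN N → ℝ → RN N → ℝ)
        (h f : RN N → ℝ) (b : ℝ → ℝ) (ψ : W01 Ω p) (u : ℕ → W01 Ω p),
        1 ≤ N → IsOpen Ω → Bornology.IsBounded Ω →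
        1 < p → 0 < α → 0 < β → 0 < α₀ →
        NaturalGrowthData Ω p α β α₀ a a₀ H h f b →
        ψ.Bounded →
        (∀ j : ℕ, 1 ≤ j → IsObstacleSolution a a₀ (truncH H j) ψ (u j)) →
        -- uniform estimates for the approximating solutions
        (∀ j : ℕ, 1 ≤ j →
          SatisfiesEstimates (M p α (volume Ω).toReal β) (M' p α (volume Ω).toReal β (b 0))
            α α₀ h f b ψ (u j)) ∧
        -- strong compactness
        (∃ (k : ℕ → ℕ) (w : W01 Ω p), StrictMono k ∧ W01.StrongConv (fun n => u (k n)) w) ∧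
        -- every limit point solves the obstacle problem and inherits the estimates
        (∀ (k : ℕ → ℕ) (w : W01 Ω p), StrictMono k → W01.StrongConv (fun n => u (k n)) w →
          IsObstacleSolution a a₀ H ψ w ∧
          SatisfiesEstimates (M p α (volume Ω).toReal β) (M' p α (volume Ω).toReal β (b 0))
            α α₀ h f b ψ w) := by
  refine ⟨fun p α m β => estimateConst p α m β 1,
    fun p α m β b₀ => estimateConst p α m β (1 + 4 * α ^ 2 / b₀ ^ 2),
    fun _ _ _ _ => estimateConst_pos _ _ _ _ _, fun _ _ _ _ _ => estimateConst_pos _ _ _ _ _,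
    continuousOn_CInfty, ?_⟩
  intro N Ω p α β α₀ a a₀ H h f b ψ u _ hΩ hΩb hp hα hβ hα₀ hD hψ hu
  have : IsFiniteMeasure (volume.restrict Ω) :=
    ⟨by rw [Measure.restrict_apply_univ]; exact hΩb.measure_lt_top⟩
  refine ⟨fun j hj => (hu j hj).satisfiesEstimates (hD.truncH j) hp hα hβ hα₀ hψ, ?_, ?_⟩
  -- The index is shifted because u_j is a solution only for j ≥ 1.
  · obtain ⟨k, w, hk, hkw⟩ := exists_subseq_strongConv (v := fun n => u (n + 1)) hΩ
      (fun n => hD.truncH (n + 1)) hp hα hβ hα₀ hψ fun n => hu (n + 1) n.succ_pos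
    exact ⟨fun n => k n + 1, w, fun m n hmn => Nat.succ_lt_succ (hk hmn), hkw⟩
  · intro k w hk hkw
    -- Dropping the first term guarantees indices at least 1, as k 0 may be 0.
    have hs : StrictMono fun n => k (n + 1) := fun m n hmn => hk (Nat.succ_lt_succ hmn)
    have hw : IsObstacleSolution a a₀ H ψ w :=
      IsObstacleSolution.of_strongConv hD hp hα hβ hα₀ hψ hs.tendsto_atTop
        (fun n => hu _ ((Nat.succ_le_succ n.zero_le).trans hk.le_apply))
        ⟨hkw.1.comp (tendsto_add_atTop_nat 1), hkw.2.comp (tendsto_add_atTop_nat 1)⟩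
    -- No limit is taken in the estimates: w solves the problem for H, and the a priori bounds hold
    -- for every solution.
    exact ⟨hw, hw.satisfiesEstimates hD hp hα hβ hα₀ hψ⟩
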